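/- **Theorem 1.2.** A Littlewood polynomial is a polynomial all of whose coefficients, from the constant term up to the leading term, belong to $\{-1,1\}$. There exist absolute constants $0<\eta_1<\eta_2$ and $\eta>0$, a sequence of integers $(m_n)_{n\ge 1}$, and a sequence $(P_{2n})_{n\ge 1}$ of Littlewood polynomials $P_{2n}$ of degree $2n$, $$P_{2n}(z)=\sum_{j=0}^{2n}a_{j,n}z^j,\qquad a_{j,n}\in\{-1,1\},\quad j=0,1,\ldots,2n,$$ such that for every integer $n\ge 1$ $$\eta_1\sqrt{2n}\le |P_{2n}(z)|\le \eta_2\sqrt{2n},\qquad z\in\mathbb C,\ |z|=1,$$ $$\eta n\le m_n\le n,$$ $$a_{j,n}=-a_{2n-j,n},\qquad 0\le j<n-m_n,$$ and $$a_{j,n}=(-1)^{n-j}a_{2n-j,n},\qquad n-m_n\le j\le n.$$ -/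

import Mathlib

/-- A Littlewood polynomial of degree `d`: a polynomial of degree `d` all of whose coefficients
`a_0, …, a_d` belong to `{-1, 1}`, regarded as a polynomial over the complex numbers. -/
def IsLittlewood (d : ℕ) (p : Polynomial ℂ) : Prop :=
  p.natDegree = d ∧ ∀ j : ℕ, j ≤ d → p.coeff j = -1 ∨ p.coeff j = 1

/-!
The coefficients of `P` prescribed by a symmetry type and by signs `ε k` around the middle make
`z ^ (-n) P (z)`, at `z = exp (i θ)`, equal to `A (θ) + 2 i S (θ)`. Here `A` is a real cosine
polynomial in the even frequencies up to `m`, and `S` is a sine polynomial in all other frequencies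
(`eval_symmPoly`). Both have signs as coefficients, up to a factor `2`, so it suffices to find signs
for which `A` and `S` are `O(sqrt n)`, and which leave no point where both are small compared with
`sqrt n`.

For `A (θ)` one takes `a (2 θ)`, where `a` is the cosine polynomial `rsSum` whose coefficients are
those of a Rudin–Shapiro polynomial of degree about `L = 4 ^ s`, with `n / L` between two fixed large
constants. It is `O(sqrt L)` everywhere. It is also of order `sqrt L` somewhere in every arc
of length `O(1 / L)`: the Fejér averages of `a` centred at the boundaries of the four blocks of its
coefficients cannot all be small, by the Rudin–Shapiro identity (`exists_tent_rsSum_gt`,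
`exists_near_rsSum_gt`). Together with Bernstein's inequality, Taylor's formula and repeated use of
the mean value theorem this limits the set where `a` is small: when the circle is cut into cells of
length `η / L`, the number of cells meeting that set in any window of length `κ / L` is at most a
constant `D` which does not depend on `η` (`exists_card_small_cells_rsSum_le`).

Since these cells form a sparse set `B`, their neighbourhoods split into short runs. The Fejér mean
of a step function which is a constant sign on each run, zero on all other cells, and odd, is a sine
polynomial of absolute value at least `1 / 2` on the cells of `B`. Multiplied by a large constant
times `sqrt n` it still has coefficients in `[-1, 1]`, provided that the signs of the runs are chosen
so that all Fourier coefficients are small (`exists_cell_signs`, `exists_large_sineSum`). Its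
coefficients are then rounded to signs, at the cost of an error of at most `60000 sqrt n`
(`exists_rounded_signs`), which the large constant dominates.

Both choices of signs come from a discrepancy theorem in the manner of Spencer: a point of the cube
`[-1, 1] ^ r` can be rounded to a vertex with an error `O(r ^ (1 / 8) m ^ (3 / 8))` in each of `m ≥ r`
linear forms with coefficients in `[-1, 1]` (`exists_signs_approx`). It is proved by the pigeonhole
principle applied to rounded discrepancies. The exponents give `O(sqrt n)` when `r` and `m` are
comparable to `n`, and a gain of `(r / n) ^ (1 / 8)` when there are few signs, which pays for the
large constant. A bound on the whole circle follows from bounds on a grid of `3 n` points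
(`norm_trigSum_le_of_grid`).

This covers all large `n`. For the remaining finitely many `n` the polynomial with `m = n` and all
`ε k = 1` is used, which has no zero on the unit circle (`eval_symmPoly_one_ne_zero`).
-/

/-! ### Discrepancy -/

/-- The `±1` colouring with value `1` exactly on `S`. -/
def signOf {ι : Type*} [DecidableEq ι] (S : Finset ι) (i : ι) : ℝ := if i ∈ S then 1 else -1

section Discrepancy

variable {ι κ : Type*} [DecidableEq ι] [Fintype κ]

/-- Second and fourth moments of a sum with random signs, the signs being indexed by the set of
places where they are positive. -/
theorem sum_signOf_moments (a : ι → ℝ) (V : Finset ι) :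
    ∑ S ∈ V.powerset, (∑ i ∈ V, a i * signOf S i) ^ 2 = 2 ^ V.card * ∑ i ∈ V, a i ^ 2 ∧
    ∑ S ∈ V.powerset, (∑ i ∈ V, a i * signOf S i) ^ 4 ≤
      3 * 2 ^ V.card * (∑ i ∈ V, a i ^ 2) ^ 2 := by
  induction V using Finset.induction_on with
  | empty => simp
  | insert v V hv ih =>
    obtain ⟨ih2, ih4⟩ := ih
    have h0 : ∀ S ∈ V.powerset, ∑ i ∈ insert v V, a i * signOf S i =
        (∑ i ∈ V, a i * signOf S i) - a v := by
      intro S hS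
      rw [Finset.sum_insert hv]
      have : v ∉ S := fun h => hv (Finset.mem_powerset.1 hS h)
      simp [signOf, this]; ring
    have h1 : ∀ S ∈ V.powerset, ∑ i ∈ insert v V, a i * signOf (insert v S) i =
        (∑ i ∈ V, a i * signOf S i) + a v := by
      intro S hS
      rw [Finset.sum_insert hv]
      have : ∑ i ∈ V, a i * signOf (insert v S) i = ∑ i ∈ V, a i * signOf S i := by
        refine Finset.sum_congr rfl fun i hi => ?_
        have : i ≠ v := fun h => hv (h ▸ hi)
        simp [signOf, this]
      rw [this]
      simp [signOf]; ring
    have key : ∀ d : ℕ, ∑ S ∈ (insert v V).powerset, (∑ i ∈ insert v V, a i * signOf S i) ^ d =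
        ∑ S ∈ V.powerset, (((∑ i ∈ V, a i * signOf S i) - a v) ^ d +
          ((∑ i ∈ V, a i * signOf S i) + a v) ^ d) := by
      intro d
      rw [Finset.sum_powerset_insert hv, ← Finset.sum_add_distrib]
      exact Finset.sum_congr rfl fun S hS => by rw [h0 S hS, h1 S hS]
    constructor
    · rw [key, Finset.card_insert_of_notMem hv, Finset.sum_insert hv]
      have : ∀ S ∈ V.powerset, ((∑ i ∈ V, a i * signOf S i) - a v) ^ 2 +
          ((∑ i ∈ V, a i * signOf S i) + a v) ^ 2 =
          2 * (∑ i ∈ V, a i * signOf S i) ^ 2 + 2 * a v ^ 2 := fun S _ => by ring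
      rw [Finset.sum_congr rfl this, Finset.sum_add_distrib, ← Finset.mul_sum, ih2]
      simp [Finset.card_powerset]; ring
    · rw [key, Finset.card_insert_of_notMem hv, Finset.sum_insert hv]
      have : ∀ S ∈ V.powerset, ((∑ i ∈ V, a i * signOf S i) - a v) ^ 4 +
          ((∑ i ∈ V, a i * signOf S i) + a v) ^ 4 =
          2 * (∑ i ∈ V, a i * signOf S i) ^ 4 +
            (12 * a v ^ 2) * (∑ i ∈ V, a i * signOf S i) ^ 2 + 2 * a v ^ 4 := fun S _ => by ring
      rw [Finset.sum_congr rfl this, Finset.sum_add_distrib, Finset.sum_add_distrib,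
        ← Finset.mul_sum, ← Finset.mul_sum, ih2]
      simp only [Finset.sum_const, Finset.card_powerset, nsmul_eq_mul, Nat.cast_pow,
        Nat.cast_ofNat]
      have hp : (0 : ℝ) < 2 ^ V.card := by positivity
      have := mul_nonneg hp.le (sq_nonneg (a v ^ 2))
      have e : 3 * 2 ^ (V.card + 1) * (a v ^ 2 + ∑ i ∈ V, a i ^ 2) ^ 2 =
          6 * (2 ^ V.card * (a v ^ 2) ^ 2) + 12 * a v ^ 2 * (2 ^ V.card * ∑ i ∈ V, a i ^ 2) +
            2 * (3 * 2 ^ V.card * (∑ i ∈ V, a i ^ 2) ^ 2) := by ring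
      have e' : 2 ^ V.card * (2 * a v ^ 4) = 2 * (2 ^ V.card * (a v ^ 2) ^ 2) := by ring
      rw [e, e']
      linarith

theorem sum_signOf_pow_four_le {a : ι → ℝ} (V : Finset ι) (ha : ∀ i, |a i| ≤ 1) :
    ∑ S ∈ V.powerset, (∑ i ∈ V, a i * signOf S i) ^ 4 ≤ 3 * 2 ^ V.card * (V.card : ℝ) ^ 2 := by
  refine (sum_signOf_moments a V).2.trans ?_
  have : ∑ i ∈ V, a i ^ 2 ≤ V.card := by
    calc ∑ i ∈ V, a i ^ 2 ≤ ∑ i ∈ V, (1 : ℝ) :=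
          Finset.sum_le_sum fun i _ => (sq_le_one_iff_abs_le_one _).2 (ha i)
      _ = V.card := by simp
  have h0 : 0 ≤ ∑ i ∈ V, a i ^ 2 := Finset.sum_nonneg fun i _ => sq_nonneg _
  gcongr

/-- A rounded value vanishes unless `|y| ≥ 1 / 2`, so that fourth moments control its mean. -/
theorem natAbs_round_le (y : ℝ) : ((round y).natAbs : ℝ) ≤ (2 * y) ^ 4 := by
  rcases eq_or_ne (round y) 0 with h | h
  · rw [h]; simp; positivity
  · have h1 : (1 : ℝ) ≤ |(round y : ℝ)| := by
      exact_mod_cast Int.one_le_abs h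
    have h2 := abs_sub_round y
    have h3 : |(round y : ℝ)| ≤ |y| + 1 / 2 := by
      have := abs_sub_abs_le_abs_sub (round y : ℝ) y
      rw [abs_sub_comm] at this; linarith
    have h4 : (1 : ℝ) ≤ 2 * |y| := by linarith
    have h5 : ((round y).natAbs : ℝ) = |(round y : ℝ)| := by
      rw [Nat.cast_natAbs]; simp
    rw [h5]
    have h6 : (2 * y) ^ 4 = (2 * |y|) ^ 4 := by
      rw [mul_pow, mul_pow, Even.pow_abs (by decide)]
    rw [h6]
    calc |(round y : ℝ)| ≤ 2 * |y| := by linarith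
      _ ≤ (2 * |y|) ^ 4 := le_self_pow₀ h4 (by norm_num)

theorem sum_Icc_neg_eq {M : Type*} [AddCommMonoid M] (N : ℕ) (g : ℤ → M) :
    ∑ k ∈ Finset.Icc (-(N : ℤ)) N, g k =
      g 0 + ∑ k ∈ Finset.range N, (g ((k : ℤ) + 1) + g (-((k : ℤ) + 1))) := by
  induction N with
  | zero => simp
  | succ N ih =>
    have : Finset.Icc (-((N + 1 : ℕ) : ℤ)) ((N + 1 : ℕ) : ℤ) =
        insert ((N : ℤ) + 1) (insert (-((N : ℤ) + 1)) (Finset.Icc (-(N : ℤ)) N)) := by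
      ext k; simp; omega
    rw [this, Finset.sum_insert (by simp; omega), Finset.sum_insert (by simp), ih,
      Finset.sum_range_succ]
    ac_rfl

/-- A two-sided geometric sum, the generating function for counting integers by size. -/
theorem sum_pow_natAbs_le {t : ℝ} (ht0 : 0 ≤ t) (ht : t ≤ 1 / 2) (w : ℕ) :
    ∑ k ∈ Finset.Icc (-(w : ℤ)) w, t ^ k.natAbs ≤ 1 + 4 * t := by
  rw [sum_Icc_neg_eq]
  have h : ∀ k : ℕ, t ^ ((k : ℤ) + 1).natAbs + t ^ (-((k : ℤ) + 1)).natAbs = 2 * t * t ^ k := by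
    intro k
    have h1 : ((k : ℤ) + 1).natAbs = k + 1 := by omega
    have h2 : (-((k : ℤ) + 1)).natAbs = k + 1 := by omega
    rw [h1, h2, pow_succ]; ring
  rw [Finset.sum_congr rfl fun k _ => h k, ← Finset.mul_sum]
  have h1 : ∑ k ∈ Finset.range w, t ^ k ≤ 2 := by
    have := geom_sum_mul t w
    have h2 : 0 ≤ t ^ w := by positivity
    have h3 : 0 ≤ ∑ k ∈ Finset.range w, t ^ k := Finset.sum_nonneg fun _ _ => by positivity
    nlinarith
  simp
  nlinarith

/-- An upper bound for the number of integer vectors of small `ℓ¹` norm. -/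
theorem card_mul_pow_le_of_natAbs_sum_le (B : Finset (κ → ℤ)) (w : ℕ)
    (hB : ∀ b ∈ B, ∑ j, (b j).natAbs ≤ w) {t : ℝ} (ht0 : 0 < t) (ht : t ≤ 1 / 2) :
    (B.card : ℝ) * t ^ w ≤ Real.exp (4 * t * Fintype.card κ) := by
  classical
  have h1 : (B.card : ℝ) * t ^ w ≤ ∑ b ∈ B, ∏ j, t ^ (b j).natAbs := by
    rw [← nsmul_eq_mul]
    refine Finset.card_nsmul_le_sum _ _ _ fun b hb => ?_
    rw [Finset.prod_pow_eq_pow_sum]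
    exact pow_le_pow_of_le_one ht0.le (by linarith) (hB b hb)
  have h2 : B ⊆ Fintype.piFinset (fun _ : κ => Finset.Icc (-(w : ℤ)) w) := by
    intro b hb
    rw [Fintype.mem_piFinset]
    intro j
    have := (Finset.single_le_sum (f := fun j => (b j).natAbs) (fun _ _ => Nat.zero_le _)
      (Finset.mem_univ j)).trans (hB b hb)
    simp only [Finset.mem_Icc]
    omega
  refine h1.trans ((Finset.sum_le_sum_of_subset_of_nonneg h2
    fun _ _ _ => Finset.prod_nonneg fun _ _ => by positivity).trans ?_)
  rw [← Finset.prod_univ_sum (fun _ : κ => Finset.Icc (-(w : ℤ)) w) (fun _ k => t ^ k.natAbs)]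
  rw [Finset.prod_const, Finset.card_univ]
  calc (∑ k ∈ Finset.Icc (-(w : ℤ)) w, t ^ k.natAbs) ^ Fintype.card κ
      ≤ (Real.exp (4 * t)) ^ Fintype.card κ := by
        gcongr
        refine (sum_pow_natAbs_le ht0.le ht w).trans ?_
        linarith [Real.add_one_le_exp (4 * t)]
    _ = _ := by rw [← Real.exp_nat_mul]; ring_nf

theorem ten_le_exp_three : (10 : ℝ) ≤ Real.exp 3 := by
  have h := Real.exp_one_gt_d9
  have : Real.exp 3 = Real.exp 1 ^ 3 := by rw [← Real.exp_nat_mul]; norm_num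
  rw [this]
  calc (10 : ℝ) ≤ 2.7 ^ 3 := by norm_num
    _ ≤ _ := by gcongr; linarith

/-- Volume bound for the Hamming ball of radius `|V| / 100`. -/
theorem card_hammingBall_le (V S₀ : Finset ι) (hS₀ : S₀ ⊆ V) :
    (((V.powerset.filter fun S => (100 * (symmDiff S S₀).card ≤ V.card)).card : ℕ) : ℝ) ≤
      Real.exp (0.13 * V.card) := by
  have h1 : (((V.powerset.filter fun S => (100 * (symmDiff S S₀).card ≤ V.card)).card : ℕ) : ℝ) *
      Real.exp (-(0.03 * V.card)) ≤ ∑ T ∈ V.powerset, (1 / 10 : ℝ) ^ T.card := by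
    rw [← nsmul_eq_mul]
    have h2 : ∑ S ∈ V.powerset.filter fun S => (100 * (symmDiff S S₀).card ≤ V.card),
        (1 / 10 : ℝ) ^ (symmDiff S S₀).card ≤ ∑ T ∈ V.powerset, (1 / 10 : ℝ) ^ T.card := by
      rw [← Finset.sum_image (f := fun T : Finset ι => (1 / 10 : ℝ) ^ T.card)
        (g := fun S => symmDiff S S₀) (fun S _ S' _ h => symmDiff_left_injective S₀ h)]
      refine Finset.sum_le_sum_of_subset_of_nonneg ?_ fun _ _ _ => by positivity
      intro T hT
      obtain ⟨S, hS, rfl⟩ := Finset.mem_image.1 hT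
      have hS := Finset.mem_powerset.1 (Finset.mem_filter.1 hS).1
      refine Finset.mem_powerset.2 fun x hx => ?_
      rcases Finset.mem_symmDiff.1 hx with h | h
      · exact hS h.1
      · exact hS₀ h.1
    refine le_trans (Finset.card_nsmul_le_sum _ _ _ fun S hS => ?_) h2
    have hc := (Finset.mem_filter.1 hS).2
    have hc' : (100 : ℝ) * (symmDiff S S₀).card ≤ V.card := by exact_mod_cast hc
    have : (1 / 10 : ℝ) ^ (symmDiff S S₀).card ≥ Real.exp (-3) ^ (symmDiff S S₀).card := by
      gcongr
      rw [Real.exp_neg, one_div]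
      exact inv_anti₀ (by norm_num) ten_le_exp_three
    refine le_trans ?_ this
    rw [← Real.exp_nat_mul]
    apply Real.exp_le_exp.2
    linarith
  have h3 : ∑ T ∈ V.powerset, (1 / 10 : ℝ) ^ T.card ≤ Real.exp (0.1 * V.card) := by
    have := Finset.sum_pow_mul_eq_add_pow (1 / 10 : ℝ) 1 V
    simp only [one_pow, mul_one] at this
    rw [this, mul_comm (0.1 : ℝ), Real.exp_nat_mul]
    gcongr
    linarith [Real.add_one_le_exp (0.1 : ℝ)]
  have h4 := h1.trans h3
  rw [Real.exp_neg, ← div_eq_mul_inv, div_le_iff₀ (Real.exp_pos _), ← Real.exp_add] at h4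
  refine h4.trans (Real.exp_le_exp.2 ?_)
  linarith

theorem signOf_eq_or (S : Finset ι) (i : ι) : signOf S i = 1 ∨ signOf S i = -1 := by
  unfold signOf; split_ifs <;> simp

theorem signOf_sub_of_notMem {S T : Finset ι} {i : ι} (h : i ∉ symmDiff S T) :
    signOf S i - signOf T i = 0 := by
  rw [Finset.mem_symmDiff] at h
  by_cases h1 : i ∈ S <;> by_cases h2 : i ∈ T <;> simp [signOf, h1, h2] at h ⊢

theorem signOf_sub_of_mem {S T : Finset ι} {i : ι} (h : i ∈ symmDiff S T) :
    signOf S i - signOf T i = 2 * signOf S i := by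
  rw [Finset.mem_symmDiff] at h
  rcases h with ⟨h1, h2⟩ | ⟨h1, h2⟩ <;> simp [signOf, h1, h2] <;> norm_num

/-- At least half of the colourings have small total rounded discrepancy. -/
theorem half_le_card_small_round (V : Finset ι) {a : κ → ι → ℝ} (ha : ∀ j i, |a j i| ≤ 1)
    {Δ : ℝ} (hΔ : 0 < Δ) {w : ℝ} (hw : 0 < w)
    (hwΔ : 6 * Fintype.card κ * (V.card : ℝ) ^ 2 ≤ w * Δ ^ 4) :
    (2 : ℝ) ^ V.card ≤ 2 * ((V.powerset.filter fun S =>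
      ((∑ j, (round ((∑ i ∈ V, a j i * signOf S i) / (2 * Δ))).natAbs : ℕ) : ℝ) ≤ w).card : ℝ) := by
  set f : Finset ι → ℝ := fun S =>
    ((∑ j, (round ((∑ i ∈ V, a j i * signOf S i) / (2 * Δ))).natAbs : ℕ) : ℝ) with hf
  have h1 : ∑ S ∈ V.powerset, f S ≤ Fintype.card κ * (3 * 2 ^ V.card * (V.card : ℝ) ^ 2) / Δ ^ 4 := by
    calc ∑ S ∈ V.powerset, f S
        ≤ ∑ S ∈ V.powerset, ∑ j, (∑ i ∈ V, a j i * signOf S i) ^ 4 / Δ ^ 4 := by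
          refine Finset.sum_le_sum fun S _ => ?_
          simp only [hf, Nat.cast_sum]
          refine Finset.sum_le_sum fun j _ => (natAbs_round_le _).trans (le_of_eq ?_)
          rw [← div_pow]; congr 1; field_simp
      _ = ∑ j, (∑ S ∈ V.powerset, (∑ i ∈ V, a j i * signOf S i) ^ 4) / Δ ^ 4 := by
          rw [Finset.sum_comm]; simp_rw [Finset.sum_div]
      _ ≤ ∑ j : κ, (3 * 2 ^ V.card * (V.card : ℝ) ^ 2) / Δ ^ 4 := by
          gcongr with j
          exact sum_signOf_pow_four_le V (ha j)
      _ = _ := by simp [Finset.sum_const, mul_div_assoc]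
  have h2 : w * ((V.powerset.filter fun S => ¬ f S ≤ w).card : ℝ) ≤ ∑ S ∈ V.powerset, f S := by
    rw [mul_comm, ← nsmul_eq_mul]
    refine le_trans (Finset.card_nsmul_le_sum _ _ _ fun S hS => ?_)
      (Finset.sum_le_sum_of_subset_of_nonneg (Finset.filter_subset _ _) fun S _ _ => ?_)
    · exact (not_le.1 (Finset.mem_filter.1 hS).2).le
    · exact Nat.cast_nonneg _
  have h3 := Finset.card_filter_add_card_filter_not (s := V.powerset) (fun S => f S ≤ w)
  rw [Finset.card_powerset] at h3
  have h3' : ((V.powerset.filter fun S => f S ≤ w).card : ℝ) +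
      ((V.powerset.filter fun S => ¬ f S ≤ w).card : ℝ) = 2 ^ V.card := by exact_mod_cast h3
  have h4 : w * ((V.powerset.filter fun S => ¬ f S ≤ w).card : ℝ) ≤ w * (2 ^ V.card / 2) := by
    refine h2.trans (h1.trans ?_)
    rw [div_le_iff₀ (by positivity)]
    have := mul_le_mul_of_nonneg_right hwΔ (show (0 : ℝ) ≤ 2 ^ V.card / 2 by positivity)
    nlinarith
  have h5 := le_of_mul_le_mul_left h4 hw
  linarith

/-- Partial colouring: two colourings with equal rounded discrepancies which differ in many places
have a half-difference that colours at least one hundredth of the points. -/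
theorem exists_partial_colouring (V : Finset ι) {a : κ → ι → ℝ} (ha : ∀ j i, |a j i| ≤ 1)
    (hV : 2 ≤ V.card) (hVκ : V.card ≤ Fintype.card κ) {Δ : ℝ} (hΔ : 0 < Δ)
    (hΔ8 : 10 ^ 6 * (V.card : ℝ) * (Fintype.card κ : ℝ) ^ 3 ≤ Δ ^ 8) :
    ∃ S₀ S₁ : Finset ι, S₀ ⊆ V ∧ S₁ ⊆ V ∧ V.card < 100 * (symmDiff S₁ S₀).card ∧
      ∀ j, |∑ i ∈ V, a j i * ((signOf S₁ i - signOf S₀ i) / 2)| ≤ Δ := by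
  classical
  set r : ℝ := (V.card : ℝ) with hr
  set m : ℝ := (Fintype.card κ : ℝ) with hm
  have hr2 : (2 : ℝ) ≤ r := by rw [hr]; exact_mod_cast hV
  have hrm : r ≤ m := by rw [hr, hm]; exact_mod_cast hVκ
  have hr0 : 0 < r := by linarith
  have hm0 : 0 < m := by linarith
  set w : ℝ := 6 * m * r ^ 2 / Δ ^ 4 with hw
  have hw0 : 0 < w := by positivity
  have hhalf := half_le_card_small_round V ha hΔ hw0 (by rw [hw]; field_simp; rfl)
  set b : Finset ι → κ → ℤ := fun S j => round ((∑ i ∈ V, a j i * signOf S i) / (2 * Δ)) with hb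
  set X := V.powerset.filter fun S => ((∑ j, (b S j).natAbs : ℕ) : ℝ) ≤ w with hX
  -- this `t` makes the counting bound `exp (4 t m)` equal to `exp (0.1 r)`
  set t : ℝ := r / (40 * m) with ht
  have ht0 : 0 < t := by positivity
  have ht1 : t ≤ 1 / 40 := by
    rw [ht, div_le_div_iff₀ (by positivity) (by norm_num)]; linarith
  have hcount := card_mul_pow_le_of_natAbs_sum_le (X.image b) ⌊w⌋₊ (by
    intro c hc
    obtain ⟨S, hS, rfl⟩ := Finset.mem_image.1 hc
    exact Nat.le_floor (Finset.mem_filter.1 hS).2) ht0 (by linarith)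
  have hexp1 : 4 * t * (Fintype.card κ : ℝ) = 0.1 * r := by
    rw [ht, ← hm]; field_simp; norm_num
  -- the factor `t ^ w` costs only a small exponential, because `w` is a small multiple of
  -- `r * sqrt (r / m)`, which absorbs `log (m / r)`
  have htw : Real.exp (-(0.1 * r)) ≤ t ^ ⌊w⌋₊ := by
    set s : ℝ := Real.sqrt (m / r) with hs
    have hs1 : 1 ≤ s := by
      rw [hs, Real.one_le_sqrt, le_div_iff₀ hr0]; linarith
    have hs2 : s ^ 2 = m / r := Real.sq_sqrt (by positivity)
    have hwle : w * (10 * s) ≤ 0.1 * r := by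
      have h4 : 1000 * r ^ 2 * s ^ 3 ≤ Δ ^ 4 := by
        refine le_of_sq_le_sq ?_ (by positivity)
        have : (1000 * r ^ 2 * s ^ 3) ^ 2 = 10 ^ 6 * r * m ^ 3 := by
          have : (1000 * r ^ 2 * s ^ 3) ^ 2 = 10 ^ 6 * r ^ 4 * (s ^ 2) ^ 3 := by ring
          rw [this, hs2]; field_simp
        rw [this, ← pow_mul]; exact hΔ8
      rw [hw, div_mul_eq_mul_div, div_le_iff₀ (by positivity)]
      have hm' : m = s ^ 2 * r := by rw [hs2, div_mul_cancel₀ _ hr0.ne']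
      have : 6 * m * r ^ 2 * (10 * s) = 60 * (r * (r ^ 2 * s ^ 3)) := by rw [hm']; ring
      rw [this]
      have := mul_le_mul_of_nonneg_left h4 hr0.le
      have e1 : r * (1000 * r ^ 2 * s ^ 3) = 1000 * (r * (r ^ 2 * s ^ 3)) := by ring
      have e2 : 0.1 * r * Δ ^ 4 = 0.1 * (r * Δ ^ 4) := by ring
      have e3 : 0 ≤ r * (r ^ 2 * s ^ 3) :=
        mul_nonneg hr0.le (mul_nonneg (sq_nonneg r) (pow_nonneg (zero_le_one.trans hs1) 3))
      rw [e1] at this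
      rw [e2]
      linarith
    have ht2 : Real.exp (-(10 * s)) ≤ t := by
      have h40 : (40 : ℝ) ≤ Real.exp 6 := by
        have : Real.exp 6 = Real.exp 3 * Real.exp 3 := by rw [← Real.exp_add]; norm_num
        rw [this]; nlinarith [ten_le_exp_three]
      have hse : s ^ 2 ≤ Real.exp (2 * s) := by
        have : Real.exp (2 * s) = Real.exp s ^ 2 := by rw [← Real.exp_nat_mul]; norm_num
        rw [this]
        have := Real.add_one_le_exp s
        gcongr; linarith
      have : t = (40 * s ^ 2)⁻¹ := by rw [hs2, ht, mul_div_assoc', inv_div]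
      rw [this, Real.exp_neg]
      refine inv_anti₀ (by positivity) ?_
      calc 40 * s ^ 2 ≤ Real.exp 6 * Real.exp (2 * s) := by gcongr
        _ = Real.exp (6 + 2 * s) := (Real.exp_add _ _).symm
        _ ≤ Real.exp (10 * s) := Real.exp_le_exp.2 (by linarith)
    calc Real.exp (-(0.1 * r)) ≤ Real.exp (⌊w⌋₊ * (-(10 * s))) := by
          apply Real.exp_le_exp.2
          have := Nat.floor_le hw0.le
          nlinarith
      _ = Real.exp (-(10 * s)) ^ ⌊w⌋₊ := Real.exp_nat_mul _ _
      _ ≤ _ := by gcongr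
  have hcard : ((X.image b).card : ℝ) ≤ Real.exp (0.2 * r) := by
    rw [hexp1] at hcount
    have h1 : ((X.image b).card : ℝ) * Real.exp (-(0.1 * r)) ≤ Real.exp (0.1 * r) :=
      le_trans (by gcongr) hcount
    rw [Real.exp_neg, ← div_eq_mul_inv, div_le_iff₀ (Real.exp_pos _), ← Real.exp_add] at h1
    refine h1.trans (Real.exp_le_exp.2 ?_); linarith
  -- pigeonhole: some vector of rounded discrepancies is attained by more colourings than a Hamming
  -- ball of radius `r / 100` can contain
  set d : ℕ := ⌊Real.exp (0.13 * r)⌋₊ with hd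
  have hpig : (X.image b).card * d < X.card := by
    have h1 : ((X.image b).card : ℝ) * d ≤ Real.exp (0.33 * r) := by
      calc ((X.image b).card : ℝ) * d ≤ Real.exp (0.2 * r) * Real.exp (0.13 * r) := by
            gcongr
            exact Nat.floor_le (Real.exp_pos _).le
        _ = _ := by rw [← Real.exp_add]; congr 1; ring
    have h2 : Real.exp (0.33 * r) * 2 < (2 : ℝ) ^ V.card := by
      have hl := Real.log_two_gt_d9
      have e2 : (2 : ℝ) = Real.exp (Real.log 2) := (Real.exp_log (by norm_num)).symm
      calc Real.exp (0.33 * r) * 2 = Real.exp (0.33 * r + Real.log 2) := by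
            rw [Real.exp_add, ← e2]
        _ < Real.exp (r * Real.log 2) := Real.exp_lt_exp.2 (by nlinarith)
        _ = _ := by rw [hr, Real.exp_nat_mul, ← e2]
    have h3 : ((X.image b).card * d : ℝ) < X.card := by linarith
    exact_mod_cast h3
  obtain ⟨c, -, hc⟩ := Finset.exists_lt_card_fiber_of_mul_lt_card_of_maps_to
    (fun S hS => Finset.mem_image_of_mem b hS) hpig
  have hne : (X.filter fun S => b S = c).Nonempty := by
    rw [← Finset.card_pos]; omega
  obtain ⟨S₀, hS₀⟩ := hne
  have hXV : ∀ S ∈ X.filter fun S => b S = c, S ⊆ V := fun S hS =>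
    Finset.mem_powerset.1 (Finset.mem_filter.1 (Finset.mem_filter.1 hS).1).1
  have hex : ∃ S₁ ∈ X.filter fun S => b S = c, V.card < 100 * (symmDiff S₁ S₀).card := by
    by_contra! hcon
    have hsub : (X.filter fun S => b S = c) ⊆
        V.powerset.filter fun S => (100 * (symmDiff S S₀).card ≤ V.card) := fun S hS =>
      Finset.mem_filter.2 ⟨Finset.mem_powerset.2 (hXV S hS), hcon S hS⟩
    have h1 := Finset.card_le_card hsub
    have h2 : (V.powerset.filter fun S => (100 * (symmDiff S S₀).card ≤ V.card)).card ≤ d :=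
      Nat.le_floor (card_hammingBall_le V S₀ (hXV S₀ hS₀))
    omega
  obtain ⟨S₁, hS₁, hdist⟩ := hex
  refine ⟨S₀, S₁, hXV _ hS₀, hXV _ hS₁, hdist, fun j => ?_⟩
  have e : b S₁ j = b S₀ j := by
    rw [(Finset.mem_filter.1 hS₁).2, (Finset.mem_filter.1 hS₀).2]
  have e1 := abs_sub_round ((∑ i ∈ V, a j i * signOf S₁ i) / (2 * Δ))
  have e0 := abs_sub_round ((∑ i ∈ V, a j i * signOf S₀ i) / (2 * Δ))
  simp only [hb] at e
  rw [e] at e1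
  have hsum : ∑ i ∈ V, a j i * ((signOf S₁ i - signOf S₀ i) / 2) =
      ((∑ i ∈ V, a j i * signOf S₁ i) / (2 * Δ) - (∑ i ∈ V, a j i * signOf S₀ i) / (2 * Δ)) * Δ := by
    rw [← sub_div, ← Finset.sum_sub_distrib, div_mul_eq_mul_div, eq_div_iff (by positivity),
      Finset.sum_mul, Finset.sum_mul]
    exact Finset.sum_congr rfl fun i _ => by ring
  rw [hsum, abs_mul, abs_of_pos hΔ]
  rw [abs_le] at e0 e1
  have : |(∑ i ∈ V, a j i * signOf S₁ i) / (2 * Δ) - (∑ i ∈ V, a j i * signOf S₀ i) / (2 * Δ)| ≤ 1 :=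
    abs_le.2 ⟨by linarith, by linarith⟩
  nlinarith

/-- Full colouring: iterated partial colouring gives discrepancy `O(r^{1/8} m^{3/8})` for `r` points
and `m ≥ r` forms with coefficients in `[-1, 1]`. -/
theorem exists_full_colouring (V : Finset ι) {a : κ → ι → ℝ} (ha : ∀ j i, |a j i| ≤ 1)
    (hVκ : V.card ≤ Fintype.card κ) :
    ∃ ε : ι → ℝ, (∀ i, ε i = 1 ∨ ε i = -1) ∧ ∀ j, |∑ i ∈ V, a j i * ε i| ≤
      4800 * (V.card : ℝ) ^ (1 / 8 : ℝ) * (Fintype.card κ : ℝ) ^ (3 / 8 : ℝ) := by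
  induction h : V.card using Nat.strong_induction_on generalizing V with
  | _ r ih =>
  subst h
  rcases Nat.lt_or_ge V.card 2 with h2 | h2
  · refine ⟨fun _ => 1, fun _ => Or.inl rfl, fun j => ?_⟩
    interval_cases hc : V.card
    · rw [Finset.card_eq_zero.1 hc]; simp
    · obtain ⟨v, rfl⟩ := Finset.card_eq_one.1 hc
      have hκ1 : (1 : ℝ) ≤ (Fintype.card κ : ℝ) ^ (3 / 8 : ℝ) :=
        Real.one_le_rpow (by exact_mod_cast hVκ) (by norm_num)
      simp only [Finset.sum_singleton, mul_one, Nat.cast_one, Real.one_rpow]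
      linarith [ha j v]
  set r : ℝ := (V.card : ℝ) with hr
  set m : ℝ := (Fintype.card κ : ℝ) with hm
  have hr2 : (2 : ℝ) ≤ r := by rw [hr]; exact_mod_cast h2
  have hrm : r ≤ m := by rw [hr, hm]; exact_mod_cast hVκ
  have hr0 : 0 < r := by linarith
  have hm0 : 0 < m := by linarith
  set Δ : ℝ := 6 * r ^ (1 / 8 : ℝ) * m ^ (3 / 8 : ℝ) with hΔ
  have hΔ0 : 0 < Δ := by positivity
  obtain ⟨S₀, S₁, hS₀, hS₁, hdist, hdisc⟩ := exists_partial_colouring V ha h2 hVκ hΔ0 (by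
    have e1 : (r ^ (1 / 8 : ℝ)) ^ 8 = r := by
      rw [← Real.rpow_natCast, ← Real.rpow_mul hr0.le]; norm_num
    have e2 : (m ^ (3 / 8 : ℝ)) ^ 8 = m ^ 3 := by
      rw [← Real.rpow_natCast, ← Real.rpow_mul hm0.le, ← Real.rpow_natCast]; norm_num
    rw [← hr, ← hm, hΔ, mul_pow, mul_pow, e1, e2]
    gcongr
    norm_num)
  set D := symmDiff S₁ S₀ with hD
  have hDV : D ⊆ V := by
    intro x hx
    rcases Finset.mem_symmDiff.1 hx with h | h
    · exact hS₁ h.1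
    · exact hS₀ h.1
  have hcard := Finset.card_sdiff_add_card_eq_card hDV
  obtain ⟨ε, hε, hεd⟩ := ih (V \ D).card (by omega) (V \ D) (by omega) rfl
  refine ⟨fun i => if i ∈ D then signOf S₁ i else ε i, fun i => ?_, fun j => ?_⟩
  · by_cases hi : i ∈ D
    · simp only [hi, if_true]; exact signOf_eq_or _ _
    · simp only [hi, if_false]; exact hε i
  · have e1 : ∑ i ∈ V, a j i * (if i ∈ D then signOf S₁ i else ε i) =
        ∑ i ∈ V, a j i * ((signOf S₁ i - signOf S₀ i) / 2) + ∑ i ∈ V \ D, a j i * ε i := by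
      rw [← Finset.sum_sdiff hDV, ← Finset.sum_sdiff hDV (f := fun i =>
        a j i * ((signOf S₁ i - signOf S₀ i) / 2))]
      have f1 : ∑ i ∈ V \ D, a j i * ((signOf S₁ i - signOf S₀ i) / 2) = 0 := by
        refine Finset.sum_eq_zero fun i hi => ?_
        rw [signOf_sub_of_notMem (Finset.mem_sdiff.1 hi).2, zero_div, mul_zero]
      have f2 : ∑ i ∈ D, a j i * ((signOf S₁ i - signOf S₀ i) / 2) =
          ∑ i ∈ D, a j i * (if i ∈ D then signOf S₁ i else ε i) := by
        refine Finset.sum_congr rfl fun i hi => ?_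
        rw [if_pos hi, signOf_sub_of_mem hi, mul_div_cancel_left₀ _ two_ne_zero]
      have f3 : ∑ i ∈ V \ D, a j i * (if i ∈ D then signOf S₁ i else ε i) =
          ∑ i ∈ V \ D, a j i * ε i := by
        refine Finset.sum_congr rfl fun i hi => ?_
        rw [if_neg (Finset.mem_sdiff.1 hi).2]
      rw [f1, f2, f3]; ring
    rw [e1]
    -- the exponent `1 / 8` turns the ratio `1 - 1 / 100` into a ratio at most `1 - 1 / 800`, and the
    -- geometric series with this ratio has sum `800`, whence `4800 = 6 * 800`
    have hle : (((V \ D).card : ℕ) : ℝ) ≤ (1 - 1 / 100) * r := by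
      have h1 : (((V \ D).card : ℕ) : ℝ) + (D.card : ℝ) = r := by rw [hr]; exact_mod_cast hcard
      have h2 : r < 100 * (D.card : ℝ) := by rw [hr]; exact_mod_cast hdist
      linarith
    have hpow : (((V \ D).card : ℕ) : ℝ) ^ (1 / 8 : ℝ) ≤ (1 - 1 / 800) * r ^ (1 / 8 : ℝ) := by
      calc (((V \ D).card : ℕ) : ℝ) ^ (1 / 8 : ℝ) ≤ (((1 - 1 / 800) ^ 8) * r) ^ (1 / 8 : ℝ) := by
            refine Real.rpow_le_rpow (Nat.cast_nonneg _) (hle.trans ?_) (by norm_num)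
            gcongr; norm_num
        _ = _ := by
            rw [Real.mul_rpow (by norm_num) hr0.le, ← Real.rpow_natCast,
              ← Real.rpow_mul (by norm_num)]
            norm_num
    calc |∑ i ∈ V, a j i * ((signOf S₁ i - signOf S₀ i) / 2) + ∑ i ∈ V \ D, a j i * ε i|
        ≤ Δ + 4800 * ((1 - 1 / 800) * r ^ (1 / 8 : ℝ)) * m ^ (3 / 8 : ℝ) := by
          refine (abs_add_le _ _).trans (add_le_add (hdisc j) ((hεd j).trans ?_))
          gcongr
      _ = _ := by rw [hΔ]; ring

/-- Rounding dyadic points of the unit cube: the last binary digit is removed by a full colouring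
of the coordinates in which it is odd, and the errors form a geometric series. -/
theorem exists_rounding_dyadic (V : Finset ι) {a : κ → ι → ℝ} (ha : ∀ j i, |a j i| ≤ 1)
    (hVκ : V.card ≤ Fintype.card κ) (s : ℕ) (y : ι → ℤ) (hy : ∀ i, 0 ≤ y i ∧ y i ≤ 2 ^ s) :
    ∃ z : ι → ℤ, (∀ i, z i = 0 ∨ z i = 1) ∧ ∀ j, |∑ i ∈ V, a j i * (z i - y i / 2 ^ s)| ≤
      (1 - 1 / 2 ^ s) * (4800 * (V.card : ℝ) ^ (1 / 8 : ℝ) * (Fintype.card κ : ℝ) ^ (3 / 8 : ℝ)) := by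
  induction s generalizing y with
  | zero =>
    refine ⟨y, fun i => ?_, fun j => ?_⟩
    · have := hy i; simp at this; omega
    · simp
  | succ s ih =>
    set O := V.filter fun i => Odd (y i) with hO
    have hOV : O ⊆ V := Finset.filter_subset _ _
    have hOc := Finset.card_le_card hOV
    obtain ⟨ε, hε, hεd⟩ := exists_full_colouring O ha (hOc.trans hVκ)
    set e : ι → ℤ := fun i => if ε i = 1 then 1 else -1 with he
    have hee : ∀ i, (e i : ℝ) = ε i := by
      intro i
      rcases hε i with h | h
      · simp [he, h]
      · simp only [he, h]; norm_num
    have he1 : ∀ i, e i = 1 ∨ e i = -1 := by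
      intro i; simp only [he]; split_ifs <;> simp
    set y' : ι → ℤ := fun i => if i ∈ V then (if Odd (y i) then (y i + e i) / 2 else y i / 2) else 0
      with hy'
    obtain ⟨z, hz, hzd⟩ := ih y' (by
      intro i
      have h1 := hy i
      have h2 := he1 i
      rw [pow_succ] at h1
      simp only [hy']
      split_ifs with hi ho
      · obtain ⟨c, hc⟩ := ho
        omega
      · omega
      · exact ⟨le_rfl, by positivity⟩)
    refine ⟨z, hz, fun j => ?_⟩
    have hsplit : ∑ i ∈ V, a j i * (z i - y i / 2 ^ (s + 1)) =
        ∑ i ∈ V, a j i * (z i - y' i / 2 ^ s) + 1 / 2 ^ (s + 1) * ∑ i ∈ O, a j i * ε i := by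
      rw [hO, Finset.sum_filter, Finset.mul_sum, ← Finset.sum_add_distrib]
      refine Finset.sum_congr rfl fun i hi => ?_
      have h2 := he1 i
      rw [← hee i]
      simp only [hy', hi, if_true]
      split_ifs with ho
      · have : ((y i + e i) / 2 : ℤ) * 2 = y i + e i := by
          obtain ⟨c, hc⟩ := ho
          omega
        have h3 : (((y i + e i) / 2 : ℤ) : ℝ) = ((y i : ℝ) + e i) / 2 := by
          rw [eq_div_iff two_ne_zero]; exact_mod_cast this
        rw [h3, pow_succ]; field_simp; ring
      · have : (y i / 2 : ℤ) * 2 = y i := by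
          have := Int.not_odd_iff_even.1 ho
          obtain ⟨c, hc⟩ := this
          omega
        have h3 : ((y i / 2 : ℤ) : ℝ) = (y i : ℝ) / 2 := by
          rw [eq_div_iff two_ne_zero]; exact_mod_cast this
        rw [h3, pow_succ]; field_simp; ring
    rw [hsplit]
    set E := 4800 * (V.card : ℝ) ^ (1 / 8 : ℝ) * (Fintype.card κ : ℝ) ^ (3 / 8 : ℝ) with hE
    have hEO : |∑ i ∈ O, a j i * ε i| ≤ E := by
      refine (hεd j).trans ?_
      rw [hE]
      gcongr
    calc _ ≤ (1 - 1 / 2 ^ s) * E + 1 / 2 ^ (s + 1) * E := by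
          refine (abs_add_le _ _).trans (add_le_add (hzd j) ?_)
          rw [abs_mul, abs_of_nonneg (by positivity)]
          gcongr
      _ = _ := by rw [pow_succ]; field_simp; ring

/-- Rounding a point of the cube `[-1, 1]^V` to a vertex, with a small error in each of `m ≥ |V|`
linear forms with coefficients in `[-1, 1]`. -/
theorem exists_signs_approx (V : Finset ι) {a : κ → ι → ℝ} (ha : ∀ j i, |a j i| ≤ 1)
    (hVκ : V.card ≤ Fintype.card κ) (x : ι → ℝ) (hx : ∀ i, |x i| ≤ 1) :
    ∃ ε : ι → ℝ, (∀ i, ε i = 1 ∨ ε i = -1) ∧ ∀ j, |∑ i ∈ V, a j i * (ε i - x i)| ≤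
      10000 * (V.card : ℝ) ^ (1 / 8 : ℝ) * (Fintype.card κ : ℝ) ^ (3 / 8 : ℝ) := by
  rcases V.eq_empty_or_nonempty with rfl | hne
  · exact ⟨fun _ => 1, fun _ => Or.inl rfl, fun j => by simp⟩
  have hV1 : 1 ≤ V.card := hne.card_pos
  set s := V.card with hs
  have h2s : (V.card : ℝ) ≤ 2 ^ s := by exact_mod_cast (Nat.lt_two_pow_self (n := V.card)).le
  have h2p : (0 : ℝ) < 2 ^ s := by positivity
  obtain ⟨z, hz, hzd⟩ := exists_rounding_dyadic V ha hVκ s (fun i => ⌊2 ^ s * ((x i + 1) / 2)⌋) (by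
    intro i
    have := abs_le.1 (hx i)
    constructor
    · exact Int.floor_nonneg.2 (by apply mul_nonneg h2p.le; linarith)
    · have h1 : (2 : ℝ) ^ s * ((x i + 1) / 2) ≤ ((2 ^ s : ℤ) : ℝ) := by
        push_cast
        nlinarith
      exact_mod_cast (Int.floor_le _).trans h1)
  refine ⟨fun i => 2 * (z i : ℝ) - 1, fun i => ?_, fun j => ?_⟩
  · rcases hz i with h | h <;> simp only [h] <;> norm_num
  set Y : ι → ℤ := fun i => ⌊(2 : ℝ) ^ s * ((x i + 1) / 2)⌋ with hY
  have hsplit : ∑ i ∈ V, a j i * (2 * (z i : ℝ) - 1 - x i) =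
      2 * ∑ i ∈ V, a j i * (z i - Y i / 2 ^ s) +
        ∑ i ∈ V, a j i * (2 * (Y i / 2 ^ s - (x i + 1) / 2)) := by
    rw [Finset.mul_sum, ← Finset.sum_add_distrib]
    exact Finset.sum_congr rfl fun i _ => by ring
  have herr : |∑ i ∈ V, a j i * (2 * (Y i / 2 ^ s - (x i + 1) / 2))| ≤ 2 := by
    calc _ ≤ ∑ i ∈ V, (2 / 2 ^ s : ℝ) := by
          refine (Finset.abs_sum_le_sum_abs _ _).trans (Finset.sum_le_sum fun i _ => ?_)
          rw [abs_mul]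
          have h1 : |2 * (Y i / 2 ^ s - (x i + 1) / 2)| ≤ (2 / 2 ^ s : ℝ) := by
            have f1 := Int.floor_le ((2 : ℝ) ^ s * ((x i + 1) / 2))
            have f2 := Int.lt_floor_add_one ((2 : ℝ) ^ s * ((x i + 1) / 2))
            have : (2 : ℝ) * (Y i / 2 ^ s - (x i + 1) / 2) =
                2 * (Y i - 2 ^ s * ((x i + 1) / 2)) / 2 ^ s := by field_simp
            rw [this, abs_div, abs_of_pos h2p]
            gcongr
            rw [abs_le]
            constructor <;> linarith
          calc _ ≤ 1 * (2 / 2 ^ s : ℝ) := by gcongr; exact ha j i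
            _ = _ := one_mul _
      _ = (V.card : ℝ) * (2 / 2 ^ s) := by simp
      _ ≤ 2 ^ s * (2 / 2 ^ s) := by gcongr
      _ = 2 := by field_simp
  set E := (V.card : ℝ) ^ (1 / 8 : ℝ) * (Fintype.card κ : ℝ) ^ (3 / 8 : ℝ) with hE
  have hE1 : 1 ≤ E := by
    have h1 : (1 : ℝ) ≤ V.card := by exact_mod_cast hV1
    have h2 : (1 : ℝ) ≤ Fintype.card κ := by exact_mod_cast hV1.trans hVκ
    exact one_le_mul_of_one_le_of_one_le (Real.one_le_rpow h1 (by norm_num))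
      (Real.one_le_rpow h2 (by norm_num))
  have hmain : |∑ i ∈ V, a j i * (z i - Y i / 2 ^ s)| ≤ 4800 * E := by
    refine (hzd j).trans ?_
    rw [mul_assoc (4800 : ℝ), ← hE]
    have : (0 : ℝ) < 1 / 2 ^ s := by positivity
    nlinarith
  rw [hsplit, mul_assoc (10000 : ℝ), ← hE]
  calc _ ≤ 2 * (4800 * E) + 2 := by
        refine (abs_add_le _ _).trans (add_le_add ?_ herr)
        rw [abs_mul, abs_two]; gcongr
    _ ≤ _ := by linarith

end Discrepancy

/-! ### Fejér means on grids -/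

/-- The character `x ↦ exp (i k x)`. -/
noncomputable def expChar (k : ℤ) (x : ℝ) : ℂ := Complex.exp (k * x * Complex.I)

theorem expChar_add (k l : ℤ) (x : ℝ) : expChar (k + l) x = expChar k x * expChar l x := by
  unfold expChar; rw [← Complex.exp_add]; push_cast; ring_nf

theorem expChar_add_arg (k : ℤ) (x y : ℝ) : expChar k (x + y) = expChar k x * expChar k y := by
  unfold expChar; rw [← Complex.exp_add]; push_cast; ring_nf

theorem expChar_sub_arg (k : ℤ) (x y : ℝ) : expChar k (x - y) = expChar k x * expChar (-k) y := by
  unfold expChar; rw [← Complex.exp_add]; push_cast; ring_nf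

@[simp] theorem expChar_zero (x : ℝ) : expChar 0 x = 1 := by simp [expChar]

@[simp] theorem norm_expChar (k : ℤ) (x : ℝ) : ‖expChar k x‖ = 1 := by
  have : (k : ℂ) * x * Complex.I = ((k * x : ℝ) : ℂ) * Complex.I := by push_cast; ring
  rw [expChar, this, Complex.norm_exp_ofReal_mul_I]

theorem expChar_natCast_mul (s : ℕ) (k : ℤ) (x : ℝ) : expChar (s * k) x = expChar k x ^ s := by
  unfold expChar; rw [← Complex.exp_nat_mul]; push_cast; ring_nf

theorem expChar_natCast (s : ℕ) (x : ℝ) : expChar s x = expChar 1 x ^ s := by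
  rw [← expChar_natCast_mul, mul_one]

theorem conj_expChar (k : ℤ) (x : ℝ) : (starRingEnd ℂ) (expChar k x) = expChar (-k) x := by
  unfold expChar
  rw [← Complex.exp_conj]
  simp

theorem expChar_eq_cos_add_sin (k : ℤ) (x : ℝ) :
    expChar k x = Real.cos (k * x) + Real.sin (k * x) * Complex.I := by
  unfold expChar; rw [Complex.exp_mul_I]; push_cast; rfl

theorem expChar_add_neg (k : ℤ) (x : ℝ) :
    expChar k x + expChar (-k) x = 2 * Real.cos (k * x) := by
  rw [expChar_eq_cos_add_sin, expChar_eq_cos_add_sin]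
  push_cast
  rw [neg_mul, Complex.cos_neg, Complex.sin_neg]; ring

theorem expChar_sub_neg (k : ℤ) (x : ℝ) :
    expChar k x - expChar (-k) x = 2 * Complex.I * Real.sin (k * x) := by
  rw [expChar_eq_cos_add_sin, expChar_eq_cos_add_sin]
  push_cast
  rw [neg_mul, Complex.cos_neg, Complex.sin_neg]; ring

/-- The points of the grid `v + (2π / G) ℤ` in one period. -/
noncomputable def gridPt (G : ℕ) (v : ℝ) (j : ℕ) : ℝ := v + 2 * Real.pi * j / G

/-- A non-constant exponential of frequency below `G` has mean zero on a grid of `G` points. -/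
theorem sum_expChar_gridPt {G : ℕ} (v : ℝ) {l : ℤ} (hl : |l| < G) :
    ∑ j ∈ Finset.range G, expChar l (gridPt G v j) = if l = 0 then (G : ℂ) else 0 := by
  have hG : 0 < G := by have := abs_nonneg l; omega
  split_ifs with h
  · subst h; simp
  · set w : ℂ := expChar l (2 * Real.pi / G) with hw
    have h1 : ∀ j ∈ Finset.range G, expChar l (gridPt G v j) = expChar l v * w ^ j := by
      intro j _
      rw [gridPt, expChar_add_arg, hw, ← expChar_natCast_mul]
      congr 1
      unfold expChar; push_cast; ring_nf
    rw [Finset.sum_congr rfl h1, ← Finset.mul_sum]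
    have hwG : w ^ G = 1 := by
      rw [hw, ← expChar_natCast_mul]
      unfold expChar
      rw [Complex.exp_eq_one_iff]
      refine ⟨l, ?_⟩
      have : (G : ℂ) ≠ 0 := by exact_mod_cast hG.ne'
      push_cast
      field_simp
    have hw1 : w ≠ 1 := by
      intro hcon
      rw [hw, expChar, Complex.exp_eq_one_iff] at hcon
      obtain ⟨n, hn⟩ := hcon
      have hG' : (G : ℂ) ≠ 0 := by exact_mod_cast hG.ne'
      have hpi : (Real.pi : ℂ) ≠ 0 := by exact_mod_cast Real.pi_ne_zero
      have h2 : (l : ℂ) = n * G := by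
        push_cast at hn
        field_simp at hn
        have := Complex.I_ne_zero
        linear_combination hn
      have h3 : l = n * G := by exact_mod_cast h2
      have hn0 : n ≠ 0 := by rintro rfl; simp at h3; exact h h3
      have : (G : ℤ) ≤ |l| := by
        rw [h3, abs_mul, Nat.abs_cast]
        have := Int.one_le_abs hn0
        nlinarith
      omega
    rw [geom_sum_eq hw1, hwG]; simp

/-- The Fejér kernel, normalised to have mean value one. -/
noncomputable def fejer (N : ℕ) (u : ℝ) : ℝ :=
  ‖∑ s ∈ Finset.range N, expChar s u‖ ^ 2 / N

theorem fejer_nonneg (N : ℕ) (u : ℝ) : 0 ≤ fejer N u := by unfold fejer; positivity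

/-- The Fourier coefficients of the Fejér kernel. -/
noncomputable def tent (N : ℕ) (k : ℤ) : ℝ := max 0 (1 - |(k : ℝ)| / N)

theorem tent_nonneg (N : ℕ) (k : ℤ) : 0 ≤ tent N k := le_max_left _ _

theorem tent_le_one (N : ℕ) (k : ℤ) : tent N k ≤ 1 :=
  max_le zero_le_one (by have : 0 ≤ |(k : ℝ)| / N := by positivity
                         linarith)

theorem tent_eq_zero {N : ℕ} (hN : 0 < N) {k : ℤ} (hk : (N : ℤ) ≤ |k|) : tent N k = 0 := by
  refine max_eq_left ?_
  have : (N : ℝ) ≤ |(k : ℝ)| := by exact_mod_cast hk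
  have hN' : (0 : ℝ) < N := by exact_mod_cast hN
  rw [sub_nonpos, le_div_iff₀ hN']; linarith

theorem tent_eq {N : ℕ} (hN : 0 < N) {k : ℤ} (hk : |k| ≤ (N : ℤ)) :
    tent N k = 1 - |(k : ℝ)| / N := by
  refine max_eq_right ?_
  have : |(k : ℝ)| ≤ N := by exact_mod_cast hk
  have hN' : (0 : ℝ) < N := by exact_mod_cast hN
  rw [sub_nonneg, div_le_iff₀ hN']; linarith

theorem tent_neg (N : ℕ) (k : ℤ) : tent N (-k) = tent N k := by
  simp [tent]

theorem sum_range_sub_eq (N : ℕ) (g : ℤ → ℂ) :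
    ∑ s ∈ Finset.range N, ∑ s' ∈ Finset.range N, g ((s : ℤ) - s') =
      ∑ k ∈ Finset.Icc (-(N : ℤ)) N, ((N : ℂ) - |k|) * g k := by
  induction N with
  | zero => simp
  | succ N ih =>
    have h1 : ∑ s ∈ Finset.range (N + 1), ∑ s' ∈ Finset.range (N + 1), g ((s : ℤ) - s') =
        (∑ s ∈ Finset.range N, ∑ s' ∈ Finset.range N, g ((s : ℤ) - s')) +
        (g 0 + ∑ k ∈ Finset.range N, (g ((k : ℤ) + 1) + g (-((k : ℤ) + 1)))) := by
      rw [Finset.sum_range_succ]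
      simp_rw [Finset.sum_range_succ _ N]
      rw [Finset.sum_add_distrib, Finset.sum_add_distrib]
      have e1 : ∑ s ∈ Finset.range N, g ((s : ℤ) - N) =
          ∑ k ∈ Finset.range N, g (-((k : ℤ) + 1)) := by
        rw [← Finset.sum_range_reflect]
        refine Finset.sum_congr rfl fun k hk => ?_
        have := Finset.mem_range.1 hk
        congr 1; omega
      have e2 : ∑ s ∈ Finset.range N, g ((N : ℤ) - s) =
          ∑ k ∈ Finset.range N, g ((k : ℤ) + 1) := by
        rw [← Finset.sum_range_reflect]
        refine Finset.sum_congr rfl fun k hk => ?_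
        have := Finset.mem_range.1 hk
        congr 1; omega
      rw [e1, e2]
      simp
      ring
    rw [h1, ih, sum_Icc_neg_eq, sum_Icc_neg_eq, Finset.sum_range_succ]
    have habs : ∀ k : ℕ, |((k : ℤ) + 1)| = (k : ℤ) + 1 := fun k => abs_of_nonneg (by positivity)
    have e3 : (∑ k ∈ Finset.range N, ((((N + 1 : ℕ) : ℂ) - (|(k : ℤ) + 1| : ℤ)) * g ((k : ℤ) + 1) +
        (((N + 1 : ℕ) : ℂ) - (|-((k : ℤ) + 1)| : ℤ)) * g (-((k : ℤ) + 1)))) =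
        (∑ k ∈ Finset.range N, (((N : ℂ) - (|(k : ℤ) + 1| : ℤ)) * g ((k : ℤ) + 1) +
          ((N : ℂ) - (|-((k : ℤ) + 1)| : ℤ)) * g (-((k : ℤ) + 1)))) +
        ∑ k ∈ Finset.range N, (g ((k : ℤ) + 1) + g (-((k : ℤ) + 1))) := by
      rw [← Finset.sum_add_distrib]
      refine Finset.sum_congr rfl fun k _ => ?_
      push_cast; ring
    simp only [abs_neg, habs] at e3 ⊢
    rw [e3]
    push_cast
    simp
    ring

/-- Fourier expansion of the Fejér kernel. -/
theorem fejer_eq_sum {N : ℕ} (hN : 0 < N) (u : ℝ) :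
    (fejer N u : ℂ) = ∑ k ∈ Finset.Icc (-(N : ℤ)) N, tent N k * expChar k u := by
  have hN' : (N : ℂ) ≠ 0 := by exact_mod_cast hN.ne'
  have h1 : ((‖∑ s ∈ Finset.range N, expChar s u‖ ^ 2 : ℝ) : ℂ) =
      ∑ s ∈ Finset.range N, ∑ s' ∈ Finset.range N, expChar ((s : ℤ) - s') u := by
    push_cast
    rw [← Complex.mul_conj', map_sum, Finset.sum_mul_sum]
    refine Finset.sum_congr rfl fun s _ => Finset.sum_congr rfl fun s' _ => ?_
    rw [conj_expChar, ← expChar_add, sub_eq_add_neg]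
  rw [fejer, Complex.ofReal_div, h1, sum_range_sub_eq N (fun k => expChar k u), Finset.sum_div]
  refine Finset.sum_congr rfl fun k hk => ?_
  have := Finset.mem_Icc.1 hk
  have hk' : ((|(k : ℝ)| : ℝ) : ℂ) = ((|k| : ℤ) : ℂ) := by
    rw [← Int.cast_abs, Complex.ofReal_intCast]
  rw [tent_eq hN (abs_le.2 this), Complex.ofReal_sub, Complex.ofReal_div, hk', Complex.ofReal_one,
    Complex.ofReal_natCast]
  field_simp

/-- Closed form of the Fejér kernel. -/
theorem fejer_mul_sin_sq {N : ℕ} (hN : 0 < N) (u : ℝ) :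
    N * fejer N u * Real.sin (u / 2) ^ 2 = Real.sin (N * u / 2) ^ 2 := by
  have hN' : (N : ℝ) ≠ 0 := by exact_mod_cast hN.ne'
  have h0 : ∀ k : ℤ, ‖expChar k u - 1‖ ^ 2 = 4 * Real.sin (k * u / 2) ^ 2 := by
    intro k
    have : expChar k u = Complex.exp (Complex.I * ((k * u : ℝ) : ℂ)) := by
      unfold expChar; push_cast; ring_nf
    rw [this, Complex.norm_exp_I_mul_ofReal_sub_one, Real.norm_eq_abs, sq_abs]; ring
  have h1 : (∑ s ∈ Finset.range N, expChar s u) * (expChar 1 u - 1) = expChar N u - 1 := by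
    simp_rw [expChar_natCast]
    exact geom_sum_mul _ _
  have h2 := congrArg (fun z : ℂ => ‖z‖ ^ 2) h1
  simp only [norm_mul, mul_pow] at h2
  rw [h0 1, h0 N] at h2
  unfold fejer
  rw [mul_div_cancel₀ _ hN']
  push_cast at h2
  rw [one_mul] at h2
  linarith

/-- A Fejér mean of an exponential, computed on a grid without aliasing. -/
theorem fejer_sampling_expChar {N G : ℕ} (hN : 0 < N) (v φ : ℝ) (k c : ℤ)
    (hG : |k - c| + N ≤ G) :
    ∑ j ∈ Finset.range G, expChar k (gridPt G v j) *
      (expChar c (φ - gridPt G v j) * fejer N (φ - gridPt G v j)) =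
      G * (tent N (k - c) * expChar k φ) := by
  have h1 : ∀ j ∈ Finset.range G, expChar k (gridPt G v j) *
      (expChar c (φ - gridPt G v j) * fejer N (φ - gridPt G v j)) =
      ∑ l ∈ Finset.Icc (-(N : ℤ)) N,
        tent N l * expChar (c + l) φ * expChar (k - c - l) (gridPt G v j) := by
    intro j _
    rw [fejer_eq_sum hN, Finset.mul_sum, Finset.mul_sum]
    refine Finset.sum_congr rfl fun l _ => ?_
    have : expChar (k - c - l) (gridPt G v j) = expChar k (gridPt G v j) *
        (expChar (-c) (gridPt G v j) * expChar (-l) (gridPt G v j)) := by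
      rw [← expChar_add, ← expChar_add]; congr 1; ring
    rw [expChar_sub_arg, expChar_sub_arg, expChar_add c l, this]
    ring
  rw [Finset.sum_congr rfl h1, Finset.sum_comm]
  have h2 : ∀ l ∈ Finset.Icc (-(N : ℤ)) N, ∑ j ∈ Finset.range G,
      (tent N l * expChar (c + l) φ * expChar (k - c - l) (gridPt G v j)) =
      if l = k - c then G * (tent N (k - c) * expChar k φ) else 0 := by
    intro l hl
    rw [← Finset.mul_sum]
    rcases eq_or_ne |l| (N : ℤ) with h | h
    · have ht : tent N l = 0 := tent_eq_zero hN h.ge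
      rw [ht]
      split_ifs with hlk
      · rw [← hlk, ht]; simp
      · simp
    · have hl' : |l| < N := lt_of_le_of_ne (abs_le.2 (Finset.mem_Icc.1 hl)) h
      rw [sum_expChar_gridPt v (by
        have := abs_sub (k - c) l
        omega)]
      by_cases hlk : l = k - c
      · subst hlk
        simp; ring
      · rw [if_neg hlk, if_neg (by omega), mul_zero]
  rw [Finset.sum_congr rfl h2, Finset.sum_ite_eq']
  split_ifs with h
  · rfl
  · have : (N : ℤ) ≤ |k - c| := by
      rw [Finset.mem_Icc, ← abs_le] at h; omega
    rw [tent_eq_zero hN this]; simp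

/-- Fejér means of trigonometric polynomials, modulated to the centre frequency `c`. -/
theorem fejer_sampling {α : Type*} (S : Finset α) (a : α → ℂ) (m : α → ℤ) {N G : ℕ} (hN : 0 < N)
    (v φ : ℝ) (c : ℤ) (hG : ∀ i ∈ S, |m i - c| + N ≤ G) :
    ∑ j ∈ Finset.range G, (∑ i ∈ S, a i * expChar (m i) (gridPt G v j)) *
      (expChar c (φ - gridPt G v j) * fejer N (φ - gridPt G v j)) =
      G * ∑ i ∈ S, a i * (tent N (m i - c) * expChar (m i) φ) := by
  simp_rw [Finset.sum_mul]
  rw [Finset.sum_comm, Finset.mul_sum]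
  refine Finset.sum_congr rfl fun i hi => ?_
  simp_rw [mul_assoc (a i)]
  rw [← Finset.mul_sum, fejer_sampling_expChar hN v φ _ _ (hG i hi)]
  ring

theorem sum_fejer_gridPt {N G : ℕ} (hN : 0 < N) (hG : N ≤ G) (v φ : ℝ) :
    ∑ j ∈ Finset.range G, fejer N (φ - gridPt G v j) = G := by
  have h := fejer_sampling_expChar hN v φ 0 0 (G := G) (by simpa using hG)
  have ht : tent N 0 = 1 := by simp [tent]
  simp only [expChar_zero, one_mul, sub_self, ht, Complex.ofReal_one, mul_one] at h
  exact_mod_cast h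

/-- Weighting coefficients by a tent amounts to a modulated Fejér mean, and is therefore bounded by a
Fejér mean of absolute values. This holds for the tent around any centre frequency. -/
theorem norm_tent_sum_le {α : Type*} (S : Finset α) (a : α → ℂ) (m : α → ℤ) {N G : ℕ} (hN : 0 < N)
    (v φ : ℝ) (c : ℤ) (hG : ∀ i ∈ S, |m i - c| + N ≤ G) :
    G * ‖∑ i ∈ S, a i * (tent N (m i - c) * expChar (m i) φ)‖ ≤
      ∑ j ∈ Finset.range G, ‖∑ i ∈ S, a i * expChar (m i) (gridPt G v j)‖ *
        fejer N (φ - gridPt G v j) := by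
  have h := congrArg norm (fejer_sampling S a m hN v φ c hG)
  rw [norm_mul, Complex.norm_natCast] at h
  rw [← h]
  refine (norm_sum_le _ _).trans (Finset.sum_le_sum fun j _ => ?_)
  rw [norm_mul, norm_mul, norm_expChar, one_mul, Complex.norm_real, Real.norm_eq_abs,
    abs_of_nonneg (fejer_nonneg _ _)]

/-- Telescoping form of the Dirichlet kernel. -/
theorem sum_cos_mul_sin (K : ℕ) (u : ℝ) :
    2 * Real.sin (u / 2) * ∑ κ ∈ Finset.range K, Real.cos ((κ + 1) * u) =
      Real.sin ((K + 1 / 2) * u) - Real.sin (u / 2) := by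
  induction K with
  | zero => simp; ring_nf
  | succ K ih =>
    rw [Finset.sum_range_succ, mul_add, ih]
    have h1 : ((K + 1 : ℕ) + 1 / 2 : ℝ) * u = (K + 1) * u + u / 2 := by push_cast; ring
    have h2 : ((K : ℝ) + 1 / 2) * u = (K + 1) * u - u / 2 := by ring
    rw [h1, h2, Real.sin_add, Real.sin_sub]; ring

theorem sum_sin_sq_ge {K : ℕ} {u s : ℝ} (hs : 0 < s) (hu : s ≤ |Real.sin (u / 2)|)
    (hK : 2 ≤ K * s) : (K : ℝ) / 4 ≤ ∑ κ ∈ Finset.range K, Real.sin ((κ + 1 : ℕ) * u / 2) ^ 2 := by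
  have h1 : ∀ κ : ℕ, Real.sin ((κ + 1 : ℕ) * u / 2) ^ 2 = 1 / 2 - Real.cos ((κ + 1) * u) / 2 := by
    intro κ
    rw [Real.sin_sq_eq_half_sub]
    push_cast
    congr 3; ring
  simp_rw [h1]
  rw [Finset.sum_sub_distrib]
  have h2 : |∑ κ ∈ Finset.range K, Real.cos ((κ + 1) * u)| * s ≤ 1 := by
    have h3 := congrArg abs (sum_cos_mul_sin K u)
    rw [abs_mul, abs_mul, abs_two] at h3
    have h4 : |Real.sin ((K + 1 / 2) * u) - Real.sin (u / 2)| ≤ 2 :=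
      (abs_sub _ _).trans (by
        have f1 := Real.abs_sin_le_one (((K : ℝ) + 1 / 2) * u)
        have f2 := Real.abs_sin_le_one (u / 2)
        linarith)
    have := mul_le_mul_of_nonneg_left hu (abs_nonneg (∑ κ ∈ Finset.range K, Real.cos ((κ + 1) * u)))
    nlinarith
  have h5 : |∑ κ ∈ Finset.range K, Real.cos ((κ + 1) * u)| ≤ K / 2 := by
    refine le_of_mul_le_mul_right (h2.trans ?_) hs
    linarith
  have := (abs_le.1 h5).2
  rw [Finset.sum_const, Finset.card_range, ← Finset.sum_div, nsmul_eq_mul]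
  linarith

/-- The part of the mass of the Fejér kernel of order `N` outside an arc of length about `s` is
`O(1 / (s N))`. On that part the kernel is at most `1 / (N sin² (u / 2))`, which is dominated by an
average of Fejér kernels of order about `1 / s`, and these have known mean values. -/
theorem fejer_tail {N G : ℕ} (hN : 0 < N) (v φ : ℝ) {s : ℝ} (hs : 0 < s) (hs1 : s ≤ 1)
    (hG : 3 ≤ G * s) :
    ∑ j ∈ (Finset.range G).filter (fun j => s ≤ |Real.sin ((φ - gridPt G v j) / 2)|),
      fejer N (φ - gridPt G v j) ≤ G * (12 / (s * N)) := by
  have hN' : (0 : ℝ) < N := by exact_mod_cast hN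
  set K := ⌈2 / s⌉₊ with hK
  have hK1 : 2 / s ≤ K := Nat.le_ceil _
  have hK2 : (K : ℝ) < 2 / s + 1 := Nat.ceil_lt_add_one (by positivity)
  have hK1' : 2 ≤ K * s := by rwa [div_le_iff₀ hs] at hK1
  have hK0 : (0 : ℝ) < K := lt_of_lt_of_le (by positivity) hK1
  have hKs : K * s < 3 := by
    have := mul_lt_mul_of_pos_right hK2 hs
    rw [add_mul, div_mul_cancel₀ _ hs.ne'] at this; linarith
  have hKG : K ≤ G := by
    have : (K : ℝ) ≤ G := le_of_mul_le_mul_right (by linarith) hs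
    exact_mod_cast this
  have hpt : ∀ u : ℝ, s ≤ |Real.sin (u / 2)| → fejer N u ≤
      4 / (K * N) * ∑ κ ∈ Finset.range K, ((κ + 1 : ℕ) : ℝ) * fejer (κ + 1) u := by
    intro u hu
    have hsin : 0 < Real.sin (u / 2) ^ 2 := by
      have : 0 < |Real.sin (u / 2)| := lt_of_lt_of_le hs hu
      rw [← sq_abs]; positivity
    have h1 := sum_sin_sq_ge hs hu hK1'
    simp_rw [← fejer_mul_sin_sq (Nat.succ_pos _) u] at h1
    rw [← Finset.sum_mul] at h1
    have h2 := fejer_mul_sin_sq hN u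
    have h3 : N * fejer N u * Real.sin (u / 2) ^ 2 ≤ 1 := by
      rw [h2]; exact Real.sin_sq_le_one _
    have h4 : N * fejer N u ≤ 4 / K * ∑ κ ∈ Finset.range K, ((κ + 1 : ℕ) : ℝ) * fejer (κ + 1) u := by
      refine le_of_mul_le_mul_right (h3.trans ?_) hsin
      rw [mul_assoc, div_mul_eq_mul_div, le_div_iff₀ hK0]
      linarith
    calc fejer N u = (N * fejer N u) / N := by field_simp
      _ ≤ (4 / K * ∑ κ ∈ Finset.range K, ((κ + 1 : ℕ) : ℝ) * fejer (κ + 1) u) / N := by gcongr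
      _ = _ := by field_simp
  calc ∑ j ∈ (Finset.range G).filter (fun j => s ≤ |Real.sin ((φ - gridPt G v j) / 2)|),
      fejer N (φ - gridPt G v j)
      ≤ ∑ j ∈ (Finset.range G).filter (fun j => s ≤ |Real.sin ((φ - gridPt G v j) / 2)|),
        4 / (K * N) * ∑ κ ∈ Finset.range K, ((κ + 1 : ℕ) : ℝ) * fejer (κ + 1) (φ - gridPt G v j) :=
        Finset.sum_le_sum fun j hj => hpt _ (Finset.mem_filter.1 hj).2
    _ ≤ ∑ j ∈ Finset.range G,
        4 / (K * N) * ∑ κ ∈ Finset.range K, ((κ + 1 : ℕ) : ℝ) * fejer (κ + 1) (φ - gridPt G v j) :=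
        Finset.sum_le_sum_of_subset_of_nonneg (Finset.filter_subset _ _) fun j _ _ =>
          mul_nonneg (by positivity) (Finset.sum_nonneg fun κ _ =>
            mul_nonneg (Nat.cast_nonneg _) (fejer_nonneg _ _))
    _ = 4 / (K * N) * ∑ κ ∈ Finset.range K, ((κ + 1 : ℕ) : ℝ) * G := by
        rw [← Finset.mul_sum, Finset.sum_comm]
        congr 1
        refine Finset.sum_congr rfl fun κ hκ => ?_
        rw [← Finset.mul_sum, sum_fejer_gridPt (Nat.succ_pos _) (by
          have := Finset.mem_range.1 hκ; omega)]
    _ ≤ 4 / (K * N) * ∑ κ ∈ Finset.range K, (K : ℝ) * G := by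
        gcongr with κ hκ
        have := Finset.mem_range.1 hκ; omega
    _ = G * (4 * K / N) := by
        rw [Finset.sum_const, Finset.card_range, nsmul_eq_mul]; field_simp
    _ ≤ G * (12 / (s * N)) := by
        have : 4 * K / N ≤ 12 / (s * N) := by
          rw [div_le_div_iff₀ hN' (by positivity)]
          nlinarith
        gcongr

/-! ### Bernstein's inequality and sampling -/

/-- The trigonometric polynomial with coefficients `c` truncated to frequencies at most `M`. -/
noncomputable def trigSum (c : ℤ → ℂ) (M : ℕ) (x : ℝ) : ℂ :=
  ∑ k ∈ Finset.Icc (-(M : ℤ)) M, c k * expChar k x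

theorem hasDerivAt_expChar (k : ℤ) (x : ℝ) :
    HasDerivAt (expChar k) (Complex.I * k * expChar k x) x := by
  unfold expChar
  have h : HasDerivAt (fun x : ℝ => (k : ℂ) * x * Complex.I) (k * 1 * Complex.I) x :=
    ((Complex.ofRealCLM.hasDerivAt (x := x)).const_mul (k : ℂ)).mul_const Complex.I
  convert h.cexp using 1
  ring

theorem hasDerivAt_trigSum (c : ℤ → ℂ) (M : ℕ) (x : ℝ) :
    HasDerivAt (trigSum c M) (trigSum (fun k => Complex.I * k * c k) M x) x := by
  unfold trigSum
  have := HasDerivAt.fun_sum (u := Finset.Icc (-(M : ℤ)) M) (x := x)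
    fun k _ => (hasDerivAt_expChar k x).const_mul (c k)
  exact this.congr_deriv (Finset.sum_congr rfl fun k _ => by ring)

theorem norm_tent_trigSum_le {c : ℤ → ℂ} {M : ℕ} {A : ℝ} (hA : ∀ x, ‖trigSum c M x‖ ≤ A) {N : ℕ}
    (hN : 0 < N) (c₀ : ℤ) (φ : ℝ) :
    ‖∑ k ∈ Finset.Icc (-(M : ℤ)) M, c k * (tent N (k - c₀) * expChar k φ)‖ ≤ A := by
  set G : ℕ := M + c₀.natAbs + N with hG
  have hG0 : (0 : ℝ) < G := by exact_mod_cast (by omega : 0 < G)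
  have h := norm_tent_sum_le (G := G) (Finset.Icc (-(M : ℤ)) M) c id hN 0 φ c₀ (by
    intro k hk
    have := Finset.mem_Icc.1 hk
    rw [hG, id]
    rcases abs_cases (k - c₀) with h | h <;> omega)
  refine le_of_mul_le_mul_left (h.trans ?_) hG0
  calc _ ≤ ∑ j ∈ Finset.range G, A * fejer N (φ - gridPt G 0 j) := by
        gcongr with j _
        · exact fejer_nonneg _ _
        · exact hA _
    _ = _ := by rw [← Finset.mul_sum, sum_fejer_gridPt hN (by omega)]; ring

/-- Bernstein's inequality, with constant `2`: the multiplier `k` is `M` times the difference of two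
tents on `[-M, M]`. -/
theorem norm_trigSum_deriv_le {c : ℤ → ℂ} {M : ℕ} {A : ℝ} (hA : ∀ x, ‖trigSum c M x‖ ≤ A) (φ : ℝ) :
    ‖trigSum (fun k => Complex.I * k * c k) M φ‖ ≤ 2 * M * A := by
  rcases Nat.eq_zero_or_pos M with rfl | hM
  · simp [trigSum]
  have hM' : (M : ℂ) ≠ 0 := by exact_mod_cast hM.ne'
  have h : trigSum (fun k => Complex.I * k * c k) M φ = Complex.I * M *
      ((∑ k ∈ Finset.Icc (-(M : ℤ)) M, c k * (tent M (k - M) * expChar k φ)) -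
       (∑ k ∈ Finset.Icc (-(M : ℤ)) M, c k * (tent M (k - (-M)) * expChar k φ))) := by
    rw [trigSum, ← Finset.sum_sub_distrib, Finset.mul_sum]
    refine Finset.sum_congr rfl fun k hk => ?_
    have hk := Finset.mem_Icc.1 hk
    have : (M : ℂ) * (tent M (k - M) - tent M (k - (-M))) = k := by
      rcases le_total 0 k with h0 | h0
      · rw [tent_eq_zero (k := k - (-M)) hM (by rw [abs_of_nonneg (by omega)]; omega),
          tent_eq hM (by rw [abs_le]; omega), ← Int.cast_abs, abs_of_nonpos (by omega)]
        push_cast; field_simp; ring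
      · rw [tent_eq_zero (k := k - M) hM (by rw [abs_of_nonpos (by omega)]; omega),
          tent_eq hM (by rw [abs_le]; omega), ← Int.cast_abs, abs_of_nonneg (by omega)]
        push_cast; field_simp; ring
    calc Complex.I * k * c k * expChar k φ = Complex.I * c k * expChar k φ * k := by ring
      _ = _ := by rw [← this]; ring
  rw [h, norm_mul, norm_mul, Complex.norm_I, Complex.norm_natCast, one_mul]
  calc _ ≤ (M : ℝ) * (A + A) := by
        gcongr
        exact (norm_sub_le _ _).trans (add_le_add (norm_tent_trigSum_le hA hM _ _)
          (norm_tent_trigSum_le hA hM _ _))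
    _ = _ := by ring

/-- A trigonometric polynomial of degree at most `M` is controlled by its values at the points
`2πj / G` for any `G ≥ 3M`, by means of a de la Vallée Poussin kernel. -/
theorem norm_trigSum_le_of_grid {c : ℤ → ℂ} {M G : ℕ} (hM : 0 < M) (hG : 3 * M ≤ G) {A : ℝ}
    (hA : ∀ j ∈ Finset.range G, ‖trigSum c M (gridPt G 0 j)‖ ≤ A) (φ : ℝ) :
    ‖trigSum c M φ‖ ≤ 3 * A := by
  have hG0 : (0 : ℝ) < G := by exact_mod_cast (by omega : 0 < G)
  have hb : ∀ N, 0 < N → N ≤ 2 * M →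
      ‖∑ k ∈ Finset.Icc (-(M : ℤ)) M, c k * (tent N (k - 0) * expChar k φ)‖ ≤ A := by
    intro N hN hNM
    have h := norm_tent_sum_le (G := G) (Finset.Icc (-(M : ℤ)) M) c id hN 0 φ 0 (by
      intro k hk
      have := Finset.mem_Icc.1 hk
      rw [id]
      rcases abs_cases (k - 0) with h | h <;> omega)
    refine le_of_mul_le_mul_left (h.trans ?_) hG0
    calc _ ≤ ∑ j ∈ Finset.range G, A * fejer N (φ - gridPt G 0 j) := by
          gcongr with j hj
          · exact fejer_nonneg _ _
          · exact hA j hj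
      _ = _ := by rw [← Finset.mul_sum, sum_fejer_gridPt hN (by omega)]; ring
  have h : trigSum c M φ =
      2 * (∑ k ∈ Finset.Icc (-(M : ℤ)) M, c k * (tent (2 * M) (k - 0) * expChar k φ)) -
       (∑ k ∈ Finset.Icc (-(M : ℤ)) M, c k * (tent M (k - 0) * expChar k φ)) := by
    rw [trigSum, Finset.mul_sum, ← Finset.sum_sub_distrib]
    refine Finset.sum_congr rfl fun k hk => ?_
    have hk := abs_le.2 (Finset.mem_Icc.1 hk)
    have : (2 : ℝ) * tent (2 * M) k - tent M k = 1 := by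
      rw [tent_eq hM hk, tent_eq (by omega) (by push_cast; omega)]
      have : (M : ℝ) ≠ 0 := by exact_mod_cast hM.ne'
      push_cast; field_simp; ring
    have this' : (2 : ℂ) * tent (2 * M) k - tent M k = 1 := by exact_mod_cast this
    rw [sub_zero]
    linear_combination -(c k * expChar k φ) * this'
  rw [h]
  calc _ ≤ 2 * A + A := by
        refine (norm_sub_le _ _).trans (add_le_add ?_ (hb M hM (by omega)))
        rw [norm_mul, Complex.norm_ofNat]
        gcongr
        exact hb _ (by omega) le_rfl
    _ = _ := by ring

/-! ### A Rudin–Shapiro cosine polynomial -/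

/-- The coefficients of the `t`-th pair of Rudin–Shapiro polynomials, which have degree `2 ^ t - 1`;
the values at larger indices are irrelevant. -/
def rudinShapiro : ℕ → (ℕ → ℝ) × (ℕ → ℝ)
  | 0 => (fun _ => 1, fun _ => 1)
  | t + 1 =>
    (fun k => if k < 2 ^ t then (rudinShapiro t).1 k else (rudinShapiro t).2 (k - 2 ^ t),
      fun k => if k < 2 ^ t then (rudinShapiro t).1 k else -(rudinShapiro t).2 (k - 2 ^ t))

theorem rudinShapiro_eq_or (t k : ℕ) :
    ((rudinShapiro t).1 k = 1 ∨ (rudinShapiro t).1 k = -1) ∧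
      ((rudinShapiro t).2 k = 1 ∨ (rudinShapiro t).2 k = -1) := by
  induction t generalizing k with
  | zero => simp [rudinShapiro]
  | succ t ih =>
    have h1 := ih k
    have h2 := ih (k - 2 ^ t)
    simp only [rudinShapiro]
    split_ifs
    · exact ⟨h1.1, h1.1⟩
    · refine ⟨h2.2, ?_⟩
      rcases h2.2 with h | h <;> rw [h] <;> simp

theorem sum_rudinShapiro_succ (t : ℕ) (g : ℕ → ℂ) :
    ∑ k ∈ Finset.range (2 ^ (t + 1)), (rudinShapiro (t + 1)).1 k * g k =
      ∑ k ∈ Finset.range (2 ^ t), (rudinShapiro t).1 k * g k +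
        ∑ k ∈ Finset.range (2 ^ t), (rudinShapiro t).2 k * g (2 ^ t + k) ∧
    ∑ k ∈ Finset.range (2 ^ (t + 1)), (rudinShapiro (t + 1)).2 k * g k =
      ∑ k ∈ Finset.range (2 ^ t), (rudinShapiro t).1 k * g k -
        ∑ k ∈ Finset.range (2 ^ t), (rudinShapiro t).2 k * g (2 ^ t + k) := by
  have h2 : 2 ^ (t + 1) = 2 ^ t + 2 ^ t := by ring
  constructor
  · rw [h2, Finset.sum_range_add]
    congr 1
    · refine Finset.sum_congr rfl fun k hk => ?_
      simp only [rudinShapiro, Finset.mem_range.1 hk, if_true]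
    · refine Finset.sum_congr rfl fun k hk => ?_
      have : ¬ (2 ^ t + k < 2 ^ t) := by omega
      simp only [rudinShapiro, this, if_false, Nat.add_sub_cancel_left]
  · rw [h2, Finset.sum_range_add, sub_eq_add_neg, ← Finset.sum_neg_distrib]
    congr 1
    · refine Finset.sum_congr rfl fun k hk => ?_
      simp only [rudinShapiro, Finset.mem_range.1 hk, if_true]
    · refine Finset.sum_congr rfl fun k hk => ?_
      have : ¬ (2 ^ t + k < 2 ^ t) := by omega
      simp only [rudinShapiro, this, if_false, Nat.add_sub_cancel_left]
      push_cast; ring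

/-- The Rudin–Shapiro identity, by the parallelogram law. -/
theorem rudinShapiro_norm_sq (t : ℕ) (x : ℝ) :
    ‖∑ k ∈ Finset.range (2 ^ t), (rudinShapiro t).1 k * expChar k x‖ ^ 2 +
      ‖∑ k ∈ Finset.range (2 ^ t), (rudinShapiro t).2 k * expChar k x‖ ^ 2 = 2 * 2 ^ t := by
  induction t with
  | zero => simp [rudinShapiro]; norm_num
  | succ t ih =>
    obtain ⟨h1, h2⟩ := sum_rudinShapiro_succ t (fun k => expChar k x)
    rw [h1, h2]
    have h3 : ‖∑ k ∈ Finset.range (2 ^ t), (rudinShapiro t).2 k * expChar ((2 ^ t + k : ℕ) : ℤ) x‖ =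
        ‖∑ k ∈ Finset.range (2 ^ t), (rudinShapiro t).2 k * expChar k x‖ := by
      have : ∀ k ∈ Finset.range (2 ^ t), (rudinShapiro t).2 k * expChar ((2 ^ t + k : ℕ) : ℤ) x =
          expChar ((2 ^ t : ℕ) : ℤ) x * ((rudinShapiro t).2 k * expChar k x) := by
        intro k _
        rw [Nat.cast_add, expChar_add]; ring
      rw [Finset.sum_congr rfl this, ← Finset.mul_sum, norm_mul, norm_expChar, one_mul]
    rw [← h3] at ih
    have hp := parallelogram_law_with_norm ℝ
      (∑ k ∈ Finset.range (2 ^ t), (rudinShapiro t).1 k * expChar k x)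
      (∑ k ∈ Finset.range (2 ^ t), (rudinShapiro t).2 k * expChar ((2 ^ t + k : ℕ) : ℤ) x)
    rw [pow_succ (2 : ℝ) t]
    nlinarith

/-- The coefficients of the cosine polynomial `1 + 2 ∑ r_{l-1} cos (l x)` built from the
Rudin–Shapiro coefficients `r` of level `t`. -/
noncomputable def rsCoeff (t : ℕ) (k : ℤ) : ℝ :=
  if k = 0 then 1 else (rudinShapiro t).1 (k.natAbs - 1)

theorem rsCoeff_zero (t : ℕ) : rsCoeff t 0 = 1 := if_pos rfl

theorem rsCoeff_eq_or (t : ℕ) (k : ℤ) : rsCoeff t k = 1 ∨ rsCoeff t k = -1 := by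
  unfold rsCoeff
  split_ifs
  · exact Or.inl rfl
  · exact (rudinShapiro_eq_or _ _).1

theorem rsCoeff_neg (t : ℕ) (k : ℤ) : rsCoeff t (-k) = rsCoeff t k := by
  simp [rsCoeff]

theorem rsCoeff_succ (t k : ℕ) : rsCoeff t ((k : ℤ) + 1) = (rudinShapiro t).1 k := by
  have h1 : (k : ℤ) + 1 ≠ 0 := by omega
  have h2 : ((k : ℤ) + 1).natAbs - 1 = k := by omega
  rw [rsCoeff, if_neg h1, h2]

/-- The cosine polynomial with coefficients `rsCoeff t`, of degree `2 ^ t`. -/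
noncomputable def rsSum (t : ℕ) (x : ℝ) : ℂ := trigSum (fun k => rsCoeff t k) (2 ^ t) x

theorem rsSum_eq (t : ℕ) (x : ℝ) : rsSum t x =
    1 + ∑ k ∈ Finset.range (2 ^ t), ((rudinShapiro t).1 k * expChar ((k : ℤ) + 1) x +
      (rudinShapiro t).1 k * expChar (-((k : ℤ) + 1)) x) := by
  rw [rsSum, trigSum, sum_Icc_neg_eq]
  simp only [rsCoeff_zero, rsCoeff_neg, rsCoeff_succ, expChar_zero, Complex.ofReal_one, mul_one]

theorem rsSum_eq_ofReal (t : ℕ) (x : ℝ) : rsSum t x =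
    ((1 + 2 * ∑ k ∈ Finset.range (2 ^ t), (rudinShapiro t).1 k * Real.cos ((k + 1) * x) : ℝ) : ℂ) := by
  rw [rsSum_eq, Finset.mul_sum]
  push_cast
  congr 1
  refine Finset.sum_congr rfl fun k _ => ?_
  rw [← mul_add, expChar_add_neg]
  push_cast; ring

theorem norm_rsSum_le (t : ℕ) (x : ℝ) : ‖rsSum t x‖ ≤ 4 * Real.sqrt (2 ^ t) := by
  have hs : ∀ σ : ℤ, σ = 1 ∨ σ = -1 → ‖∑ k ∈ Finset.range (2 ^ t),
      (rudinShapiro t).1 k * expChar (σ * ((k : ℤ) + 1)) x‖ ≤ 1.45 * Real.sqrt (2 ^ t) := by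
    intro σ hσ
    have h1 : ∀ k ∈ Finset.range (2 ^ t), (rudinShapiro t).1 k * expChar (σ * ((k : ℤ) + 1)) x =
        expChar σ x * ((rudinShapiro t).1 k * expChar k (σ * x)) := by
      intro k _
      have : expChar k (σ * x) = expChar (σ * k) x := by
        unfold expChar; push_cast; ring_nf
      rw [mul_add, mul_one, add_comm, expChar_add, this]; ring
    rw [Finset.sum_congr rfl h1, ← Finset.mul_sum, norm_mul, norm_expChar, one_mul]
    have h2 := rudinShapiro_norm_sq t (σ * x)
    refine le_of_sq_le_sq ?_ (by positivity)
    rw [mul_pow, Real.sq_sqrt (by positivity)]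
    nlinarith [sq_nonneg ‖∑ k ∈ Finset.range (2 ^ t), (rudinShapiro t).2 k * expChar k (σ * x)‖,
      show (0 : ℝ) < 2 ^ t by positivity]
  have h1 := hs 1 (Or.inl rfl)
  have h2 := hs (-1) (Or.inr rfl)
  simp only [one_mul, neg_mul] at h1 h2
  have h3 : (1 : ℝ) ≤ Real.sqrt (2 ^ t) := Real.one_le_sqrt.2 (one_le_pow₀ (by norm_num))
  rw [rsSum_eq, Finset.sum_add_distrib]
  calc _ ≤ 1 + (1.45 * Real.sqrt (2 ^ t) + 1.45 * Real.sqrt (2 ^ t)) := by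
        refine (norm_add_le _ _).trans (add_le_add (by simp) ?_)
        exact (norm_add_le _ _).trans (add_le_add h1 h2)
    _ ≤ _ := by linarith

/-- The values at `z = 1` of both Rudin–Shapiro polynomials of an even level `2 s`. -/
theorem sum_rudinShapiro_two_mul (s : ℕ) :
    ∑ k ∈ Finset.range (2 ^ (2 * s)), (rudinShapiro (2 * s)).1 k = 2 ^ s ∧
      ∑ k ∈ Finset.range (2 ^ (2 * s)), (rudinShapiro (2 * s)).2 k = 2 ^ s := by
  have key : ∀ t, ∑ k ∈ Finset.range (2 ^ (t + 1)), (rudinShapiro (t + 1)).1 k =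
      ∑ k ∈ Finset.range (2 ^ t), (rudinShapiro t).1 k +
        ∑ k ∈ Finset.range (2 ^ t), (rudinShapiro t).2 k ∧
      ∑ k ∈ Finset.range (2 ^ (t + 1)), (rudinShapiro (t + 1)).2 k =
      ∑ k ∈ Finset.range (2 ^ t), (rudinShapiro t).1 k -
        ∑ k ∈ Finset.range (2 ^ t), (rudinShapiro t).2 k := by
    intro t
    have := sum_rudinShapiro_succ t (fun _ => 1)
    simp only [mul_one] at this
    exact_mod_cast this
  induction s with
  | zero => simp [rudinShapiro]
  | succ s ih =>
    have e : 2 * (s + 1) = 2 * s + 1 + 1 := by ring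
    have h1 := key (2 * s)
    have h2 := key (2 * s + 1)
    rw [ih.1, ih.2] at h1
    rw [h1.1, h1.2] at h2
    rw [e, h2.1, h2.2, pow_succ]
    constructor <;> ring

theorem rsSum_zero (s : ℕ) : rsSum (2 * s) 0 = ((1 + 2 * 2 ^ s : ℝ) : ℂ) := by
  rw [rsSum_eq_ofReal]
  simp only [mul_zero, Real.cos_zero, mul_one]
  rw [(sum_rudinShapiro_two_mul s).1]

/-- The tent average of `rsSum (t + 2)` around the frequency `1 + c 2^t` sees only two consecutive
blocks of length `2 ^ t` of coefficients. -/
theorem tent_rsSum (t c : ℕ) (hc : 1 ≤ c) (x : ℝ) :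
    ∑ k ∈ Finset.Icc (-((2 ^ (t + 2) : ℕ) : ℤ)) (2 ^ (t + 2) : ℕ), (rsCoeff (t + 2) k : ℂ) *
      (tent (2 ^ t) (k - (1 + c * 2 ^ t : ℕ)) * expChar k x) =
    expChar 1 x * ∑ b ∈ Finset.range 4, expChar (2 ^ t : ℕ) x ^ b *
      ∑ k ∈ Finset.range (2 ^ t), (![(rudinShapiro t).1 k, (rudinShapiro t).2 k,
        (rudinShapiro t).1 k, -(rudinShapiro t).2 k] : Fin 4 → ℝ) (Fin.ofNat 4 b) *
        (tent (2 ^ t) (k + ((b : ℤ) - c) * 2 ^ t) * expChar k x) := by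
  have hL : 0 < 2 ^ t := by positivity
  have hp : (0 : ℤ) < 2 ^ t := by positivity
  have hcL : (2 : ℤ) ^ t ≤ c * 2 ^ t := by
    have : (1 : ℤ) ≤ c := by exact_mod_cast hc
    nlinarith [show (0 : ℤ) < 2 ^ t by positivity]
  rw [sum_Icc_neg_eq]
  have h0 : tent (2 ^ t) (0 - ((1 + c * 2 ^ t : ℕ) : ℤ)) = 0 :=
    tent_eq_zero hL (by push_cast; rw [abs_of_nonpos] <;> linarith)
  have hneg : ∀ k : ℕ, tent (2 ^ t) (-((k : ℤ) + 1) - ((1 + c * 2 ^ t : ℕ) : ℤ)) = 0 := fun k =>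
    tent_eq_zero hL (by push_cast; rw [abs_of_nonpos] <;> linarith)
  simp only [h0, hneg, Complex.ofReal_zero, zero_mul, mul_zero, zero_add, add_zero, rsCoeff_succ]
  have h1 := (sum_rudinShapiro_succ (t + 1) (fun k => (tent (2 ^ t) ((k : ℤ) + 1 -
    ((1 + c * 2 ^ t : ℕ) : ℤ)) * expChar ((k : ℤ) + 1) x : ℂ))).1
  rw [h1, (sum_rudinShapiro_succ t _).1, (sum_rudinShapiro_succ t _).2]
  simp only [Finset.sum_range_succ, Finset.sum_range_zero, zero_add, mul_add]
  have hw : ∀ b k : ℕ, expChar ((b * 2 ^ t + k : ℕ) + 1 : ℤ) x =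
      expChar 1 x * (expChar (2 ^ t : ℕ) x ^ b * expChar k x) := by
    intro b k
    rw [← expChar_natCast_mul, ← expChar_add, ← expChar_add]
    congr 1; push_cast; ring
  have ht : ∀ b k : ℕ, ((b * 2 ^ t + k : ℕ) : ℤ) + 1 - ((1 + c * 2 ^ t : ℕ) : ℤ) =
      k + ((b : ℤ) - c) * 2 ^ t := by
    intro b k; push_cast; ring
  have hb : ∀ (b : ℕ) (X : ℕ → ℝ) (f : ℕ → ℕ), (∀ k, f k = b * 2 ^ t + k) →
      ∑ k ∈ Finset.range (2 ^ t), (X k : ℂ) * (tent (2 ^ t) ((f k : ℤ) + 1 -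
        ((1 + c * 2 ^ t : ℕ) : ℤ)) * expChar ((f k : ℤ) + 1) x) =
      expChar 1 x * (expChar (2 ^ t : ℕ) x ^ b * ∑ k ∈ Finset.range (2 ^ t), (X k : ℂ) *
        (tent (2 ^ t) (k + ((b : ℤ) - c) * 2 ^ t) * expChar k x)) := by
    intro b X f hf
    rw [Finset.mul_sum, Finset.mul_sum]
    refine Finset.sum_congr rfl fun k _ => ?_
    rw [hf, hw, ht]; ring
  have b0 := hb 0 (rudinShapiro t).1 (fun k => k) (fun k => by ring)
  have b1 := hb 1 (rudinShapiro t).2 (fun k => 2 ^ t + k) (fun k => by ring)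
  have b2 := hb 2 (rudinShapiro t).1 (fun k => 2 ^ (t + 1) + k) (fun k => by ring)
  have b3 := hb 3 (rudinShapiro t).2 (fun k => 2 ^ (t + 1) + (2 ^ t + k)) (fun k => by ring)
  have hm : ∀ k : ℕ, ((-(rudinShapiro t).2 k : ℝ) : ℂ) = -((rudinShapiro t).2 k : ℂ) := fun k => by
    push_cast; rfl
  rw [b0, b1, b2, b3]
  simp only [Fin.ofNat]
  simp [hm, Finset.sum_neg_distrib]
  ring

/-- Wherever all four tent averages of `rsSum (t + 2)` are small, both Rudin–Shapiro polynomials of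
level `t` are small, which is impossible. -/
theorem exists_tent_rsSum_gt (t : ℕ) (x : ℝ) : ∃ c : ℕ, 1 ≤ c ∧ c ≤ 4 ∧ Real.sqrt (2 ^ t) / 3 <
    ‖∑ k ∈ Finset.Icc (-((2 ^ (t + 2) : ℕ) : ℤ)) (2 ^ (t + 2) : ℕ), (rsCoeff (t + 2) k : ℂ) *
      (tent (2 ^ t) (k - (1 + c * 2 ^ t : ℕ)) * expChar k x)‖ := by
  by_contra! hcon
  have hL : 0 < 2 ^ t := by positivity
  have hLr : (2 ^ t : ℝ) ≠ 0 := by positivity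
  set ε := Real.sqrt (2 ^ t) / 3 with hε
  set U : (ℕ → ℝ) → ℂ := fun X => ∑ k ∈ Finset.range (2 ^ t), X k * (((k / 2 ^ t : ℝ) : ℂ) *
    expChar k x) with hU
  set V : (ℕ → ℝ) → ℂ := fun X => ∑ k ∈ Finset.range (2 ^ t), X k * (((1 - k / 2 ^ t : ℝ) : ℂ) *
    expChar k x) with hV
  set p := (rudinShapiro t).1 with hp
  set q := (rudinShapiro t).2 with hq
  set w := expChar (2 ^ t : ℕ) x with hw
  have hUneg : ∀ X, U (-X) = -U X := by
    intro X; simp [hU, Finset.sum_neg_distrib]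
  have hVneg : ∀ X, V (-X) = -V X := by
    intro X; simp [hV, Finset.sum_neg_distrib]
  -- the block just below the centre of the tent is weighted by `U`, the next one by `V`
  have hblock : ∀ (X : ℕ → ℝ) (d : ℤ), ∑ k ∈ Finset.range (2 ^ t), (X k : ℂ) *
      (tent (2 ^ t) (k + d * 2 ^ t) * expChar k x) =
      if d = 0 then V X else if d = -1 then U X else 0 := by
    intro X d
    have hkL : ∀ k ∈ Finset.range (2 ^ t), (k : ℤ) < 2 ^ t := fun k hk => by
      exact_mod_cast Finset.mem_range.1 hk
    have hLz : (0 : ℤ) < 2 ^ t := by positivity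
    split_ifs with h0 h1
    · subst h0
      refine Finset.sum_congr rfl fun k hk => ?_
      have := hkL k hk
      rw [zero_mul, add_zero, tent_eq hL (by rw [abs_of_nonneg (by positivity)]; push_cast; omega),
        ← Int.cast_abs, abs_of_nonneg (by positivity)]
      push_cast; ring
    · subst h1
      refine Finset.sum_congr rfl fun k hk => ?_
      have := hkL k hk
      rw [tent_eq hL (by rw [abs_of_nonpos (by linarith)]; push_cast; linarith [Int.natCast_nonneg k]),
        ← Int.cast_abs, abs_of_nonpos (by linarith)]
      have : (1 - ((-((k : ℤ) + -1 * 2 ^ t) : ℤ) : ℝ) / (2 ^ t : ℕ) : ℝ) = k / 2 ^ t := by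
        push_cast; field_simp; ring
      rw [this]
    · refine Finset.sum_eq_zero fun k hk => ?_
      have := hkL k hk
      have hk0 := Int.natCast_nonneg k
      rw [tent_eq_zero hL]
      · simp
      · push_cast
        rcases lt_or_ge d 0 with hd | hd
        · have : d ≤ -2 := by omega
          rw [abs_of_nonpos] <;> nlinarith
        · have : 1 ≤ d := by omega
          rw [abs_of_nonneg] <;> nlinarith
  have hT : ∀ c : ℕ, 1 ≤ c → c ≤ 4 → ‖∑ b ∈ Finset.range 4, w ^ b *
      (if (b : ℤ) - c = 0 then V ((![p, q, p, -q] : Fin 4 → ℕ → ℝ) (Fin.ofNat 4 b)) else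
        if (b : ℤ) - c = -1 then U ((![p, q, p, -q] : Fin 4 → ℕ → ℝ) (Fin.ofNat 4 b)) else 0)‖ ≤ ε := by
    intro c hc1 hc4
    have h := hcon c hc1 hc4
    rw [tent_rsSum t c hc1, norm_mul, norm_expChar, one_mul] at h
    refine le_of_eq_of_le (congrArg norm (Finset.sum_congr rfl fun b hb => ?_)) h
    congr 1
    rw [← hblock]
    refine Finset.sum_congr rfl fun k _ => ?_
    congr 2
    have := Finset.mem_range.1 hb
    interval_cases b <;> rfl
  have hw1 : ‖w‖ = 1 := norm_expChar _ _
  have T1 : ‖w * V q + U p‖ ≤ ε := by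
    have := hT 1 le_rfl (by norm_num)
    simpa [Finset.sum_range_succ, Fin.ofNat, add_comm] using this
  have T2 : ‖w * U q + w ^ 2 * V p‖ ≤ ε := by
    have := hT 2 (by norm_num) (by norm_num)
    simpa [Finset.sum_range_succ, Fin.ofNat] using this
  have T3 : ‖w ^ 2 * U p - w ^ 3 * V q‖ ≤ ε := by
    have := hT 3 (by norm_num) (by norm_num)
    simpa [Finset.sum_range_succ, Fin.ofNat, hVneg, sub_eq_add_neg] using this
  have T4 : ‖U q‖ ≤ ε := by
    have := hT 4 (by norm_num) (by norm_num)
    simpa [Finset.sum_range_succ, Fin.ofNat, hUneg, hw1] using this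
  have T1' : ‖w ^ 2 * (w * V q + U p)‖ ≤ ε := by rw [norm_mul, norm_pow, hw1]; simpa using T1
  -- the sign change in the last block separates `U p` from `V q` in the averages `T1` and `T3`
  have hUp : ‖U p‖ ≤ ε := by
    have e : (2 : ℂ) * (w ^ 2 * U p) = w ^ 2 * (w * V q + U p) + (w ^ 2 * U p - w ^ 3 * V q) := by
      ring
    have := norm_add_le (w ^ 2 * (w * V q + U p)) (w ^ 2 * U p - w ^ 3 * V q)
    rw [← e, norm_mul, norm_mul, norm_pow, hw1, Complex.norm_ofNat] at this
    linarith
  have hVq : ‖V q‖ ≤ ε := by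
    have e : (2 : ℂ) * (w ^ 3 * V q) = w ^ 2 * (w * V q + U p) - (w ^ 2 * U p - w ^ 3 * V q) := by
      ring
    have := norm_sub_le (w ^ 2 * (w * V q + U p)) (w ^ 2 * U p - w ^ 3 * V q)
    rw [← e, norm_mul, norm_mul, norm_pow, hw1, Complex.norm_ofNat] at this
    linarith
  have hVp : ‖V p‖ ≤ 2 * ε := by
    have e : w ^ 2 * V p = (w * U q + w ^ 2 * V p) - w * U q := by ring
    have := norm_sub_le (w * U q + w ^ 2 * V p) (w * U q)
    rw [← e, norm_mul, norm_mul, norm_pow, hw1] at this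
    linarith
  have hsum : ∀ X : ℕ → ℝ, ∑ k ∈ Finset.range (2 ^ t), X k * expChar k x = U X + V X := by
    intro X
    rw [hU, hV, ← Finset.sum_add_distrib]
    refine Finset.sum_congr rfl fun k _ => ?_
    push_cast; ring
  have hn := rudinShapiro_norm_sq t x
  rw [hsum, hsum] at hn
  have h1 : ‖U p + V p‖ ≤ 3 * ε := (norm_add_le _ _).trans (by linarith)
  have h2 : ‖U q + V q‖ ≤ 2 * ε := (norm_add_le _ _).trans (by linarith)
  have h3 : ε ^ 2 * 9 = 2 ^ t := by
    rw [hε, div_pow, Real.sq_sqrt (by positivity)]; ring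
  have hε0 : 0 < 2 ^ t := by positivity
  have h1' : ‖U p + V p‖ ^ 2 ≤ (3 * ε) ^ 2 := by gcongr
  have h2' : ‖U q + V q‖ ^ 2 ≤ (2 * ε) ^ 2 := by gcongr
  have h4 : (0 : ℝ) < 2 ^ t := by positivity
  nlinarith

/-- The polynomial `rsSum (t + 2)` is large somewhere in every arc of length a constant multiple
of `2 ^ (-t)`. -/
theorem exists_near_rsSum_gt {t : ℕ} (ht : 2500 ≤ 2 ^ t) (φ : ℝ) :
    ∃ x, |x - φ| ≤ 2500 * Real.pi / 2 ^ t ∧ Real.sqrt (2 ^ t) / 12 < ‖rsSum (t + 2) x‖ := by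
  have hL : 0 < 2 ^ t := by positivity
  have hLr : (0 : ℝ) < 2 ^ t := by positivity
  have htr : (2500 : ℝ) ≤ 2 ^ t := by exact_mod_cast ht
  obtain ⟨c, hc1, hc4, hc⟩ := exists_tent_rsSum_gt t φ
  set s : ℝ := 2500 / 2 ^ t with hs
  have hs0 : 0 < s := by positivity
  have hs1 : s ≤ 1 := by rw [hs, div_le_one hLr]; exact htr
  set G : ℕ := 16 * 2 ^ t with hG
  have hGr : (G : ℝ) = 16 * 2 ^ t := by rw [hG]; push_cast; rfl
  have hG0 : (0 : ℝ) < G := by rw [hGr]; positivity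
  have hmain := norm_tent_sum_le (G := G) (Finset.Icc (-((2 ^ (t + 2) : ℕ) : ℤ)) (2 ^ (t + 2) : ℕ))
    (fun k => (rsCoeff (t + 2) k : ℂ)) id hL 0 φ (1 + c * 2 ^ t : ℕ) (by
      intro k hk
      have hk := Finset.mem_Icc.1 hk
      rw [id]
      push_cast [pow_add] at hk ⊢
      have hp : (1 : ℤ) ≤ 2 ^ t := by exact_mod_cast hL
      have hc1' : (1 : ℤ) ≤ c := by exact_mod_cast hc1
      have hc4' : (c : ℤ) ≤ 4 := by exact_mod_cast hc4
      have h5 : (c : ℤ) * 2 ^ t ≤ 4 * 2 ^ t := by gcongr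
      have h6 : (1 : ℤ) * 2 ^ t ≤ c * 2 ^ t := by gcongr
      rw [hG]; push_cast
      rcases abs_cases (k - (1 + c * 2 ^ t : ℤ)) with h | h <;> linarith)
  -- otherwise the average would be at most `1 / 12` plus the tail `8 * 12 / 2500`, in units of
  -- `sqrt (2 ^ t)`, and this is less than `1 / 3`
  have hpt : ∃ j ∈ Finset.range G, |Real.sin ((φ - gridPt G 0 j) / 2)| < s ∧
      Real.sqrt (2 ^ t) / 12 < ‖rsSum (t + 2) (gridPt G 0 j)‖ := by
    by_contra! hcon
    have hle : ∀ j ∈ Finset.range G, ‖rsSum (t + 2) (gridPt G 0 j)‖ * fejer (2 ^ t) (φ - gridPt G 0 j) ≤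
        Real.sqrt (2 ^ t) / 12 * fejer (2 ^ t) (φ - gridPt G 0 j) +
        if s ≤ |Real.sin ((φ - gridPt G 0 j) / 2)| then
          8 * Real.sqrt (2 ^ t) * fejer (2 ^ t) (φ - gridPt G 0 j) else 0 := by
      intro j hj
      have hf := fejer_nonneg (2 ^ t) (φ - gridPt G 0 j)
      have hq : 0 ≤ Real.sqrt (2 ^ t) / 12 * fejer (2 ^ t) (φ - gridPt G 0 j) := by positivity
      split_ifs with h
      · have h1 := norm_rsSum_le (t + 2) (gridPt G 0 j)
        have h2 : Real.sqrt (2 ^ (t + 2)) = 2 * Real.sqrt (2 ^ t) := by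
          rw [pow_add, Real.sqrt_mul hLr.le, show (2 : ℝ) ^ 2 = 2 * 2 by norm_num,
            Real.sqrt_mul_self (by norm_num)]; ring
        rw [h2] at h1
        have := mul_le_mul_of_nonneg_right h1 hf
        linarith
      · have := mul_le_mul_of_nonneg_right (hcon j hj (not_le.1 h)) hf
        linarith
    have htail := fejer_tail (N := 2 ^ t) (G := G) hL 0 φ hs0 hs1 (by
      rw [hGr, hs, mul_assoc, mul_div_cancel₀ _ hLr.ne']; norm_num)
    have h2 := hmain.trans (Finset.sum_le_sum hle)
    rw [Finset.sum_add_distrib, ← Finset.mul_sum, sum_fejer_gridPt hL (by omega),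
      ← Finset.sum_filter, ← Finset.mul_sum] at h2
    have h3 : (G : ℝ) * (12 / (s * (2 ^ t : ℕ))) = G * (12 / 2500) := by
      rw [hs]; push_cast; rw [div_mul_cancel₀ _ hLr.ne']
    rw [h3] at htail
    have h4 : 0 < Real.sqrt (2 ^ t) := Real.sqrt_pos.2 hLr
    have h5 := mul_le_mul_of_nonneg_left htail (show 0 ≤ 8 * Real.sqrt (2 ^ t) by positivity)
    have h6 := mul_lt_mul_of_pos_left hc hG0
    have h7 : 0 < (G : ℝ) * Real.sqrt (2 ^ t) := by positivity
    simp only [id] at h2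
    nlinarith
  obtain ⟨j, -, hj1, hj2⟩ := hpt
  set y := gridPt G 0 j with hy
  set n : ℤ := round ((φ - y) / (2 * Real.pi)) with hn
  refine ⟨y + n * (2 * Real.pi), ?_, ?_⟩
  · have hpi := Real.pi_pos
    have h1 := abs_sub_round ((φ - y) / (2 * Real.pi))
    rw [← hn] at h1
    set d : ℝ := (φ - y) / 2 - n * Real.pi with hd
    have hd1 : |d| ≤ Real.pi / 2 := by
      have : d = ((φ - y) / (2 * Real.pi) - n) * Real.pi := by rw [hd]; field_simp
      rw [this, abs_mul, abs_of_pos hpi]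
      nlinarith
    have h2 := Real.mul_abs_le_abs_sin hd1
    have h3 : |Real.sin d| < s := by
      rw [hd, Real.sin_sub_int_mul_pi, abs_mul, abs_zpow, abs_neg, abs_one, one_zpow, one_mul]
      exact hj1
    have h4 : y + n * (2 * Real.pi) - φ = -(2 * d) := by rw [hd]; ring
    rw [h4, abs_neg, abs_mul, abs_two]
    have h5 : 2 / Real.pi * |d| < s := lt_of_le_of_lt h2 h3
    rw [div_mul_eq_mul_div, div_lt_iff₀ hpi] at h5
    rw [mul_div_right_comm]
    exact h5.le
  · have : rsSum (t + 2) (y + n * (2 * Real.pi)) = rsSum (t + 2) y := by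
      rw [rsSum_eq_ofReal, rsSum_eq_ofReal]
      congr 3
      refine Finset.sum_congr rfl fun k _ => ?_
      have : ((k : ℝ) + 1) * (y + n * (2 * Real.pi)) =
          (k + 1) * y + ((((k : ℤ) + 1) * n : ℤ) : ℝ) * (2 * Real.pi) := by push_cast; ring
      rw [this, Real.cos_add_int_mul_two_pi]
    rw [this]; exact hj2

/-! ### Sublevel sets of functions with controlled derivatives -/

/-- Taylor's inequality for a function `f 0` with successive derivatives `f d`. -/
theorem abs_le_taylor_of_nonneg {f : ℕ → ℝ → ℝ} (hf : ∀ d x, HasDerivAt (f d) (f (d + 1) x) x)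
    {x₀ K : ℝ} (D : ℕ) (hK : ∀ x, |f D x| ≤ K) {u : ℝ} (hu : 0 ≤ u) :
    |f 0 (x₀ + u)| ≤ ∑ d ∈ Finset.range D, |f d x₀| * (u ^ d / d.factorial) +
      K * (u ^ D / D.factorial) := by
  induction D generalizing f u with
  | zero => simpa using hK (x₀ + u)
  | succ D ih =>
    set B : ℝ → ℝ := fun v => ∑ d ∈ Finset.range (D + 1), |f d x₀| * (v ^ d / d.factorial) +
      K * (v ^ (D + 1) / (D + 1).factorial) with hB
    set B' : ℝ → ℝ := fun v => ∑ d ∈ Finset.range D, |f (d + 1) x₀| * (v ^ d / d.factorial) +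
      K * (v ^ D / D.factorial) with hB'
    have hpow : ∀ (d : ℕ) (v : ℝ), HasDerivAt (fun v : ℝ => v ^ (d + 1) / (d + 1).factorial)
        (v ^ d / d.factorial) v := by
      intro d v
      refine ((hasDerivAt_pow (d + 1) v).div_const _).congr_deriv ?_
      rw [Nat.factorial_succ]
      have : (d.factorial : ℝ) ≠ 0 := by exact_mod_cast d.factorial_ne_zero
      have : ((d : ℝ) + 1) ≠ 0 := by positivity
      push_cast
      field_simp
    have hBd : ∀ v, HasDerivAt B (B' v) v := by
      intro v
      have h1 : B = fun v => |f 0 x₀| + ∑ d ∈ Finset.range D,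
          |f (d + 1) x₀| * (v ^ (d + 1) / (d + 1).factorial) +
            K * (v ^ (D + 1) / (D + 1).factorial) := by
        funext v
        simp only [hB]
        rw [Finset.sum_range_succ']
        simp
        ring
      rw [h1]
      refine HasDerivAt.fun_add ?_ ((hpow D v).const_mul K)
      refine HasDerivAt.const_add _ ?_
      exact HasDerivAt.fun_sum fun d _ => (hpow d v).const_mul _
    have h := image_norm_le_of_norm_deriv_right_le_deriv_boundary (f := fun v => f 0 (x₀ + v))
      (f' := fun v => f 1 (x₀ + v)) (a := 0) (b := u) (B := B) (B' := B')
      (fun v _ => ((hf 0 (x₀ + v)).comp_const_add x₀ v).continuousAt.continuousWithinAt)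
      (fun v _ => ((hf 0 (x₀ + v)).comp_const_add x₀ v).hasDerivWithinAt)
      (by
        simp only [hB, add_zero, Real.norm_eq_abs]
        rw [Finset.sum_range_succ']
        simp)
      hBd (fun v hv => ih (f := fun d => f (d + 1)) (fun d => hf (d + 1)) hK hv.1)
    exact h ⟨hu, le_rfl⟩

theorem abs_le_taylor {f : ℕ → ℝ → ℝ} (hf : ∀ d x, HasDerivAt (f d) (f (d + 1) x) x)
    {x₀ K : ℝ} (D : ℕ) (hK : ∀ x, |f D x| ≤ K) (x : ℝ) :
    |f 0 x| ≤ ∑ d ∈ Finset.range D, |f d x₀| * (|x - x₀| ^ d / d.factorial) +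
      K * (|x - x₀| ^ D / D.factorial) := by
  rcases le_total x₀ x with h | h
  · have := abs_le_taylor_of_nonneg (x₀ := x₀) hf D hK (u := x - x₀) (by linarith)
    rw [abs_of_nonneg (by linarith : 0 ≤ x - x₀)]
    simpa using this
  · have hf' : ∀ d x, HasDerivAt ((fun (d : ℕ) (x : ℝ) => (-1) ^ d * f d (-x)) d)
        ((fun (d : ℕ) (x : ℝ) => (-1) ^ d * f d (-x)) (d + 1) x) x := by
      intro d x
      have := ((hf d (-x)).scomp x (hasDerivAt_neg x)).const_mul ((-1 : ℝ) ^ d)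
      refine this.congr_deriv ?_
      simp [pow_succ]
    have := abs_le_taylor_of_nonneg (x₀ := -x₀) hf' D (K := K)
      (by intro x; simpa [abs_mul] using hK (-x)) (u := x₀ - x) (by linarith)
    rw [abs_sub_comm, abs_of_nonneg (by linarith : 0 ≤ x₀ - x)]
    simpa [abs_mul] using this

/-- If `|f|` exceeds `c` within distance `R` of each point, then at each point one of the first
`D` derivatives is bounded below. -/
theorem exists_deriv_lower_bound {A B R c : ℝ} (hA : 0 ≤ A) (hB : 0 ≤ B) (hR : 0 ≤ R)
    (hc : 0 < c) : ∃ (D : ℕ) (c₁ : ℝ), 0 < c₁ ∧ ∀ f : ℕ → ℝ → ℝ,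
      (∀ d x, HasDerivAt (f d) (f (d + 1) x) x) → (∀ d x, |f d x| ≤ A * B ^ d) →
      (∀ x₀, ∃ x, |x - x₀| ≤ R ∧ c < |f 0 x|) → ∀ x₀, ∃ d < D, c₁ < |f d x₀| := by
  have hlim := (FloorSemiring.tendsto_pow_div_factorial_atTop (B * R)).const_mul A
  rw [mul_zero] at hlim
  obtain ⟨D, hD⟩ := (hlim.eventually (gt_mem_nhds (half_pos hc))).exists
  refine ⟨D, c / 2 * Real.exp (-R), by positivity, fun f hf hfb hfc x₀ => ?_⟩
  by_contra! hcon
  obtain ⟨x, hx, hxc⟩ := hfc x₀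
  have h1 := abs_le_taylor (x₀ := x₀) hf D (hfb D) x
  have h2 : A * B ^ D * (|x - x₀| ^ D / D.factorial) ≤ A * ((B * R) ^ D / D.factorial) := by
    rw [mul_pow, mul_assoc, mul_div_assoc]
    gcongr
  have h3 : ∑ d ∈ Finset.range D, |f d x₀| * (|x - x₀| ^ d / d.factorial) ≤ c / 2 := by
    calc _ ≤ ∑ d ∈ Finset.range D, c / 2 * Real.exp (-R) * (R ^ d / d.factorial) := by
          gcongr with d hd
          exact hcon d (Finset.mem_range.1 hd)
      _ = c / 2 * Real.exp (-R) * ∑ d ∈ Finset.range D, R ^ d / d.factorial := by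
          rw [Finset.mul_sum]
      _ ≤ c / 2 * Real.exp (-R) * Real.exp R := by
          gcongr
          exact Real.sum_le_exp_of_nonneg hR D
      _ = c / 2 := by rw [mul_assoc, ← Real.exp_add]; simp
  linarith

/-- Smallness at `2 ^ d` separated points forces the `d`-th derivative to be small somewhere. -/
theorem exists_small_deriv {f : ℕ → ℝ → ℝ} (hf : ∀ d x, HasDerivAt (f d) (f (d + 1) x) x)
    {η δ : ℝ} (hη : 0 < η) (d : ℕ) (y : ℕ → ℝ) (hy : ∀ i, i + 1 < 2 ^ d → η ≤ y (i + 1) - y i)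
    (hyf : ∀ i < 2 ^ d, |f 0 (y i)| ≤ δ) :
    ∃ ξ, y 0 ≤ ξ ∧ ξ ≤ y (2 ^ d - 1) ∧ |f d ξ| ≤ (2 / η) ^ d * δ := by
  induction d generalizing f δ y with
  | zero => exact ⟨y 0, le_rfl, le_rfl, by simpa using hyf 0 (by norm_num)⟩
  | succ d ih =>
    have h2 : 2 ^ (d + 1) = 2 * 2 ^ d := by ring
    rw [h2] at hy hyf ⊢
    have hex : ∀ i, ∃ ξ, i < 2 ^ d → y (2 * i) ≤ ξ ∧ ξ ≤ y (2 * i + 1) ∧ |f 1 ξ| ≤ 2 / η * δ := by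
      intro i
      by_cases hi : i < 2 ^ d
      · have hsep := hy (2 * i) (by omega)
        obtain ⟨ξ, hξ, hξ'⟩ := exists_hasDerivAt_eq_slope (f 0) (f 1)
          (show y (2 * i) < y (2 * i + 1) by linarith)
          (fun x _ => (hf 0 x).continuousAt.continuousWithinAt) (fun x _ => hf 0 x)
        refine ⟨ξ, fun _ => ⟨hξ.1.le, hξ.2.le, ?_⟩⟩
        rw [hξ', abs_div, abs_of_pos (by linarith : 0 < y (2 * i + 1) - y (2 * i)),
          div_le_iff₀ (by linarith)]
        have e1 := hyf (2 * i) (by omega)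
        have e2 := hyf (2 * i + 1) (by omega)
        have hδ : 0 ≤ δ := (abs_nonneg _).trans e1
        calc |f 0 (y (2 * i + 1)) - f 0 (y (2 * i))| ≤ δ + δ := (abs_sub _ _).trans (by linarith)
          _ = 2 / η * δ * η := by field_simp; ring
          _ ≤ _ := by gcongr
      · exact ⟨0, fun h => absurd h hi⟩
    choose z hz using hex
    obtain ⟨ξ, h1, h3, h4⟩ := ih (f := fun d => f (d + 1)) (fun d => hf (d + 1)) z
      (fun i hi => by
        have a1 := hz i (by omega)
        have a2 := hz (i + 1) hi
        have a3 := hy (2 * i + 1) (by omega)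
        have : 2 * (i + 1) = 2 * i + 1 + 1 := by ring
        rw [this] at a2
        linarith [a1.2.1, a2.1]) (fun i hi => (hz i hi).2.2)
    have hp : 0 < 2 ^ d := by positivity
    refine ⟨ξ, (hz 0 hp).1.trans h1, h3.trans ?_, h4.trans (le_of_eq ?_)⟩
    · have := (hz (2 ^ d - 1) (by omega)).2.1
      have e : 2 * (2 ^ d - 1) + 1 = 2 * 2 ^ d - 1 := by omega
      rwa [e] at this
    · rw [pow_succ]; ring

/-- In a window of length `κ` there are boundedly many cells of length `η` on which `|f|` comes
below `δ`, with a bound which does not depend on `η`. -/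
theorem exists_card_small_cells_le {A B R c : ℝ} (hA : 0 < A) (hB : 1 ≤ B) (hR : 0 ≤ R)
    (hc : 0 < c) : ∃ (κ : ℝ) (D₁ : ℕ), 0 < κ ∧ ∀ η : ℝ, 0 < η → η ≤ 2 → ∃ δ : ℝ, 0 < δ ∧
      ∀ f : ℕ → ℝ → ℝ,
      (∀ d x, HasDerivAt (f d) (f (d + 1) x) x) → (∀ d x, |f d x| ≤ A * B ^ d) →
      (∀ x₀, ∃ x, |x - x₀| ≤ R ∧ c < |f 0 x|) → ∀ (s : Finset ℕ) (c₀ W : ℕ), W * η ≤ κ →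
      s ⊆ Finset.Ico c₀ (c₀ + W) →
      (∀ i ∈ s, ∃ x, i * η ≤ x ∧ x ≤ (i + 1) * η ∧ |f 0 x| ≤ δ) → s.card ≤ D₁ := by
  obtain ⟨D, c₁, hc₁, hD⟩ := exists_deriv_lower_bound hA.le (zero_le_one.trans hB) hR hc
  have hB0 : 0 < B := by linarith
  refine ⟨c₁ / 2 / (A * B ^ D), 2 * 2 ^ D, by positivity, fun η hη hη2 =>
    ⟨c₁ / 2 * (η / 2) ^ D, by positivity, fun f hf hfb hfc s c₀ W hW hs hsδ => ?_⟩⟩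
  by_contra! hcard
  -- points chosen in every second small cell are separated by at least `η`
  set e := s.orderEmbOfFin rfl with he
  have hbig : ∀ i, i < 2 ^ D → 2 * i < s.card := fun i hi => by omega
  have hmem : ∀ k, e k ∈ s := fun k => s.orderEmbOfFin_mem rfl k
  have hpt : ∀ i, ∃ x, ∀ h : i < 2 ^ D, ((e ⟨2 * i, hbig i h⟩ : ℕ) : ℝ) * η ≤ x ∧
      x ≤ ((e ⟨2 * i, hbig i h⟩ : ℕ) + 1) * η ∧ |f 0 x| ≤ c₁ / 2 * (η / 2) ^ D := by
    intro i
    by_cases h : i < 2 ^ D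
    · obtain ⟨x, hx⟩ := hsδ _ (hmem ⟨2 * i, hbig i h⟩)
      exact ⟨x, fun _ => hx⟩
    · exact ⟨0, fun h' => absurd h' h⟩
  choose y hy using hpt
  have hsep : ∀ i, i + 1 < 2 ^ D → η ≤ y (i + 1) - y i := by
    intro i hi
    have h1 := hy i (by omega)
    have h2 := hy (i + 1) hi
    have l1 : e ⟨2 * i, hbig i (by omega)⟩ < e ⟨2 * i + 1, by have := hbig (i + 1) hi; omega⟩ :=
      e.strictMono (by simp)
    have l2 : e ⟨2 * i + 1, by have := hbig (i + 1) hi; omega⟩ < e ⟨2 * (i + 1), hbig (i + 1) hi⟩ :=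
      e.strictMono (Fin.mk_lt_mk.2 (by omega))
    have l3 : ((e ⟨2 * i, hbig i (by omega)⟩ : ℕ) : ℝ) + 2 ≤ (e ⟨2 * (i + 1), hbig (i + 1) hi⟩ : ℕ) := by
      have l4 := Nat.succ_le_of_lt ((Nat.succ_le_of_lt l1).trans_lt l2)
      exact_mod_cast l4
    have := mul_le_mul_of_nonneg_right l3 hη.le
    linarith [h1.2.1, h2.1]
  obtain ⟨d, hdD, hd⟩ := hD f hf hfb hfc (c₀ * η)
  have hpow : 2 ^ d ≤ 2 ^ D := Nat.pow_le_pow_right (by norm_num) hdD.le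
  obtain ⟨ξ, hξ0, hξ1, hξ⟩ := exists_small_deriv hf hη d y (fun i hi => hsep i (by omega))
    (fun i hi => (hy i (by omega)).2.2)
  have hd0 : 0 < 2 ^ d := by positivity
  have hlow : c₀ * η ≤ ξ := by
    refine le_trans ?_ hξ0
    refine le_trans ?_ (hy 0 (by omega)).1
    have := (Finset.mem_Ico.1 (hs (hmem ⟨2 * 0, hbig 0 (by omega)⟩))).1
    gcongr
  have hupp : ξ ≤ c₀ * η + c₁ / 2 / (A * B ^ D) := by
    refine hξ1.trans ((hy (2 ^ d - 1) (by omega)).2.1.trans ?_)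
    have := (Finset.mem_Ico.1 (hs (hmem ⟨2 * (2 ^ d - 1), hbig _ (by omega)⟩))).2
    have h1 : ((e ⟨2 * (2 ^ d - 1), hbig _ (by omega)⟩ : ℕ) : ℝ) + 1 ≤ c₀ + W := by
      exact_mod_cast this
    have := mul_le_mul_of_nonneg_right h1 hη.le
    linarith
  have hdiff : |f d (c₀ * η) - f d ξ| ≤ A * B ^ (d + 1) * |c₀ * η - ξ| := by
    have := Convex.norm_image_sub_le_of_norm_hasDerivWithin_le (f := f d) (f' := f (d + 1))
      (s := Set.univ) (x := ξ) (y := c₀ * η) (C := A * B ^ (d + 1))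
      (fun x _ => (hf d x).hasDerivWithinAt) (fun x _ => hfb (d + 1) x) convex_univ trivial trivial
    simpa [Real.norm_eq_abs] using this
  have h1 : A * B ^ (d + 1) * |c₀ * η - ξ| ≤ c₁ / 2 := by
    have h2 : |c₀ * η - ξ| ≤ c₁ / 2 / (A * B ^ D) := by
      rw [abs_le]
      have : 0 < c₁ / 2 / (A * B ^ D) := by positivity
      constructor <;> linarith
    calc A * B ^ (d + 1) * |c₀ * η - ξ| ≤ A * B ^ D * (c₁ / 2 / (A * B ^ D)) := by
          gcongr
          exact hdD
      _ = c₁ / 2 := by field_simp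
  have h2 : (2 / η) ^ d * (c₁ / 2 * (η / 2) ^ D) ≤ c₁ / 2 := by
    have h3 : (η / 2) ^ D ≤ (η / 2) ^ d :=
      pow_le_pow_of_le_one (by positivity) (by linarith) hdD.le
    calc (2 / η) ^ d * (c₁ / 2 * (η / 2) ^ D) ≤ (2 / η) ^ d * (c₁ / 2 * (η / 2) ^ d) := by gcongr
      _ = c₁ / 2 * ((2 / η) * (η / 2)) ^ d := by rw [mul_pow]; ring
      _ = c₁ / 2 := by
          have : 2 / η * (η / 2) = 1 := by field_simp
          rw [this, one_pow, mul_one]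
  have := abs_sub_abs_le_abs_sub (f d (c₀ * η)) (f d ξ)
  linarith

/-- The number of small cells of the Rudin–Shapiro cosine polynomial, at the scale `2 ^ (-t)`. -/
theorem exists_card_small_cells_rsSum_le : ∃ (κ : ℝ) (D₁ : ℕ), 0 < κ ∧ ∀ η : ℝ, 0 < η → η ≤ 2 →
    ∃ δ : ℝ, 0 < δ ∧ ∀ t : ℕ, 2500 ≤ 2 ^ t → ∀ (s : Finset ℕ) (c₀ W : ℕ), W * η ≤ κ →
      s ⊆ Finset.Ico c₀ (c₀ + W) →
      (∀ i ∈ s, ∃ x, i * (η / 2 ^ t) ≤ x ∧ x ≤ (i + 1) * (η / 2 ^ t) ∧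
        ‖rsSum (t + 2) x‖ ≤ δ * Real.sqrt (2 ^ t)) → s.card ≤ D₁ := by
  obtain ⟨κ, D₁, hκ, h⟩ := exists_card_small_cells_le (A := 8) (B := 8) (R := 2500 * Real.pi)
    (c := 1 / 12) (by norm_num) (by norm_num) (by positivity) (by norm_num)
  refine ⟨κ, D₁, hκ, fun η hη hη2 => ?_⟩
  obtain ⟨δ, hδ, h⟩ := h η hη hη2
  refine ⟨δ, hδ, fun t ht s c₀ W hW hs hsx => ?_⟩
  have hL : (0 : ℝ) < 2 ^ t := by positivity
  have hsq : 0 < Real.sqrt (2 ^ t) := Real.sqrt_pos.2 hL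
  set F : ℕ → ℝ → ℂ := fun d => trigSum (fun k => (Complex.I * k) ^ d * rsCoeff (t + 2) k)
    (2 ^ (t + 2)) with hF
  have hF0 : F 0 = rsSum (t + 2) := by
    funext x; simp [hF, rsSum]
  have hFd : ∀ d x, HasDerivAt (F d) (F (d + 1) x) x := by
    intro d x
    have := hasDerivAt_trigSum (fun k => (Complex.I * k) ^ d * rsCoeff (t + 2) k) (2 ^ (t + 2)) x
    refine this.congr_deriv ?_
    simp only [hF]
    congr 1; funext k; ring
  have hFb : ∀ d x, ‖F d x‖ ≤ (8 * 2 ^ t) ^ d * (8 * Real.sqrt (2 ^ t)) := by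
    intro d
    induction d with
    | zero =>
      intro x
      rw [hF0, pow_zero, one_mul]
      refine (norm_rsSum_le _ _).trans (le_of_eq ?_)
      rw [pow_add, Real.sqrt_mul hL.le, show (2 : ℝ) ^ 2 = 2 * 2 by norm_num,
        Real.sqrt_mul_self (by norm_num)]; ring
    | succ d ih =>
      intro x
      have h1 := norm_trigSum_deriv_le ih x
      have h2 : F (d + 1) x = trigSum (fun k => Complex.I * k *
          ((Complex.I * k) ^ d * rsCoeff (t + 2) k)) (2 ^ (t + 2)) x := by
        simp only [hF]; congr 1; funext k; ring
      rw [h2]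
      refine h1.trans (le_of_eq ?_)
      push_cast; ring
  have hF0re : ∀ x, |(F 0 x).re| = ‖rsSum (t + 2) x‖ := by
    intro x
    rw [hF0, rsSum_eq_ofReal, Complex.ofReal_re, Complex.norm_real, Real.norm_eq_abs]
  set f : ℕ → ℝ → ℝ := fun d y => (F d (y / 2 ^ t)).re / ((2 ^ t) ^ d * Real.sqrt (2 ^ t)) with hf
  have hf0 : ∀ y, |f 0 y| = ‖rsSum (t + 2) (y / 2 ^ t)‖ / Real.sqrt (2 ^ t) := by
    intro y
    simp only [hf, pow_zero, one_mul]
    rw [abs_div, hF0re, abs_of_pos hsq]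
  refine h f ?_ ?_ ?_ s c₀ W hW hs ?_
  · intro d y
    have h1 : HasDerivAt (fun y : ℝ => y / 2 ^ t) (1 / 2 ^ t) y := (hasDerivAt_id y).div_const _
    have h2 := (Complex.reCLM.hasFDerivAt.comp_hasDerivAt _ (hFd d (y / 2 ^ t)))
    have h3 := (h2.comp y h1).div_const ((2 ^ t) ^ d * Real.sqrt (2 ^ t))
    refine h3.congr_deriv ?_
    simp only [hf, Complex.reCLM_apply]
    rw [pow_succ]; field_simp
  · intro d y
    simp only [hf]
    rw [abs_div, abs_of_pos (by positivity : 0 < (2 ^ t : ℝ) ^ d * Real.sqrt (2 ^ t)),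
      div_le_iff₀ (by positivity)]
    refine (Complex.abs_re_le_norm _).trans ((hFb d _).trans (le_of_eq ?_))
    rw [mul_pow]; ring
  · intro y₀
    obtain ⟨x, hx1, hx2⟩ := exists_near_rsSum_gt ht (y₀ / 2 ^ t)
    refine ⟨x * 2 ^ t, ?_, ?_⟩
    · have : x * 2 ^ t - y₀ = (x - y₀ / 2 ^ t) * 2 ^ t := by field_simp
      rw [this, abs_mul, abs_of_pos hL]
      exact (le_div_iff₀ hL).1 hx1
    · rw [hf0, mul_div_cancel_right₀ _ hL.ne', lt_div_iff₀ hsq]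
      linarith
  · intro i hi
    obtain ⟨x, hx1, hx2, hx3⟩ := hsx i hi
    refine ⟨x * 2 ^ t, ?_, ?_, ?_⟩
    · rw [mul_div_assoc', div_le_iff₀ hL] at hx1; exact hx1
    · rw [mul_div_assoc', le_div_iff₀ hL] at hx2; exact hx2
    · rw [hf0, mul_div_cancel_right₀ _ hL.ne', div_le_iff₀ hsq]; exact hx3

/-- Near the origin the polynomial `rsSum (2 s + 2)` is large. -/
theorem norm_rsSum_ge_near_zero (s : ℕ) {x : ℝ} (hx0 : 0 ≤ x) (hx : x * 2 ^ (2 * s) ≤ 1 / 64) :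
    (2 : ℝ) ^ s ≤ ‖rsSum (2 * s + 2) x‖ := by
  have h0 : rsSum (2 * s + 2) 0 = ((1 + 2 * 2 ^ (s + 1) : ℝ) : ℂ) := rsSum_zero (s + 1)
  have hsq : Real.sqrt (2 ^ (2 * s + 2)) = 2 * 2 ^ s := by
    rw [show (2 : ℝ) ^ (2 * s + 2) = (2 * 2 ^ s) ^ 2 by ring, Real.sqrt_sq (by positivity)]
  have hb := fun y => norm_trigSum_deriv_le (M := 2 ^ (2 * s + 2))
    (c := fun k => (rsCoeff (2 * s + 2) k : ℂ)) (norm_rsSum_le (2 * s + 2)) y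
  have hd := Convex.norm_image_sub_le_of_norm_hasDerivWithin_le (f := rsSum (2 * s + 2))
      (s := Set.univ) (x := 0) (y := x)
      (fun y _ => (hasDerivAt_trigSum (fun k => (rsCoeff (2 * s + 2) k : ℂ)) (2 ^ (2 * s + 2))
        y).hasDerivWithinAt) (fun y _ => hb y) convex_univ trivial trivial
  rw [hsq, sub_zero, Real.norm_eq_abs, abs_of_nonneg hx0] at hd
  have h1 : ‖rsSum (2 * s + 2) 0‖ = 1 + 4 * 2 ^ s := by
    rw [h0, Complex.norm_real, Real.norm_eq_abs, abs_of_nonneg (by positivity)]; ring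
  have h2 : 2 * ((2 ^ (2 * s + 2) : ℕ) : ℝ) * (4 * (2 * 2 ^ s)) * x ≤ 2 ^ s := by
    have : 2 * ((2 ^ (2 * s + 2) : ℕ) : ℝ) * (4 * (2 * 2 ^ s)) * x =
        (x * 2 ^ (2 * s)) * 64 * 2 ^ s := by push_cast; ring
    rw [this]
    have : (0 : ℝ) < 2 ^ s := by positivity
    nlinarith
  have h3 := norm_sub_norm_le (rsSum (2 * s + 2) 0) (rsSum (2 * s + 2) x)
  rw [norm_sub_rev] at h3
  have : (0 : ℝ) < 2 ^ s := by positivity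
  linarith

/-! ### Sine polynomials with prescribed signs -/

theorem fejer_eq_cos {N : ℕ} (hN : 0 < N) (u : ℝ) : fejer N u =
    1 + 2 * ∑ k ∈ Finset.range N, tent N ((k : ℤ) + 1) * Real.cos ((k + 1) * u) := by
  have h := fejer_eq_sum hN u
  rw [sum_Icc_neg_eq] at h
  have ht : tent N 0 = 1 := by simp [tent]
  have h2 : ∀ k ∈ Finset.range N, (tent N ((k : ℤ) + 1) : ℂ) * expChar ((k : ℤ) + 1) u +
      tent N (-((k : ℤ) + 1)) * expChar (-((k : ℤ) + 1)) u =
      ((2 * (tent N ((k : ℤ) + 1) * Real.cos ((k + 1) * u)) : ℝ) : ℂ) := by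
    intro k _
    rw [tent_neg, ← mul_add, expChar_add_neg]
    push_cast; ring
  rw [Finset.sum_congr rfl h2, ht, expChar_zero, mul_one, ← Complex.ofReal_sum] at h
  rw [Finset.mul_sum]
  exact_mod_cast h

theorem sum_range_four_mul (n : ℕ) (f : ℕ → ℝ) : ∑ j ∈ Finset.range (4 * n), f j =
    ∑ i ∈ Finset.range n, (f i + f (2 * n - 1 - i) + f (2 * n + i) + f (4 * n - 1 - i)) := by
  have h4 : 4 * n = n + n + n + n := by ring
  rw [h4, Finset.sum_range_add, Finset.sum_range_add, Finset.sum_range_add,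
    ← Finset.sum_range_reflect (fun x => f (n + x)),
    ← Finset.sum_range_reflect (fun x => f (n + n + n + x)),
    ← Finset.sum_add_distrib, ← Finset.sum_add_distrib, ← Finset.sum_add_distrib]
  refine Finset.sum_congr rfl fun i hi => ?_
  have := Finset.mem_range.1 hi
  congr 1
  · congr 1
    · congr 2; omega
    · congr 1; omega
  · congr 1; omega

/-- The extension of a function on the first quarter of a grid of `4 n` points, offset
by half a step from the axes, to a function on the whole grid which is odd and symmetric about `π / 2`. -/
def quarterExt (n : ℕ) (σ : ℕ → ℝ) (j : ℕ) : ℝ :=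
  if j < n then σ j else if j < 2 * n then σ (2 * n - 1 - j)
  else if j < 3 * n then -σ (j - 2 * n) else -σ (4 * n - 1 - j)

theorem abs_quarterExt_le {n : ℕ} {σ : ℕ → ℝ} (hσ : ∀ j, |σ j| ≤ 1) (j : ℕ) :
    |quarterExt n σ j| ≤ 1 := by
  unfold quarterExt
  split_ifs
  · exact hσ _
  · exact hσ _
  · rw [abs_neg]; exact hσ _
  · rw [abs_neg]; exact hσ _

/-- The coefficients of the Fejér mean of an odd function on a grid which is symmetric about
`π / 2`; only odd frequencies occur. -/
noncomputable def sineCoeff (n : ℕ) (σ : ℕ → ℝ) (k : ℕ) : ℝ :=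
  if Even k then 0 else 2 / n * tent n k *
    ∑ i ∈ Finset.range n, σ i * Real.sin (k * gridPt (4 * n) (Real.pi / (4 * n)) i)

/-- The sine polynomial of degree at most `n` with coefficients `x`. -/
noncomputable def sineSum (n : ℕ) (x : ℕ → ℝ) (θ : ℝ) : ℝ :=
  ∑ k ∈ Finset.range n, x (k + 1) * Real.sin ((k + 1) * θ)

/-- The sine polynomial with coefficients `sineCoeff n σ` is the Fejér mean of the odd extension of
`σ` to the grid of `4 n` points, so that it nearly reproduces the values of `σ`. -/
theorem sineSum_sineCoeff {n : ℕ} (hn : 0 < n) (σ : ℕ → ℝ) (θ : ℝ) :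
    4 * n * sineSum n (sineCoeff n σ) θ = ∑ j ∈ Finset.range (4 * n), quarterExt n σ j *
      fejer n (θ - gridPt (4 * n) (Real.pi / (4 * n)) j) := by
  have hn' : (n : ℝ) ≠ 0 := by exact_mod_cast hn.ne'
  set X : ℕ → ℝ := gridPt (4 * n) (Real.pi / (4 * n)) with hX
  have hx1 : ∀ i ∈ Finset.range n, X (2 * n - 1 - i) = Real.pi - X i := by
    intro i hi
    have := Finset.mem_range.1 hi
    have e : ((2 * n - 1 - i : ℕ) : ℝ) = 2 * n - 1 - i := by
      rw [Nat.cast_sub (by omega), Nat.cast_sub (by omega)]; push_cast; ring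
    simp only [hX, gridPt]; rw [e]; push_cast; field_simp; ring
  have hx2 : ∀ i ∈ Finset.range n, X (2 * n + i) = Real.pi + X i := by
    intro i hi
    simp only [hX, gridPt]; push_cast; field_simp; ring
  have hx3 : ∀ i ∈ Finset.range n, X (4 * n - 1 - i) = 2 * Real.pi - X i := by
    intro i hi
    have := Finset.mem_range.1 hi
    have e : ((4 * n - 1 - i : ℕ) : ℝ) = 4 * n - 1 - i := by
      rw [Nat.cast_sub (by omega), Nat.cast_sub (by omega)]; push_cast; ring
    simp only [hX, gridPt]; rw [e]; push_cast; field_simp; ring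
  rw [sum_range_four_mul]
  have hterm : ∀ i ∈ Finset.range n, quarterExt n σ i * fejer n (θ - X i) +
      quarterExt n σ (2 * n - 1 - i) * fejer n (θ - X (2 * n - 1 - i)) +
      quarterExt n σ (2 * n + i) * fejer n (θ - X (2 * n + i)) +
      quarterExt n σ (4 * n - 1 - i) * fejer n (θ - X (4 * n - 1 - i)) =
      ∑ k ∈ Finset.range n, (if Even (k + 1) then 0 else 8 * tent n ((k : ℤ) + 1) *
        (σ i * Real.sin ((k + 1) * X i)) * Real.sin ((k + 1) * θ)) := by
    intro i hi
    have hin := Finset.mem_range.1 hi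
    have q0 : quarterExt n σ i = σ i := if_pos hin
    have q1 : quarterExt n σ (2 * n - 1 - i) = σ i := by
      unfold quarterExt
      rw [if_neg (by omega), if_pos (by omega)]; congr 1; omega
    have q2 : quarterExt n σ (2 * n + i) = -σ i := by
      unfold quarterExt
      rw [if_neg (by omega), if_neg (by omega), if_pos (by omega)]; congr 2; omega
    have q3 : quarterExt n σ (4 * n - 1 - i) = -σ i := by
      unfold quarterExt
      rw [if_neg (by omega), if_neg (by omega), if_neg (by omega)]; congr 2; omega
    rw [q0, q1, q2, q3, hx1 i hi, hx2 i hi, hx3 i hi, fejer_eq_cos hn, fejer_eq_cos hn,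
      fejer_eq_cos hn, fejer_eq_cos hn]
    have : ∀ k ∈ Finset.range n, (if Even (k + 1) then 0 else 8 * tent n ((k : ℤ) + 1) *
        (σ i * Real.sin ((k + 1) * X i)) * Real.sin ((k + 1) * θ)) =
        2 * σ i * (tent n ((k : ℤ) + 1) * Real.cos ((k + 1) * (θ - X i)) +
          tent n ((k : ℤ) + 1) * Real.cos ((k + 1) * (θ - (Real.pi - X i))) -
          tent n ((k : ℤ) + 1) * Real.cos ((k + 1) * (θ - (Real.pi + X i))) -
          tent n ((k : ℤ) + 1) * Real.cos ((k + 1) * (θ - (2 * Real.pi - X i)))) := by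
      intro k _
      have e1 : ((k : ℝ) + 1) * (θ - X i) = (k + 1) * θ - (k + 1) * X i := by ring
      have e2 : ((k : ℝ) + 1) * (θ - (Real.pi - X i)) =
          ((k + 1) * θ + (k + 1) * X i) - ((k + 1 : ℕ) : ℤ) * Real.pi := by push_cast; ring
      have e3 : ((k : ℝ) + 1) * (θ - (Real.pi + X i)) =
          ((k + 1) * θ - (k + 1) * X i) - ((k + 1 : ℕ) : ℤ) * Real.pi := by push_cast; ring
      have e4 : ((k : ℝ) + 1) * (θ - (2 * Real.pi - X i)) =
          ((k + 1) * θ + (k + 1) * X i) - ((k + 1 : ℕ) : ℤ) * (2 * Real.pi) := by push_cast; ring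
      rw [e1, e2, e3, e4, Real.cos_sub_int_mul_pi, Real.cos_sub_int_mul_pi,
        Real.cos_sub_int_mul_two_pi, Real.cos_add, Real.cos_sub, zpow_natCast]
      split_ifs with he
      · rw [he.neg_one_pow]; ring
      · rw [(Nat.not_even_iff_odd.1 he).neg_one_pow]; ring
    rw [Finset.sum_congr rfl this, ← Finset.mul_sum, Finset.sum_sub_distrib,
      Finset.sum_sub_distrib, Finset.sum_add_distrib]
    ring
  rw [Finset.sum_congr rfl hterm, Finset.sum_comm, sineSum, Finset.mul_sum]
  refine Finset.sum_congr rfl fun k _ => ?_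
  unfold sineCoeff
  split_ifs with he
  · simp
  · rw [← Finset.sum_mul, ← Finset.mul_sum]
    push_cast
    field_simp
    ring

theorem abs_sineSum_sineCoeff_le {n : ℕ} (hn : 0 < n) {σ : ℕ → ℝ} (hσ : ∀ j, |σ j| ≤ 1) (θ : ℝ) :
    |sineSum n (sineCoeff n σ) θ| ≤ 1 := by
  have hn' : (0 : ℝ) < 4 * n := by positivity
  refine le_of_mul_le_mul_left ?_ hn'
  calc 4 * n * |sineSum n (sineCoeff n σ) θ| = |4 * n * sineSum n (sineCoeff n σ) θ| := by
        rw [abs_mul, abs_of_pos hn']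
    _ ≤ ∑ j ∈ Finset.range (4 * n), 1 * fejer n (θ - gridPt (4 * n) (Real.pi / (4 * n)) j) := by
        rw [sineSum_sineCoeff hn]
        refine (Finset.abs_sum_le_sum_abs _ _).trans (Finset.sum_le_sum fun j _ => ?_)
        rw [abs_mul, abs_of_nonneg (fejer_nonneg _ _)]
        exact mul_le_mul_of_nonneg_right (abs_quarterExt_le hσ j) (fejer_nonneg _ _)
    _ = 4 * n * 1 := by
        simp_rw [one_mul]
        rw [sum_fejer_gridPt hn (by omega)]; push_cast; ring

/-- Grid points at which the Fejér kernel centred in the cell `c` of the first quadrant is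
concentrated lie, up to reflection, in the cells adjacent to `c`. -/
theorem quarterExt_eq_of_near {b C c : ℕ} (hb : 0 < b) (hc1 : 1 ≤ c) (hcC : c < C)
    {τ : ℕ → ℝ} {α : ℝ} (hτ : ∀ c' < C, c' ≤ c + 1 → c ≤ c' + 1 → τ c' = α) {θ : ℝ}
    (hθ1 : c * (Real.pi / (2 * C)) ≤ θ) (hθ2 : θ ≤ (c + 1) * (Real.pi / (2 * C))) {j : ℕ}
    (hj : j < 4 * (b * C))
    (hsin : |Real.sin ((θ - gridPt (4 * (b * C)) (Real.pi / (4 * (b * C : ℕ))) j) / 2)| <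
      1 / (2 * C)) :
    quarterExt (b * C) (fun i => τ (i / b)) j = α := by
  have hpi := Real.pi_pos
  have hb' : (0 : ℝ) < b := by exact_mod_cast hb
  have hC' : (0 : ℝ) < C := by exact_mod_cast (by omega : 0 < C)
  set h : ℝ := Real.pi / (2 * C) with hh
  have hh0 : 0 < h := by positivity
  set X := gridPt (4 * (b * C)) (Real.pi / (4 * (b * C : ℕ))) j with hX
  have hXj : X = (2 * j + 1) * h / (2 * b) := by
    rw [hX, hh, gridPt]; push_cast; field_simp; ring
  have hX0 : 0 < X := by rw [hXj]; positivity
  have hCh : C * h = Real.pi / 2 := by rw [hh]; field_simp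
  have hX1 : X < 2 * Real.pi := by
    have : (2 * (j : ℝ) + 1) < 2 * (4 * (b * C)) := by exact_mod_cast (by omega)
    rw [hXj, div_lt_iff₀ (by positivity)]
    calc (2 * (j : ℝ) + 1) * h < 2 * (4 * (b * C)) * h := by gcongr
      _ = 2 * Real.pi * (2 * b) := by
        have : 2 * (4 * (b * C)) * h = 8 * b * (C * h) := by ring
        rw [this, hCh]; ring
  have hc1' : (1 : ℝ) ≤ c := by exact_mod_cast hc1
  have hcC' : (c : ℝ) + 1 ≤ C := by exact_mod_cast hcC
  have hθ0 : h ≤ θ := by nlinarith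
  have hθ3 : θ ≤ Real.pi / 2 := by
    rw [← hCh]; exact hθ2.trans (by gcongr)
  have hs : 1 / (2 * C : ℝ) = h / Real.pi := by rw [hh]; field_simp
  rw [hs] at hsin
  have hnear : |θ - X| < h := by
    by_cases hu : |θ - X| ≤ Real.pi
    · have h1 : |(θ - X) / 2| ≤ Real.pi / 2 := by rw [abs_div, abs_two]; linarith
      have h2 := lt_of_le_of_lt (Real.mul_abs_le_abs_sin h1) hsin
      rw [abs_div, abs_two, div_mul_div_comm, mul_comm, mul_div_mul_right _ _ two_ne_zero,
        div_lt_div_iff_of_pos_right hpi] at h2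
      exact h2
    · exfalso
      have hlt : θ - X < 0 := by
        by_contra hcon
        rw [abs_of_nonneg (by linarith)] at hu
        linarith
      rw [abs_of_neg hlt] at hu
      set d := (θ - X) / 2 + Real.pi with hd
      have hd1 : |d| ≤ Real.pi / 2 := by
        rw [hd, abs_le]; constructor <;> linarith
      have h2 := Real.mul_abs_le_abs_sin hd1
      rw [hd, Real.sin_add_pi, abs_neg] at h2
      have h3 := lt_of_le_of_lt h2 hsin
      rw [div_mul_eq_mul_div, div_lt_div_iff_of_pos_right hpi] at h3
      have := (abs_lt.1 (by linarith [abs_nonneg ((θ - X) / 2 + Real.pi)] :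
        |(θ - X) / 2 + Real.pi| < h / 2)).2
      linarith
  rw [abs_lt] at hnear
  have hlow : (c - 1) * b < j + 1 := by
    have h1 : ((c : ℝ) - 1) * h < X := by linarith
    rw [hXj, lt_div_iff₀ (by positivity)] at h1
    have h2 : ((c : ℝ) - 1) * (2 * b) < 2 * j + 1 := by
      refine lt_of_mul_lt_mul_right ?_ hh0.le
      linarith
    have h3 : (((c - 1 : ℕ) : ℝ)) = c - 1 := by rw [Nat.cast_sub hc1]; simp
    rw [← h3] at h2
    have h4 : (c - 1) * (2 * b) < 2 * j + 1 := by exact_mod_cast h2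
    have : (c - 1) * (2 * b) = 2 * ((c - 1) * b) := by ring
    omega
  have hupp : j < (c + 2) * b := by
    have h1 : X < ((c : ℝ) + 2) * h := by linarith
    rw [hXj, div_lt_iff₀ (by positivity)] at h1
    have h2 : 2 * (j : ℝ) + 1 < ((c : ℝ) + 2) * (2 * b) := by
      refine lt_of_mul_lt_mul_right ?_ hh0.le
      linarith
    have h4 : 2 * j + 1 < (c + 2) * (2 * b) := by exact_mod_cast h2
    have : (c + 2) * (2 * b) = 2 * ((c + 2) * b) := by ring
    omega
  unfold quarterExt
  split_ifs with hj1 hj2 hj3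
  · have e1 : j / b < C := Nat.div_lt_of_lt_mul hj1
    have e2 : j / b < c + 2 := by rw [Nat.div_lt_iff_lt_mul hb]; exact hupp
    have e3 : c - 1 ≤ j / b := by rw [Nat.le_div_iff_mul_le hb]; omega
    exact hτ _ e1 (by omega) (by omega)
  -- a grid point in the second quadrant is close to `θ` only across `π / 2`, from the last cell
  · have hc : c = C - 1 := by
      by_contra hne
      have : (c + 2) * b ≤ C * b := Nat.mul_le_mul_right b (by omega)
      rw [mul_comm C b] at this
      omega
    have e0 : (C - 1) * b + b = b * C := by
      rw [← Nat.succ_mul, mul_comm]; congr 1; omega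
    have e5 : (c + 2) * b = b * C + b := by
      rw [hc, show C - 1 + 2 = C + 1 by omega]; ring
    have e3 : C - 1 ≤ (2 * (b * C) - 1 - j) / b := by
      rw [Nat.le_div_iff_mul_le hb]; omega
    have e1 : (2 * (b * C) - 1 - j) / b < C := Nat.div_lt_of_lt_mul (by omega)
    exact hτ _ e1 (by omega) (by omega)
  all_goals
    exfalso
    have : (c + 2) * b ≤ (C + 1) * b := Nat.mul_le_mul_right b (by omega)
    have e : (C + 1) * b ≤ 2 * (b * C) := by
      have : (C + 1) * b ≤ (2 * C) * b := Nat.mul_le_mul_right b (by omega)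
      calc _ ≤ _ := this
        _ = _ := by ring
    omega

/-- On a cell whose neighbours carry the same sign `α`, the Fejér mean is at least `1 / 2` in
absolute value. -/
theorem half_le_abs_sineSum {b C c : ℕ} (hb : 96 ≤ b) (hc1 : 1 ≤ c) (hcC : c < C)
    {τ : ℕ → ℝ} (hτ1 : ∀ c, |τ c| ≤ 1) {α : ℝ} (hα : |α| = 1)
    (hτ : ∀ c' < C, c' ≤ c + 1 → c ≤ c' + 1 → τ c' = α) {θ : ℝ}
    (hθ1 : c * (Real.pi / (2 * C)) ≤ θ) (hθ2 : θ ≤ (c + 1) * (Real.pi / (2 * C))) :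
    1 / 2 ≤ |sineSum (b * C) (sineCoeff (b * C) fun i => τ (i / b)) θ| := by
  have hC0 : 0 < C := by omega
  have hn : 0 < b * C := Nat.mul_pos (by omega) hC0
  have hC' : (1 : ℝ) ≤ C := by exact_mod_cast hC0
  have hb' : (96 : ℝ) ≤ b := by exact_mod_cast hb
  have hn' : (0 : ℝ) < 4 * (b * C : ℕ) := by exact_mod_cast (by omega : 0 < 4 * (b * C))
  set n := b * C with hnd
  set S := sineSum n (sineCoeff n fun i => τ (i / b)) θ with hS
  have hid : 4 * (n : ℝ) * (S - α) = ∑ j ∈ Finset.range (4 * n),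
      (quarterExt n (fun i => τ (i / b)) j - α) *
        fejer n (θ - gridPt (4 * n) (Real.pi / (4 * n)) j) := by
    simp_rw [sub_mul]
    rw [Finset.sum_sub_distrib, ← sineSum_sineCoeff hn, ← Finset.mul_sum,
      sum_fejer_gridPt hn (by omega)]
    push_cast; ring
  have hle : 4 * (n : ℝ) * |S - α| ≤ 2 * ((4 * n : ℕ) * (12 / (1 / (2 * C) * n))) := by
    calc 4 * (n : ℝ) * |S - α| = |4 * (n : ℝ) * (S - α)| := by rw [abs_mul, abs_of_pos hn']
      _ ≤ ∑ j ∈ Finset.range (4 * n),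
          if 1 / (2 * C : ℝ) ≤ |Real.sin ((θ - gridPt (4 * n) (Real.pi / (4 * n)) j) / 2)| then
            2 * fejer n (θ - gridPt (4 * n) (Real.pi / (4 * n)) j) else 0 := by
          rw [hid]
          refine (Finset.abs_sum_le_sum_abs _ _).trans (Finset.sum_le_sum fun j hj => ?_)
          have hf := fejer_nonneg n (θ - gridPt (4 * n) (Real.pi / (4 * n)) j)
          rw [abs_mul, abs_of_nonneg hf]
          split_ifs with h
          · gcongr
            refine (abs_sub _ _).trans ?_
            have := abs_quarterExt_le (n := n) (σ := fun i => τ (i / b)) (fun i => hτ1 _) j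
            linarith
          · have := quarterExt_eq_of_near (b := b) (by omega) hc1 hcC hτ hθ1 hθ2
              (Finset.mem_range.1 hj) (not_le.1 h)
            rw [hnd, this]; simp
      _ = 2 * ∑ j ∈ (Finset.range (4 * n)).filter (fun j => 1 / (2 * C : ℝ) ≤
            |Real.sin ((θ - gridPt (4 * n) (Real.pi / (4 * n)) j) / 2)|),
            fejer n (θ - gridPt (4 * n) (Real.pi / (4 * n)) j) := by
          rw [← Finset.sum_filter, Finset.mul_sum]
      _ ≤ _ := by
          gcongr
          refine fejer_tail hn _ θ (by positivity) ?_ ?_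
          · rw [div_le_one (by positivity)]; linarith
          · rw [hnd]; push_cast
            have : 4 * ((b : ℝ) * C) * (1 / (2 * C)) = 2 * b := by field_simp; norm_num
            rw [this]; linarith
  have hval : 2 * (((4 * n : ℕ) : ℝ) * (12 / (1 / (2 * C) * n))) = 4 * (n : ℝ) * (48 / b) := by
    rw [hnd]; push_cast
    have : (b : ℝ) ≠ 0 := by positivity
    field_simp; norm_num
  rw [hval] at hle
  have h1 : |S - α| ≤ 48 / b := le_of_mul_le_mul_left hle hn'
  have h2 : (48 : ℝ) / b ≤ 1 / 2 := by
    rw [div_le_div_iff₀ (by linarith) (by norm_num)]; linarith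
  have h3 := abs_sub_abs_le_abs_sub α S
  rw [abs_sub_comm, hα] at h3
  linarith

theorem card_le_three_mul_of_adjacent {E B : Finset ℕ}
    (h : ∀ c ∈ E, ∃ x ∈ B, x ≤ c + 1 ∧ c ≤ x + 1) : E.card ≤ 3 * B.card := by
  have hsub : E ⊆ B.biUnion fun x => Finset.Icc (x - 1) (x + 1) := by
    intro c hc
    obtain ⟨x, hx, h1, h2⟩ := h c hc
    exact Finset.mem_biUnion.2 ⟨x, hx, Finset.mem_Icc.2 ⟨by omega, h2⟩⟩
  refine (Finset.card_le_card hsub).trans ?_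
  rw [mul_comm]
  refine Finset.card_biUnion_le_card_mul _ _ _ fun x _ => ?_
  rw [Nat.card_Icc]; omega

/-- Signs on the cells near a sparse set `B` of cells. Cells adjacent to `B` form short runs; the
sign is constant on every run, and the signs of the runs are chosen by the discrepancy theorem. -/
theorem exists_cell_signs {B : Finset ℕ} {C D b : ℕ} (hb : 0 < b) (h0 : 0 ∉ B) (h1 : 1 ∉ B)
    (hD : ∀ c₀, (B ∩ Finset.Ico c₀ (c₀ + (3 * D + 3))).card ≤ D)
    (g : Fin (b * C) → ℕ → ℝ) (hg : ∀ k i, |g k i| ≤ 1) :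
    ∃ τ : ℕ → ℝ, (∀ c, |τ c| ≤ 1) ∧
      (∀ c ∈ B, ∃ α : ℝ, |α| = 1 ∧ ∀ c', c' ≤ c + 1 → c ≤ c' + 1 → τ c' = α) ∧
      ∀ k, |∑ i ∈ Finset.range (b * C), τ (i / b) * g k i| ≤
        3 * D * b * (10000 * (3 * B.card : ℝ) ^ (1 / 8 : ℝ) * (b * C : ℝ) ^ (3 / 8 : ℝ)) := by
  classical
  -- `ext c` says that `c` is adjacent to `B`; a run of such cells is labelled by the last cell before
  -- it, and its length is at most `3 D`, since a longer run would need more than `D` cells of `B`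
  set ext : ℕ → Prop := fun c => ∃ x ∈ B, x ≤ c + 1 ∧ c ≤ x + 1 with hext
  have hext0 : ¬ ext 0 := by
    rintro ⟨x, hx, hx1, -⟩
    interval_cases x
    · exact h0 hx
    · exact h1 hx
  set start : ℕ → ℕ := Nat.findGreatest (fun c => ¬ ext c) with hstart
  have hrun : ∀ c, ext c → start c < c ∧ c ≤ start c + 3 * D := by
    intro c hc
    have hs : ¬ ext (start c) := Nat.findGreatest_spec (P := fun c => ¬ ext c) (Nat.zero_le c) hext0
    have hle : start c ≤ c := Nat.findGreatest_le c
    refine ⟨lt_of_le_of_ne hle fun h => hs (h.symm ▸ hc), ?_⟩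
    by_contra! hlt
    have hall : ∀ x ∈ Finset.Icc (start c + 1) (start c + 3 * D + 1),
        ∃ y ∈ B ∩ Finset.Ico (start c) (start c + (3 * D + 3)), y ≤ x + 1 ∧ x ≤ y + 1 := by
      intro x hx
      rw [Finset.mem_Icc] at hx
      have hx' : ext x := by
        by_contra hcon
        exact Nat.findGreatest_is_greatest (P := fun c => ¬ ext c) (show start c < x by omega)
          (show x ≤ c by omega) hcon
      obtain ⟨y, hy, hy1, hy2⟩ := hx'
      exact ⟨y, Finset.mem_inter.2 ⟨hy, Finset.mem_Ico.2 ⟨by omega, by omega⟩⟩, hy1, hy2⟩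
    have := card_le_three_mul_of_adjacent hall
    have h2 := hD (start c)
    rw [Nat.card_Icc] at this
    omega
  set E := (Finset.range C).filter ext with hE
  set V := E.image start with hV
  have hVB : V.card ≤ 3 * B.card := Finset.card_image_le.trans
    (card_le_three_mul_of_adjacent fun c hc => (Finset.mem_filter.1 hc).2)
  have hVn : V.card ≤ b * C := by
    refine Finset.card_image_le.trans ((Finset.card_filter_le _ _).trans ?_)
    rw [Finset.card_range]
    exact Nat.le_mul_of_pos_left C hb
  set I : ℕ → Finset ℕ := fun v => (Finset.range (b * C)).filter
    (fun i => ext (i / b) ∧ start (i / b) = v) with hI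
  have hIcard : ∀ v, (I v).card ≤ 3 * D * b := by
    intro v
    have hsub : I v ⊆ Finset.Ico ((v + 1) * b) ((v + 1) * b + 3 * D * b) := by
      intro i hi
      obtain ⟨-, hi1, hi2⟩ := Finset.mem_filter.1 hi
      obtain ⟨r1, r2⟩ := hrun _ hi1
      rw [hi2] at r1 r2
      have e1 : (v + 1) * b ≤ i := (Nat.le_div_iff_mul_le hb).1 r1
      have e2 : i < (v + 3 * D + 1) * b := (Nat.div_lt_iff_lt_mul hb).1 (by omega)
      rw [Finset.mem_Ico]
      refine ⟨e1, lt_of_lt_of_eq e2 (by ring)⟩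
    refine (Finset.card_le_card hsub).trans ?_
    rw [Nat.card_Ico]; omega
  have ha : ∀ (k : Fin (b * C)) (v : ℕ), |(∑ i ∈ I v, g k i) / (3 * D * b)| ≤ 1 := by
    intro k v
    rw [abs_div, abs_of_nonneg (by positivity : (0 : ℝ) ≤ 3 * D * b)]
    refine div_le_one_of_le₀ ?_ (by positivity)
    calc |∑ i ∈ I v, g k i| ≤ ∑ i ∈ I v, (1 : ℝ) :=
          (Finset.abs_sum_le_sum_abs _ _).trans (Finset.sum_le_sum fun i _ => hg k i)
      _ = (I v).card := by simp
      _ ≤ 3 * D * b := by exact_mod_cast hIcard v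
  obtain ⟨ε, hε, hεd⟩ := exists_signs_approx (κ := Fin (b * C)) V ha
    (by rw [Fintype.card_fin]; exact hVn) (fun _ => 0) (by simp)
  have hε1 : ∀ v, |ε v| = 1 := by
    intro v
    rcases hε v with h | h <;> rw [h] <;> simp
  refine ⟨fun c => if ext c then ε (start c) else 0, fun c => ?_, fun c hc => ?_, fun k => ?_⟩
  · by_cases hc : ext c
    · simp only [hc, if_true]; exact (hε1 _).le
    · simp [hc]
  · refine ⟨ε (start c), hε1 _, fun c' h1 h2 => ?_⟩
    have hext' : ∀ c', c' ≤ c + 1 → c ≤ c' + 1 → ext c' := fun c' h1 h2 => ⟨c, hc, h2, h1⟩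
    have hstep : ∀ d, ext (d + 1) → start (d + 1) = start d := fun d hd =>
      Nat.findGreatest_of_not (not_not.2 hd)
    refine (if_pos (hext' c' h1 h2)).trans (congrArg ε ?_)
    have : c' = c + 1 ∨ c' = c ∨ c = c' + 1 := by omega
    rcases this with h | h | h
    · rw [h]; exact hstep c (hext' _ le_rfl (by omega))
    · rw [h]
    · rw [h]; exact (hstep c' (h ▸ hext' c (by omega) (by omega))).symm
  · have hsum : ∑ i ∈ Finset.range (b * C), (if ext (i / b) then ε (start (i / b)) else 0) * g k i =
        3 * D * b * ∑ v ∈ V, (∑ i ∈ I v, g k i) / (3 * D * b) * (ε v - 0) := by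
      have hmap : ∀ i ∈ (Finset.range (b * C)).filter (fun i => ext (i / b)), start (i / b) ∈ V := by
        intro i hi
        obtain ⟨hi1, hi2⟩ := Finset.mem_filter.1 hi
        refine Finset.mem_image_of_mem _ (Finset.mem_filter.2 ⟨Finset.mem_range.2 ?_, hi2⟩)
        exact Nat.div_lt_of_lt_mul (Finset.mem_range.1 hi1)
      simp_rw [ite_mul, zero_mul]
      rw [← Finset.sum_filter, ← Finset.sum_fiberwise_of_maps_to hmap, Finset.mul_sum]
      refine Finset.sum_congr rfl fun v hv => ?_
      rw [Finset.filter_filter, sub_zero]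
      obtain ⟨c, hc, rfl⟩ := Finset.mem_image.1 hv
      have hr := hrun c (Finset.mem_filter.1 hc).2
      have hD0 : (D : ℝ) ≠ 0 := by
        have : D ≠ 0 := by rintro rfl; omega
        exact_mod_cast this
      have hb0 : (b : ℝ) ≠ 0 := by exact_mod_cast hb.ne'
      have : ∑ i ∈ (Finset.range (b * C)).filter (fun i => ext (i / b) ∧ start (i / b) = start c),
          ε (start (i / b)) * g k i = (∑ i ∈ I (start c), g k i) * ε (start c) := by
        rw [Finset.sum_mul]
        refine Finset.sum_congr rfl fun i hi => ?_
        rw [(Finset.mem_filter.1 hi).2.2]; ring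
      rw [this]
      field_simp
    rw [hsum, abs_mul, abs_of_nonneg (by positivity)]
    refine mul_le_mul_of_nonneg_left ((hεd k).trans ?_) (by positivity)
    rw [Fintype.card_fin]
    have hVB' : (V.card : ℝ) ≤ 3 * B.card := by exact_mod_cast hVB
    push_cast
    gcongr

theorem card_le_of_windows {B : Finset ℕ} {C D W : ℕ} (hW : 0 < W) (hBC : B ⊆ Finset.range C)
    (hD : ∀ c₀, (B ∩ Finset.Ico c₀ (c₀ + W)).card ≤ D) : B.card ≤ D * (C / W + 1) := by
  have h1 := Finset.card_le_mul_card_image (f := fun c => c / W) B D (by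
    intro w _
    refine (Finset.card_le_card ?_).trans (hD (w * W))
    intro c hc
    obtain ⟨hc1, hc2⟩ := Finset.mem_filter.1 hc
    refine Finset.mem_inter.2 ⟨hc1, Finset.mem_Ico.2 ?_⟩
    have e1 := Nat.div_add_mod c W
    have e2 := Nat.mod_lt c hW
    rw [hc2, mul_comm] at e1
    omega)
  refine h1.trans (Nat.mul_le_mul_left D ?_)
  refine (Finset.card_le_card (t := Finset.range (C / W + 1)) ?_).trans (Finset.card_range _).le
  intro w hw
  obtain ⟨c, hc, rfl⟩ := Finset.mem_image.1 hw
  have := Finset.mem_range.1 (hBC hc)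
  rw [Finset.mem_range, Nat.lt_succ_iff]
  exact Nat.div_le_div_right this.le

/-- Every angle is, up to sign and a multiple of `π`, in the first quadrant. -/
theorem exists_fold (θ : ℝ) : ∃ θ' : ℝ, 0 ≤ θ' ∧ θ' ≤ Real.pi / 2 ∧ ∃ n : ℤ,
    θ = θ' + n * Real.pi ∨ θ = -θ' + n * Real.pi := by
  have hpi := Real.pi_pos
  have h := abs_sub_round (θ / Real.pi)
  have e : |θ - round (θ / Real.pi) * Real.pi| ≤ Real.pi / 2 := by
    have : θ - round (θ / Real.pi) * Real.pi = (θ / Real.pi - round (θ / Real.pi)) * Real.pi := by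
      field_simp
    rw [this, abs_mul, abs_of_pos hpi]
    nlinarith
  refine ⟨|θ - round (θ / Real.pi) * Real.pi|, abs_nonneg _, e, round (θ / Real.pi), ?_⟩
  rcases abs_choice (θ - round (θ / Real.pi) * Real.pi) with h | h <;> rw [h]
  · left; ring
  · right; ring

/-- A sine polynomial with odd frequencies is symmetric about `π / 2`, hence determined by its values
on the first quadrant. -/
theorem abs_sineSum_fold {n : ℕ} {x : ℕ → ℝ} (hx : ∀ k, Even k → x k = 0) {θ θ' : ℝ} {m : ℤ}
    (h : θ = θ' + m * Real.pi ∨ θ = -θ' + m * Real.pi) : |sineSum n x θ| = |sineSum n x θ'| := by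
  have hper : ∀ y, sineSum n x (y + m * Real.pi) = (-1) ^ m * sineSum n x y := by
    intro y
    rw [sineSum, sineSum, Finset.mul_sum]
    refine Finset.sum_congr rfl fun k _ => ?_
    rcases Nat.even_or_odd (k + 1) with he | ho
    · rw [hx _ he]; simp
    · have e : ((k : ℝ) + 1) * (y + m * Real.pi) = (k + 1) * y + (((k + 1 : ℕ) : ℤ) * m : ℤ) * Real.pi := by
        push_cast; ring
      rw [e, Real.sin_add_int_mul_pi, zpow_mul, zpow_natCast, ho.neg_one_pow]; ring
  have hneg : sineSum n x (-θ') = -sineSum n x θ' := by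
    rw [sineSum, sineSum, ← Finset.sum_neg_distrib]
    refine Finset.sum_congr rfl fun k _ => ?_
    rw [mul_neg, Real.sin_neg]; ring
  rcases h with rfl | rfl
  · rw [hper, abs_mul, abs_zpow, abs_neg, abs_one, one_zpow, one_mul]
  · rw [hper, abs_mul, abs_zpow, abs_neg, abs_one, one_zpow, one_mul, hneg, abs_neg]

theorem rsSum_fold (t : ℕ) {θ θ' : ℝ} {m : ℤ}
    (h : θ = θ' + m * Real.pi ∨ θ = -θ' + m * Real.pi) : rsSum t (2 * θ) = rsSum t (2 * θ') := by
  have hper : ∀ y, rsSum t (2 * (y + m * Real.pi)) = rsSum t (2 * y) := by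
    intro y
    rw [rsSum_eq_ofReal, rsSum_eq_ofReal]
    congr 3
    refine Finset.sum_congr rfl fun k _ => ?_
    have e : ((k : ℝ) + 1) * (2 * (y + m * Real.pi)) =
        (k + 1) * (2 * y) + (((k + 1 : ℕ) : ℤ) * m : ℤ) * (2 * Real.pi) := by push_cast; ring
    rw [e, Real.cos_add_int_mul_two_pi]
  rcases h with rfl | rfl
  · exact hper _
  · rw [hper, rsSum_eq_ofReal, rsSum_eq_ofReal]
    congr 3
    refine Finset.sum_congr rfl fun k _ => ?_
    rw [mul_neg, mul_neg, Real.cos_neg]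

theorem exists_cell {C : ℕ} (hC : 0 < C) {θ : ℝ} (h0 : 0 ≤ θ) (h1 : θ ≤ Real.pi / 2) :
    ∃ c < C, c * (Real.pi / (2 * C)) ≤ θ ∧ θ ≤ (c + 1) * (Real.pi / (2 * C)) := by
  have hC' : (0 : ℝ) < C := by exact_mod_cast hC
  have hh : 0 < Real.pi / (2 * C) := by positivity
  have hCh : C * (Real.pi / (2 * C)) = Real.pi / 2 := by field_simp
  rcases h1.lt_or_eq with h | h
  · refine ⟨⌊θ / (Real.pi / (2 * C))⌋₊, ?_, ?_, ?_⟩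
    · rw [Nat.floor_lt (by positivity), div_lt_iff₀ hh, hCh]; exact h
    · rw [← le_div_iff₀ hh]; exact Nat.floor_le (by positivity)
    · rw [← div_le_iff₀ hh]; exact (Nat.lt_floor_add_one _).le
  · refine ⟨C - 1, by omega, ?_, ?_⟩
    · rw [h, ← hCh, Nat.cast_sub hC]
      gcongr; simp
    · rw [h, ← hCh, Nat.cast_sub hC]
      gcongr; simp

/-- The size of the coefficients produced by the choice of signs: all powers of `n` cancel except
for `(β / n) ^ (1 / 8)`, where `β` is the number of cells in the sparse set. -/
theorem coefficient_bound_le_one {n β Λ D : ℝ} (hn : 0 < n) (hΛ : 0 ≤ Λ) (hD : 0 ≤ D) (hβ : 0 ≤ β)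
    (h : (96 * 60000 * D * Λ) ^ 8 * (3 * β) ≤ n) :
    Λ * Real.sqrt n * (2 / n * 1 * (3 * D * 96 *
      (10000 * (3 * β) ^ (1 / 8 : ℝ) * n ^ (3 / 8 : ℝ)))) ≤ 1 := by
  set K : ℝ := 96 * 60000 * D * Λ with hK
  have hK0 : 0 ≤ K := by positivity
  have e2 : n ^ (1 / 8 : ℝ) ≠ 0 := by positivity
  have h3 : Λ * Real.sqrt n * (2 / n * 1 * (3 * D * 96 * (10000 * (3 * β) ^ (1 / 8 : ℝ) *
      n ^ (3 / 8 : ℝ)))) = K * ((3 * β) ^ (1 / 8 : ℝ)) / n ^ (1 / 8 : ℝ) := by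
    have e1 : Real.sqrt n * n ^ (3 / 8 : ℝ) * n ^ (1 / 8 : ℝ) = n := by
      rw [Real.sqrt_eq_rpow, ← Real.rpow_add hn, ← Real.rpow_add hn]
      norm_num
    rw [eq_div_iff e2, hK]
    calc _ = Λ * (2 / n * (3 * D * 96 * (10000 * (3 * β) ^ (1 / 8 : ℝ)))) *
          (Real.sqrt n * n ^ (3 / 8 : ℝ) * n ^ (1 / 8 : ℝ)) := by ring
      _ = _ := by rw [e1]; field_simp; ring
  rw [h3, div_le_one (by positivity)]
  calc K * (3 * β) ^ (1 / 8 : ℝ) = (K ^ 8 * (3 * β)) ^ (1 / 8 : ℝ) := by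
        rw [Real.mul_rpow (x := K ^ 8) (by positivity) (by positivity), ← Real.rpow_natCast K,
          ← Real.rpow_mul hK0]
        norm_num
    _ ≤ n ^ (1 / 8 : ℝ) := Real.rpow_le_rpow (by positivity) h (by norm_num)

/-- A sine polynomial with coefficients in `[-1, 1]`, only odd frequencies and degree `n = Q 4 ^ s`,
which has absolute value at least `Λ sqrt n / 2` wherever `rsSum (2 s + 2) (2 θ)` is small. The
factor `Λ` is arbitrary: it only influences how small the latter has to be, and `Q`. -/
theorem exists_large_sineSum {Λ : ℝ} (hΛ : 0 < Λ) : ∃ (Q : ℕ) (δ : ℝ), 96 ≤ Q ∧ 0 < δ ∧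
    ∀ s : ℕ, 2500 ≤ 2 ^ (2 * s) → ∃ x : ℕ → ℝ, (∀ k, |x k| ≤ 1) ∧ (∀ k, Even k → x k = 0) ∧
      (∀ k, Q * 2 ^ (2 * s) < k → x k = 0) ∧
      ∀ θ, |sineSum (Q * 2 ^ (2 * s)) x θ| ≤ Λ * Real.sqrt (Q * 2 ^ (2 * s)) ∧
        (δ * 2 ^ s ≤ ‖rsSum (2 * s + 2) (2 * θ)‖ ∨
          Λ * Real.sqrt (Q * 2 ^ (2 * s)) / 2 ≤ |sineSum (Q * 2 ^ (2 * s)) x θ|) := by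
  obtain ⟨κ, D, hκ, hcells⟩ := exists_card_small_cells_rsSum_le
  have hpi := Real.pi_pos
  set T : ℝ := D * (2 * Real.pi / κ + 1) with hT
  have hT0 : 0 ≤ T := by positivity
  set K : ℝ := 96 * 60000 * D * Λ with hK
  have hK0 : 0 ≤ K := by positivity
  obtain ⟨q, hq⟩ : ∃ q : ℕ, max (max 1000 ((3 * D + 3) * Real.pi / κ))
      (max (2 * Real.pi / κ) (K ^ 8 * (3 * T))) ≤ q :=
    ⟨_, Nat.le_ceil _⟩
  rw [max_le_iff, max_le_iff, max_le_iff] at hq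
  obtain ⟨⟨hq1, hq2⟩, hq3, hq4⟩ := hq
  have hq0 : (0 : ℝ) < q := by linarith
  have hqn : 0 < q := by exact_mod_cast hq0
  -- the cells have length `η / 4 ^ s` in the variable `2 θ`, and `η` is small in terms of `D` and `Λ`
  set η : ℝ := Real.pi / q with hη
  have hη0 : 0 < η := by positivity
  have hη64 : 2 * η ≤ 1 / 64 := by
    rw [hη, mul_div_assoc', div_le_div_iff₀ hq0 (by norm_num)]
    linarith [Real.pi_lt_four]
  obtain ⟨δ, hδ, hcells⟩ := hcells η hη0 (by linarith)
  set δ' := min δ (1 / 2) with hδ'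
  have hδ'0 : 0 < δ' := by positivity
  refine ⟨96 * q, δ', by omega, hδ'0, fun s hs => ?_⟩
  set L : ℕ := 2 ^ (2 * s) with hL
  have hL0 : 0 < L := by positivity
  have hLr : (L : ℝ) = 2 ^ (2 * s) := by rw [hL]; push_cast; rfl
  have hL0' : (0 : ℝ) < L := by exact_mod_cast hL0
  have hsqL : Real.sqrt (2 ^ (2 * s)) = 2 ^ s := by
    rw [show (2 : ℝ) ^ (2 * s) = (2 ^ s) ^ 2 by ring, Real.sqrt_sq (by positivity)]
  set C : ℕ := q * L with hC
  have hC0 : 0 < C := by positivity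
  have hCr : (C : ℝ) = q * L := by rw [hC]; push_cast; rfl
  have hnC : 96 * q * L = 96 * C := by rw [hC]; ring
  rw [hnC]
  set n : ℕ := 96 * C with hn
  have hn0 : 0 < n := by omega
  have hnr : (n : ℝ) = 96 * (C : ℝ) := by rw [hn]; push_cast; rfl
  have hn0' : (0 : ℝ) < n := by exact_mod_cast hn0
  have hsn : ((96 * q : ℕ) : ℝ) * 2 ^ (2 * s) = n := by
    rw [hnr, hCr, hLr]; push_cast; ring
  rw [hsn]
  classical
  have hcell : η / 2 ^ (2 * s) = 2 * (Real.pi / (2 * C)) := by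
    rw [hη, hCr, hLr]; field_simp
  set B := (Finset.range C).filter (fun c : ℕ => ∃ x : ℝ, c * (η / 2 ^ (2 * s)) ≤ x ∧
    x ≤ (c + 1) * (η / 2 ^ (2 * s)) ∧ ‖rsSum (2 * s + 2) x‖ < δ' * 2 ^ s) with hB
  have hBwin : ∀ W : ℕ, W * η ≤ κ → ∀ c₀, (B ∩ Finset.Ico c₀ (c₀ + W)).card ≤ D := by
    intro W hW c₀
    refine hcells (2 * s) hs _ c₀ W hW Finset.inter_subset_right fun i hi => ?_
    obtain ⟨-, x, hx1, hx2, hx3⟩ := Finset.mem_filter.1 (Finset.mem_inter.1 hi).1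
    refine ⟨x, hx1, hx2, hx3.le.trans ?_⟩
    rw [hsqL]
    gcongr
    exact min_le_left _ _
  -- a sine polynomial vanishes at the origin, so the first cells must not belong to `B`
  have hB01 : ∀ c : ℕ, c < 2 → c ∉ B := by
    intro c hc hcB
    obtain ⟨-, x, hx1, hx2, hx3⟩ := Finset.mem_filter.1 hcB
    have h2 : (2 : ℝ) ^ s ≤ ‖rsSum (2 * s + 2) x‖ := by
      refine norm_rsSum_ge_near_zero s ((by positivity : (0 : ℝ) ≤ c * (η / 2 ^ (2 * s))).trans hx1) ?_
      have hc' : (c : ℝ) + 1 ≤ 2 := by exact_mod_cast hc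
      calc x * 2 ^ (2 * s) ≤ (c + 1) * (η / 2 ^ (2 * s)) * 2 ^ (2 * s) := by gcongr
        _ ≤ 2 * (η / 2 ^ (2 * s)) * 2 ^ (2 * s) := by gcongr
        _ = 2 * η := by field_simp
        _ ≤ _ := hη64
    have h3 : δ' ≤ 1 / 2 := min_le_right _ _
    have : (0 : ℝ) < 2 ^ s := by positivity
    nlinarith
  -- a window of `3 D + 3` cells is short enough to contain at most `D` cells of `B`
  have hrunlen : ((3 * D + 3 : ℕ) : ℝ) * η ≤ κ := by
    rw [div_le_iff₀ hκ] at hq2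
    rw [hη, mul_div_assoc', div_le_iff₀ hq0]; push_cast
    linarith
  have hBcard : (B.card : ℝ) ≤ T * L := by
    set W := ⌊κ / η⌋₊ with hW
    have hκη : 2 ≤ κ / η := by
      rw [hη, div_div_eq_mul_div, le_div_iff₀ hpi]
      rw [div_le_iff₀ hκ] at hq3
      linarith
    have hW1 : κ / η < W + 1 := Nat.lt_floor_add_one _
    have hW2 : κ / η / 2 ≤ W := by linarith
    have hW0 : (0 : ℝ) < W := by linarith
    have hWη : W * η ≤ κ := by
      rw [← le_div_iff₀ hη0]; exact Nat.floor_le (by positivity)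
    have h1 := card_le_of_windows (B := B) (by exact_mod_cast hW0) (Finset.filter_subset _ _) (hBwin W hWη)
    have h2 : ((C / W : ℕ) : ℝ) ≤ 2 * Real.pi / κ * L := by
      refine Nat.cast_div_le.trans ?_
      rw [div_le_iff₀ hW0]
      calc (C : ℝ) = 2 * Real.pi / κ * L * (κ / η / 2) := by
            rw [hCr, hη]; field_simp
        _ ≤ _ := by gcongr
    have h3 : (B.card : ℝ) ≤ D * (((C / W : ℕ) : ℝ) + 1) := by exact_mod_cast h1
    have h4 : (1 : ℝ) ≤ L := by exact_mod_cast hL0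
    refine h3.trans ?_
    rw [hT, mul_assoc]
    gcongr
    linarith
  obtain ⟨τ, hτ1, hτ2, hτ3⟩ := exists_cell_signs (B := B) (C := C) (D := D) (b := 96) (by norm_num)
    (hB01 0 (by norm_num)) (hB01 1 (by norm_num)) (hBwin _ hrunlen)
    (fun k i => Real.sin ((k + 1 : ℕ) * gridPt (4 * n) (Real.pi / (4 * n)) i))
    (fun k i => Real.abs_sin_le_one _)
  set σ : ℕ → ℝ := fun i => τ (i / 96) with hσ
  set lam : ℝ := Λ * Real.sqrt n with hlam
  have hlam0 : 0 < lam := by positivity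
  set x : ℕ → ℝ := fun k => lam * sineCoeff n σ k with hx
  have hS : ∀ θ, sineSum n x θ = lam * sineSum n (sineCoeff n σ) θ := by
    intro θ
    rw [sineSum, sineSum, Finset.mul_sum]
    exact Finset.sum_congr rfl fun k _ => by simp only [hx]; ring
  have hx0 : ∀ k, Even k → x k = 0 := by
    intro k hk
    simp [hx, sineCoeff, hk]
  have hxbig : ∀ k, n < k → x k = 0 := by
    intro k hk
    have : tent n k = 0 := tent_eq_zero hn0 (by rw [Nat.abs_cast]; exact_mod_cast hk.le)
    simp [hx, sineCoeff, this]
  refine ⟨x, fun k => ?_, hx0, hxbig, fun θ => ⟨?_, ?_⟩⟩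
  · rcases Nat.even_or_odd k with he | ho
    · rw [hx0 k he]; simp
    rcases Nat.lt_or_ge n k with hkn | hkn
    · rw [hxbig k hkn]; simp
    obtain ⟨k, rfl⟩ : ∃ l, k = l + 1 := ⟨k - 1, by have := ho.pos; omega⟩
    have h1 := hτ3 ⟨k, by rw [← hn]; omega⟩
    simp only at h1
    have h2 : |x (k + 1)| ≤ lam * (2 / n * 1 * (3 * D * 96 *
        (10000 * (3 * B.card : ℝ) ^ (1 / 8 : ℝ) * (n : ℝ) ^ (3 / 8 : ℝ)))) := by
      simp only [hx, sineCoeff, if_neg (Nat.not_even_iff_odd.2 ho)]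
      rw [abs_mul, abs_of_pos hlam0, abs_mul, abs_mul, abs_of_pos (by positivity : (0 : ℝ) < 2 / n),
        abs_of_nonneg (tent_nonneg _ _)]
      rw [hnr]
      gcongr
      · exact tent_le_one _ _
      · exact_mod_cast h1
    refine h2.trans ?_
    refine coefficient_bound_le_one hn0' hΛ.le (Nat.cast_nonneg _) (Nat.cast_nonneg _) ?_
    calc K ^ 8 * (3 * B.card : ℝ) ≤ K ^ 8 * (3 * (T * L)) := by gcongr
      _ = K ^ 8 * (3 * T) * L := by ring
      _ ≤ q * L := by gcongr
      _ = C := hCr.symm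
      _ ≤ n := by rw [hnr]; linarith [show (0 : ℝ) ≤ C by positivity]
  · rw [hS, abs_mul, abs_of_pos hlam0]
    exact mul_le_of_le_one_right hlam0.le (abs_sineSum_sineCoeff_le hn0 (fun j => hτ1 _) θ)
  · obtain ⟨θ', hθ0, hθ1, m, hm⟩ := exists_fold θ
    rw [rsSum_fold _ hm, abs_sineSum_fold hx0 hm]
    obtain ⟨c, hcC, hc1, hc2⟩ := exists_cell hC0 hθ0 hθ1
    by_cases hcB : c ∈ B
    · right
      obtain ⟨α, hα, hατ⟩ := hτ2 c hcB
      have hc1' : 1 ≤ c := by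
        by_contra hcon
        exact hB01 c (by omega) hcB
      have := half_le_abs_sineSum (b := 96) le_rfl hc1' hcC hτ1 hα
        (fun c' _ h1 h2 => hατ c' h1 h2) hc1 hc2
      rw [hS, abs_mul, abs_of_pos hlam0]
      have := mul_le_mul_of_nonneg_left this hlam0.le
      linarith
    · left
      by_contra! hcon
      refine hcB (Finset.mem_filter.2 ⟨Finset.mem_range.2 hcC, 2 * θ', ?_, ?_, hcon⟩)
      · rw [hcell]; linarith
      · rw [hcell]; linarith

/-! ### From signs to Littlewood polynomials -/

/-- The coefficient of `z ^ j` in the polynomial of degree `2 n` whose coefficients around the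
middle are `ε k` at `n + k`, and `ε k` or `-ε k` at `n - k` according as `k` is an even number not
exceeding `m` or not. -/
def symmCoeff (n m : ℕ) (ε : ℕ → ℝ) (j : ℕ) : ℝ :=
  if n ≤ j then ε (j - n) else if n - j ≤ m ∧ Even (n - j) then ε (n - j) else -ε (n - j)

/-- The polynomial of degree `2 n` with the coefficients `symmCoeff n m ε`. -/
noncomputable def symmPoly (n m : ℕ) (ε : ℕ → ℝ) : Polynomial ℂ :=
  ∑ j ∈ Finset.range (2 * n + 1), Polynomial.C (symmCoeff n m ε j : ℂ) * Polynomial.X ^ j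

theorem coeff_symmPoly {n m : ℕ} {ε : ℕ → ℝ} {j : ℕ} (hj : j ≤ 2 * n) :
    (symmPoly n m ε).coeff j = symmCoeff n m ε j := by
  simp only [symmPoly, Polynomial.finsetSum_coeff, Polynomial.coeff_C_mul_X_pow]
  rw [Finset.sum_ite_eq]
  exact if_pos (Finset.mem_range.2 (by omega))

theorem symmCoeff_eq_or {n m : ℕ} {ε : ℕ → ℝ} (hε : ∀ k, ε k = 1 ∨ ε k = -1) (j : ℕ) :
    symmCoeff n m ε j = -1 ∨ symmCoeff n m ε j = 1 := by
  unfold symmCoeff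
  split_ifs
  · exact (hε _).symm
  · exact (hε _).symm
  · rcases hε (n - j) with h | h <;> rw [h] <;> simp

theorem isLittlewood_symmPoly {n m : ℕ} {ε : ℕ → ℝ} (hε : ∀ k, ε k = 1 ∨ ε k = -1) :
    IsLittlewood (2 * n) (symmPoly n m ε) := by
  have hc : ∀ j ≤ 2 * n, (symmPoly n m ε).coeff j = -1 ∨ (symmPoly n m ε).coeff j = 1 := by
    intro j hj
    rw [coeff_symmPoly hj]
    rcases symmCoeff_eq_or (n := n) (m := m) hε j with h | h <;> rw [h] <;> simp
  refine ⟨Polynomial.natDegree_eq_of_le_of_coeff_ne_zero ?_ ?_, hc⟩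
  · refine Polynomial.natDegree_sum_le_of_forall_le _ _ fun j hj => ?_
    refine (Polynomial.natDegree_C_mul_X_pow_le _ _).trans ?_
    have := Finset.mem_range.1 hj
    omega
  · rcases hc (2 * n) le_rfl with h | h <;> rw [h] <;> simp

theorem coeff_symmPoly_of_lt {n m : ℕ} (hm : m ≤ n) (ε : ℕ → ℝ) {j : ℕ} (hj : j < n - m) :
    (symmPoly n m ε).coeff j = -(symmPoly n m ε).coeff (2 * n - j) := by
  rw [coeff_symmPoly (by omega), coeff_symmPoly (by omega), symmCoeff, symmCoeff,
    if_neg (by omega), if_neg (by omega), if_pos (by omega), show 2 * n - j - n = n - j by omega]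
  push_cast; rfl

theorem coeff_symmPoly_of_ge {n m : ℕ} (ε : ℕ → ℝ) {j : ℕ} (hj : n - m ≤ j) (hjn : j ≤ n) :
    (symmPoly n m ε).coeff j = (-1 : ℂ) ^ (n - j) * (symmPoly n m ε).coeff (2 * n - j) := by
  rw [coeff_symmPoly (by omega), coeff_symmPoly (by omega)]
  rcases hjn.lt_or_eq with hlt | rfl
  · rw [symmCoeff, symmCoeff, if_neg (by omega), if_pos (by omega : n ≤ 2 * n - j),
      show 2 * n - j - n = n - j by omega]
    rcases Nat.even_or_odd (n - j) with he | ho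
    · rw [if_pos ⟨by omega, he⟩, he.neg_one_pow, one_mul]
    · rw [if_neg fun h => (Nat.not_even_iff_odd.2 ho) h.2, ho.neg_one_pow]; push_cast; ring
  · rw [Nat.sub_self, pow_zero, one_mul, show 2 * j - j = j by omega]

/-- The part of `z ^ (-n) P (z)` which is even in `θ`, where `z = exp (i θ)` and `P` is
`symmPoly n m ε`. -/
noncomputable def cosPart (n m : ℕ) (ε : ℕ → ℝ) (θ : ℝ) : ℝ :=
  ε 0 + 2 * ∑ k ∈ Finset.range n,
    if k + 1 ≤ m ∧ Even (k + 1) then ε (k + 1) * Real.cos ((k + 1) * θ) else 0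

/-- The coefficients of the part of `z ^ (-n) P (z)` which is odd in `θ`, divided by `2 i`. -/
def sinCoeff (m : ℕ) (ε : ℕ → ℝ) (k : ℕ) : ℝ := if k ≤ m ∧ Even k then 0 else ε k

/-- On the unit circle the two symmetry types of the coefficients separate `z ^ (-n) P (z)` into its
real part, a cosine polynomial, and its imaginary part, a sine polynomial. -/
theorem eval_symmPoly (n m : ℕ) (ε : ℕ → ℝ) (θ : ℝ) :
    (symmPoly n m ε).eval (expChar 1 θ) = expChar n θ *
      (cosPart n m ε θ + 2 * Complex.I * sineSum n (sinCoeff m ε) θ) := by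
  have h1 : (symmPoly n m ε).eval (expChar 1 θ) =
      ∑ j ∈ Finset.range (2 * n + 1), (symmCoeff n m ε j : ℂ) * expChar j θ := by
    simp [symmPoly, Polynomial.eval_finsetSum, expChar_natCast]
  have h2 : 2 * n + 1 = n + 1 + n := by ring
  rw [h1, h2, Finset.sum_range_add, Finset.sum_range_succ, ← Finset.sum_range_reflect, cosPart,
    sineSum]
  have h3 : symmCoeff n m ε n = ε 0 := by
    rw [symmCoeff, if_pos le_rfl, Nat.sub_self]
  rw [h3, add_right_comm, ← Finset.sum_add_distrib]
  have h4 : ∀ k ∈ Finset.range n,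
      (symmCoeff n m ε (n - 1 - k) : ℂ) * expChar ((n - 1 - k : ℕ) : ℤ) θ +
        symmCoeff n m ε (n + 1 + k) * expChar ((n + 1 + k : ℕ) : ℤ) θ =
      expChar n θ * (2 * ((if k + 1 ≤ m ∧ Even (k + 1) then ε (k + 1) * Real.cos ((k + 1) * θ)
        else 0 : ℝ) : ℂ) +
        2 * Complex.I * ((sinCoeff m ε (k + 1) * Real.sin ((k + 1) * θ) : ℝ) : ℂ)) := by
    intro k hk
    have hk := Finset.mem_range.1 hk
    have e1 : ((n - 1 - k : ℕ) : ℤ) = (n : ℤ) + -((k : ℤ) + 1) := by omega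
    have e2 : ((n + 1 + k : ℕ) : ℤ) = (n : ℤ) + ((k : ℤ) + 1) := by omega
    rw [e1, e2, expChar_add, expChar_add, symmCoeff, symmCoeff, if_neg (by omega),
      if_pos (by omega : n ≤ n + 1 + k), show n - (n - 1 - k) = k + 1 by omega,
      show n + 1 + k - n = k + 1 by omega, sinCoeff]
    have c1 := expChar_add_neg ((k : ℤ) + 1) θ
    have c2 := expChar_sub_neg ((k : ℤ) + 1) θ
    push_cast at c1 c2
    split_ifs with h
    · push_cast
      linear_combination (expChar n θ * ε (k + 1)) * c1
    · push_cast
      linear_combination (expChar n θ * ε (k + 1)) * c2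
  rw [Finset.sum_congr rfl h4, ← Finset.mul_sum, Finset.sum_add_distrib, ← Finset.mul_sum,
    ← Finset.mul_sum]
  push_cast
  ring

theorem norm_eval_symmPoly (n m : ℕ) (ε : ℕ → ℝ) (θ : ℝ) :
    |cosPart n m ε θ| ≤ ‖(symmPoly n m ε).eval (expChar 1 θ)‖ ∧
    2 * |sineSum n (sinCoeff m ε) θ| ≤ ‖(symmPoly n m ε).eval (expChar 1 θ)‖ ∧
    ‖(symmPoly n m ε).eval (expChar 1 θ)‖ ≤
      |cosPart n m ε θ| + 2 * |sineSum n (sinCoeff m ε) θ| := by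
  rw [eval_symmPoly, norm_mul, norm_expChar, one_mul]
  set w : ℂ := cosPart n m ε θ + 2 * Complex.I * sineSum n (sinCoeff m ε) θ with hw
  have hre : w.re = cosPart n m ε θ := by simp [hw]
  have him : w.im = 2 * sineSum n (sinCoeff m ε) θ := by simp [hw]
  rw [← hre, ← abs_two, ← abs_mul, ← him]
  exact ⟨Complex.abs_re_le_norm w, Complex.abs_im_le_norm w, Complex.norm_le_abs_re_add_abs_im w⟩

theorem exists_eq_expChar {z : ℂ} (hz : ‖z‖ = 1) : ∃ θ : ℝ, z = expChar 1 θ := by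
  refine ⟨z.arg, ?_⟩
  have := Complex.norm_mul_exp_arg_mul_I z
  rw [hz] at this
  simpa [expChar] using this.symm

/-! ### Small degrees -/

/-- Closed forms of the real part and of half the imaginary part for the polynomial all of whose
signs `ε k` are one. -/
theorem sin_mul_parts (θ : ℝ) (j : ℕ) :
    Real.sin θ * cosPart (2 * j) (2 * j) (fun _ => 1) θ = Real.sin ((2 * j + 1) * θ) ∧
    Real.sin θ * cosPart (2 * j + 1) (2 * j + 1) (fun _ => 1) θ = Real.sin ((2 * j + 1) * θ) ∧
    Real.sin θ * sineSum (2 * j) (sinCoeff (2 * j) fun _ => 1) θ = Real.sin (j * θ) ^ 2 ∧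
    Real.sin θ * sineSum (2 * j + 1) (sinCoeff (2 * j + 1) fun _ => 1) θ =
      Real.sin ((j + 1) * θ) ^ 2 := by
  have hA : ∀ n, cosPart n n (fun _ => 1) θ = 1 + 2 * ∑ k ∈ Finset.range n,
      if Even (k + 1) then Real.cos ((k + 1) * θ) else 0 := by
    intro n
    unfold cosPart
    congr 2
    refine Finset.sum_congr rfl fun k hk => ?_
    have : k + 1 ≤ n := Finset.mem_range.1 hk
    simp [this]
  have hB : ∀ n, sineSum n (sinCoeff n fun _ => 1) θ = ∑ k ∈ Finset.range n,
      if Even (k + 1) then 0 else Real.sin ((k + 1) * θ) := by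
    intro n
    unfold sineSum sinCoeff
    refine Finset.sum_congr rfl fun k hk => ?_
    have : k + 1 ≤ n := Finset.mem_range.1 hk
    simp [this]
  have hAo : ∀ j, cosPart (2 * j + 1) (2 * j + 1) (fun _ => 1) θ =
      cosPart (2 * j) (2 * j) (fun _ => 1) θ := by
    intro j
    rw [hA, hA, Finset.sum_range_succ, if_neg (by simp), add_zero]
  have hBo : ∀ j, Real.sin θ * sineSum (2 * j) (sinCoeff (2 * j) fun _ => 1) θ =
      Real.sin (j * θ) ^ 2 →
      Real.sin θ * sineSum (2 * j + 1) (sinCoeff (2 * j + 1) fun _ => 1) θ =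
      Real.sin ((j + 1) * θ) ^ 2 := by
    intro j h
    rw [hB] at h
    rw [hB, Finset.sum_range_succ, if_neg (by simp), mul_add, h]
    have e1 : ((2 * j : ℕ) + 1 : ℝ) * θ = j * θ + (j * θ + θ) := by push_cast; ring
    have e2 : ((j : ℝ) + 1) * θ = j * θ + θ := by ring
    rw [e1, e2, Real.sin_add (j * θ) (j * θ + θ), Real.sin_add, Real.cos_add]
    have s1 := Real.sin_sq_add_cos_sq θ
    have s2 := Real.sin_sq_add_cos_sq (j * θ)
    linear_combination -(Real.sin (j * θ) ^ 2) * s1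
  have main : ∀ j : ℕ,
      Real.sin θ * cosPart (2 * j) (2 * j) (fun _ => 1) θ = Real.sin ((2 * j + 1) * θ) ∧
      Real.sin θ * sineSum (2 * j) (sinCoeff (2 * j) fun _ => 1) θ = Real.sin (j * θ) ^ 2 := by
    intro j
    induction j with
    | zero => simp [cosPart, sineSum]
    | succ j ih =>
      constructor
      · have h1 := ih.1
        rw [← hAo, hA] at h1
        rw [hA, show 2 * (j + 1) = 2 * j + 1 + 1 by ring, Finset.sum_range_succ,
          if_pos (by simp [Nat.even_add_one])]
        have e1 : (2 * ((j + 1 : ℕ) : ℝ) + 1) * θ = (2 * j + 2) * θ + θ := by push_cast; ring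
        have e2 : (2 * (j : ℝ) + 1) * θ = (2 * j + 2) * θ - θ := by ring
        have e3 : ((2 * j + 1 : ℕ) + 1 : ℝ) * θ = (2 * j + 2) * θ := by push_cast; ring
        rw [e2, Real.sin_sub] at h1
        rw [e1, e3, Real.sin_add]
        linear_combination h1
      · have h1 := hBo j ih.2
        rw [hB] at h1
        rw [hB, show 2 * (j + 1) = 2 * j + 1 + 1 by ring, Finset.sum_range_succ,
          if_pos (by simp [Nat.even_add_one]), add_zero, h1]
        push_cast; rfl
  exact ⟨(main j).1, by rw [hAo]; exact (main j).1, (main j).2, hBo j (main j).2⟩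

/-- The polynomial with all signs `ε k` equal to one has no zero on the unit circle. -/
theorem eval_symmPoly_one_ne_zero (n : ℕ) (θ : ℝ) :
    (symmPoly n n fun _ => 1).eval (expChar 1 θ) ≠ 0 := by
  intro h0
  obtain ⟨h1, h2, -⟩ := norm_eval_symmPoly n n (fun _ => 1) θ
  rw [h0, norm_zero] at h1 h2
  have hA : cosPart n n (fun _ => 1) θ = 0 := abs_nonpos_iff.1 h1
  have hB : sineSum n (sinCoeff n fun _ => 1) θ = 0 := abs_nonpos_iff.1 (by linarith)
  have hsin : Real.sin θ = 0 := by
    rcases Nat.even_or_odd' n with ⟨j, rfl | rfl⟩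
    · obtain ⟨p1, -, p3, -⟩ := sin_mul_parts θ j
      rw [hA, mul_zero] at p1
      rw [hB, mul_zero] at p3
      have p4 : Real.sin (j * θ) = 0 := pow_eq_zero_iff two_ne_zero |>.1 p3.symm
      have e : (2 * (j : ℝ) + 1) * θ = 2 * (j * θ) + θ := by ring
      rw [e, Real.sin_add, Real.sin_two_mul, Real.cos_two_mul', p4] at p1
      have := Real.sin_sq_add_cos_sq (j * θ)
      rw [p4] at this
      have e2 : Real.cos (j * θ) ^ 2 = 1 := by linarith
      rw [e2] at p1
      linarith
    · obtain ⟨-, p2, -, p4⟩ := sin_mul_parts θ j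
      rw [hA, mul_zero] at p2
      rw [hB, mul_zero] at p4
      have p5 : Real.sin ((j + 1) * θ) = 0 := pow_eq_zero_iff two_ne_zero |>.1 p4.symm
      have e : (2 * (j : ℝ) + 1) * θ = 2 * ((j + 1) * θ) - θ := by ring
      rw [e, Real.sin_sub, Real.sin_two_mul, Real.cos_two_mul', p5] at p2
      have := Real.sin_sq_add_cos_sq ((j + 1) * θ)
      rw [p5] at this
      have e2 : Real.cos ((j + 1) * θ) ^ 2 = 1 := by linarith
      rw [e2] at p2
      linarith
  obtain ⟨l, rfl⟩ := Real.sin_eq_zero_iff.1 hsin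
  -- at the multiples of `π` all cosines of even frequency are equal to one
  have hpos : 0 ≤ ∑ k ∈ Finset.range n, if k + 1 ≤ n ∧ Even (k + 1) then
      (1 : ℝ) * Real.cos ((k + 1) * (l * Real.pi)) else 0 := by
    refine Finset.sum_nonneg fun k _ => ?_
    split_ifs with h
    · obtain ⟨r, hr⟩ := h.2
      have : ((k : ℝ) + 1) * (l * Real.pi) = ((r * l : ℤ) : ℝ) * (2 * Real.pi) := by
        have : ((k : ℝ) + 1) = r + r := by exact_mod_cast hr
        rw [this]; push_cast; ring
      rw [this, Real.cos_int_mul_two_pi]; norm_num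
    · exact le_rfl
  unfold cosPart at hA
  linarith

theorem exists_bounds_symmPoly_one (n : ℕ) : ∃ c C : ℝ, 0 < c ∧ ∀ z : ℂ, ‖z‖ = 1 →
    c ≤ ‖(symmPoly n n fun _ => 1).eval z‖ ∧ ‖(symmPoly n n fun _ => 1).eval z‖ ≤ C := by
  have hK : IsCompact (Metric.sphere (0 : ℂ) 1) := isCompact_sphere 0 1
  have hne : (Metric.sphere (0 : ℂ) 1).Nonempty := ⟨1, by simp⟩
  have hcont : ContinuousOn (fun z : ℂ => ‖(symmPoly n n fun _ => 1).eval z‖)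
      (Metric.sphere (0 : ℂ) 1) := (Polynomial.continuous _).norm.continuousOn
  obtain ⟨z₀, hz₀, hmin⟩ := hK.exists_isMinOn hne hcont
  obtain ⟨z₁, -, hmax⟩ := hK.exists_isMaxOn hne hcont
  refine ⟨_, _, ?_, fun z hz => ⟨hmin (by simpa using hz), hmax (by simpa using hz)⟩⟩
  obtain ⟨θ, rfl⟩ := exists_eq_expChar (by simpa using hz₀)
  exact norm_pos_iff.2 (eval_symmPoly_one_ne_zero n θ)

theorem exists_uniform_bounds (N : ℕ) : ∃ c C : ℝ, 0 < c ∧ ∀ n, 1 ≤ n → n < N →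
    ∀ z : ℂ, ‖z‖ = 1 → c * Real.sqrt (2 * n) ≤ ‖(symmPoly n n fun _ => 1).eval z‖ ∧
      ‖(symmPoly n n fun _ => 1).eval z‖ ≤ C * Real.sqrt (2 * n) := by
  induction N with
  | zero => exact ⟨1, 1, one_pos, fun n _ h => absurd h (by omega)⟩
  | succ N ih =>
    obtain ⟨c, C, hc, h⟩ := ih
    rcases Nat.eq_zero_or_pos N with rfl | hN
    · exact ⟨1, 1, one_pos, fun n h1 h2 => absurd h2 (by omega)⟩
    obtain ⟨c', C', hc', h'⟩ := exists_bounds_symmPoly_one N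
    have hs : 0 < Real.sqrt (2 * N) := Real.sqrt_pos.2 (by positivity)
    refine ⟨min c (c' / Real.sqrt (2 * N)), max C (C' / Real.sqrt (2 * N)), by positivity,
      fun n h1 h2 z hz => ?_⟩
    rcases Nat.lt_succ_iff_lt_or_eq.1 h2 with h3 | rfl
    · obtain ⟨a1, a2⟩ := h n h1 h3 z hz
      refine ⟨le_trans ?_ a1, a2.trans ?_⟩
      · gcongr; exact min_le_left _ _
      · gcongr; exact le_max_left _ _
    · obtain ⟨a1, a2⟩ := h' z hz
      constructor
      · refine le_trans ?_ a1
        rw [← le_div_iff₀ hs]; exact min_le_right _ _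
      · refine a2.trans ?_
        rw [← div_le_iff₀ hs]; exact le_max_right _ _

/-! ### Large degrees -/

/-- `norm_trigSum_le_of_grid` for sine polynomials. -/
theorem abs_sineSum_le_of_grid {n : ℕ} (hn : 0 < n) (d : ℕ → ℝ) {A : ℝ}
    (hA : ∀ j ∈ Finset.range (3 * n), |sineSum n d (gridPt (3 * n) 0 j)| ≤ A) (θ : ℝ) :
    |sineSum n d θ| ≤ 3 * A := by
  set c : ℤ → ℂ := fun k => if 0 < k then d k.natAbs / (2 * Complex.I) else
    if k < 0 then -d k.natAbs / (2 * Complex.I) else 0 with hc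
  have h : ∀ x, trigSum c n x = sineSum n d x := by
    intro x
    rw [trigSum, sum_Icc_neg_eq, sineSum]
    have h0 : c 0 = 0 := by simp [hc]
    rw [h0, zero_mul, zero_add]
    push_cast
    refine Finset.sum_congr rfl fun k _ => ?_
    have h1 : c ((k : ℤ) + 1) = d (k + 1) / (2 * Complex.I) := by
      have : ((k : ℤ) + 1).natAbs = k + 1 := by omega
      simp only [hc]; rw [if_pos (by omega), this]
    have h2 : c (-((k : ℤ) + 1)) = -d (k + 1) / (2 * Complex.I) := by
      have : (-((k : ℤ) + 1)).natAbs = k + 1 := by omega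
      simp only [hc]; rw [if_neg (by omega), if_pos (by omega), this]
    have h3 := expChar_sub_neg ((k : ℤ) + 1) x
    push_cast at h3
    rw [h1, h2]
    have hI := Complex.I_ne_zero
    calc _ = d (k + 1) / (2 * Complex.I) * (expChar ((k : ℤ) + 1) x - expChar (-((k : ℤ) + 1)) x) := by
          ring
      _ = _ := by rw [h3]; field_simp
  have hA' : ∀ j ∈ Finset.range (3 * n), ‖trigSum c n (gridPt (3 * n) 0 j)‖ ≤ A := by
    intro j hj
    rw [h, Complex.norm_real]; exact hA j hj
  have := norm_trigSum_le_of_grid hn le_rfl hA' θ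
  rwa [h, Complex.norm_real] at this

theorem sum_even_eq {N n : ℕ} (hN : 2 * N ≤ n) (g : ℕ → ℝ) :
    ∑ k ∈ Finset.range n, (if k + 1 ≤ 2 * N ∧ Even (k + 1) then g (k + 1) else 0) =
      ∑ l ∈ Finset.range N, g (2 * (l + 1)) := by
  rw [← Finset.sum_filter]
  have : (Finset.range n).filter (fun k => k + 1 ≤ 2 * N ∧ Even (k + 1)) =
      (Finset.range N).image fun l => 2 * l + 1 := by
    ext k
    simp only [Finset.mem_filter, Finset.mem_range, Finset.mem_image]
    constructor
    · rintro ⟨h1, h2, r, hr⟩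
      exact ⟨r - 1, by omega, by omega⟩
    · rintro ⟨l, hl, rfl⟩
      exact ⟨by omega, by omega, ⟨l + 1, by ring⟩⟩
  rw [this, Finset.sum_image (by intro a _ b _ h; simpa using h)]
  exact Finset.sum_congr rfl fun l _ => by congr 1

/-- Rounding the coefficients of a sine polynomial to signs, at the frequencies which are odd or
exceed `m`, with error `O(sqrt n)` on the whole circle. The remaining signs can be prescribed. -/
theorem exists_rounded_signs {n : ℕ} (hn : 0 < n) (m : ℕ) {x : ℕ → ℝ} (hx : ∀ k, |x k| ≤ 1)
    (hx0 : ∀ k, Even k → x k = 0) {r : ℕ → ℝ} (hr : ∀ k, r k = 1 ∨ r k = -1) :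
    ∃ ε : ℕ → ℝ, (∀ k, ε k = 1 ∨ ε k = -1) ∧ (∀ k, k ≤ m → Even k → ε k = r k) ∧
      ∀ θ, |sineSum n (sinCoeff m ε) θ - sineSum n x θ| ≤ 60000 * Real.sqrt n := by
  classical
  set V := (Finset.range n).filter fun k => ¬ (k + 1 ≤ m ∧ Even (k + 1)) with hV
  have hVn : V.card ≤ n := (Finset.card_filter_le _ _).trans (Finset.card_range n).le
  have hn' : (0 : ℝ) < n := by exact_mod_cast hn
  -- one linear form for each point of a grid which is fine enough for sampling
  obtain ⟨e, he, hed⟩ := exists_signs_approx (κ := Fin (3 * n)) V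
    (a := fun j k => Real.sin (((k : ℕ) + 1) * gridPt (3 * n) 0 j))
    (fun j k => Real.abs_sin_le_one _) (by rw [Fintype.card_fin]; omega) (fun k => x (k + 1))
    (fun k => hx _)
  set ε : ℕ → ℝ := fun k => if k ≤ m ∧ Even k then r k else e (k - 1) with hε
  refine ⟨ε, fun k => ?_, fun k h1 h2 => if_pos ⟨h1, h2⟩, fun θ => ?_⟩
  · simp only [hε]
    split_ifs
    · exact hr k
    · exact he _
  have hdiff : ∀ y, sineSum n (sinCoeff m ε) y - sineSum n x y =
      ∑ k ∈ V, Real.sin ((k + 1) * y) * (e k - x (k + 1)) := by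
    intro y
    rw [sineSum, sineSum, ← Finset.sum_sub_distrib, hV, Finset.sum_filter]
    refine Finset.sum_congr rfl fun k _ => ?_
    simp only [sinCoeff, hε]
    by_cases h : k + 1 ≤ m ∧ Even (k + 1)
    · rw [if_pos h, if_neg (not_not.2 h), hx0 _ h.2]; ring
    · rw [if_neg h, if_neg h, if_pos h, Nat.add_sub_cancel]; ring
  have hsub : ∀ y, sineSum n (sinCoeff m ε) y - sineSum n x y =
      sineSum n (fun k => sinCoeff m ε k - x k) y := by
    intro y
    rw [sineSum, sineSum, sineSum, ← Finset.sum_sub_distrib]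
    exact Finset.sum_congr rfl fun k _ => by ring
  rw [hsub]
  have h3 : 60000 * Real.sqrt n = 3 * (20000 * Real.sqrt n) := by ring
  rw [h3]
  refine abs_sineSum_le_of_grid hn _ (fun j hj => ?_) θ
  rw [← hsub, hdiff]
  refine (hed ⟨j, Finset.mem_range.1 hj⟩).trans ?_
  rw [Fintype.card_fin]
  have e1 : (V.card : ℝ) ^ (1 / 8 : ℝ) ≤ (n : ℝ) ^ (1 / 8 : ℝ) :=
    Real.rpow_le_rpow (by positivity) (by exact_mod_cast hVn) (by norm_num)
  have e2 : (((3 * n : ℕ) : ℝ)) ^ (3 / 8 : ℝ) ≤ 2 * (n : ℝ) ^ (3 / 8 : ℝ) := by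
    push_cast
    rw [Real.mul_rpow (by norm_num) hn'.le]
    gcongr
    calc (3 : ℝ) ^ (3 / 8 : ℝ) ≤ 4 ^ (1 / 2 : ℝ) :=
          (Real.rpow_le_rpow (by norm_num) (by norm_num) (by norm_num)).trans
            (Real.rpow_le_rpow_of_exponent_le (by norm_num) (by norm_num))
      _ = 2 := by
          rw [← Real.sqrt_eq_rpow, show (4 : ℝ) = 2 * 2 by norm_num, Real.sqrt_mul_self (by norm_num)]
  have e3 : (n : ℝ) ^ (1 / 8 : ℝ) * (n : ℝ) ^ (3 / 8 : ℝ) = Real.sqrt n := by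
    rw [Real.sqrt_eq_rpow, ← Real.rpow_add hn']; norm_num
  calc 10000 * (V.card : ℝ) ^ (1 / 8 : ℝ) * (((3 * n : ℕ) : ℝ)) ^ (3 / 8 : ℝ)
      ≤ 10000 * (n : ℝ) ^ (1 / 8 : ℝ) * (2 * (n : ℝ) ^ (3 / 8 : ℝ)) := by gcongr
    _ = 20000 * ((n : ℝ) ^ (1 / 8 : ℝ) * (n : ℝ) ^ (3 / 8 : ℝ)) := by ring
    _ = _ := by rw [e3]

theorem sineSum_eq_of_le {n₀ n : ℕ} (h : n₀ ≤ n) {x : ℕ → ℝ} (hx : ∀ k, n₀ < k → x k = 0) (θ : ℝ) :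
    sineSum n x θ = sineSum n₀ x θ := by
  refine (Finset.sum_subset (Finset.range_subset_range.2 h) fun k _ hk => ?_).symm
  rw [hx _ (by rw [Finset.mem_range] at hk; omega), zero_mul]

/-- All sufficiently large degrees. The cosine part is `rsSum` on the even frequencies, evaluated at
`2 θ`; the sine part is obtained by rounding the polynomial of `exists_large_sineSum`. The level of
`rsSum` is the largest one allowed by `n`, which makes `m` comparable to `n`. -/
theorem exists_large_degree : ∃ (N : ℕ) (η c C : ℝ), 0 < η ∧ 0 < c ∧ ∀ n, N ≤ n → 1 ≤ n →
    ∃ (m : ℕ) (ε : ℕ → ℝ), (∀ k, ε k = 1 ∨ ε k = -1) ∧ η * n ≤ m ∧ m ≤ n ∧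
      ∀ θ, c * Real.sqrt n ≤ ‖(symmPoly n m ε).eval (expChar 1 θ)‖ ∧
        ‖(symmPoly n m ε).eval (expChar 1 θ)‖ ≤ C * Real.sqrt n := by
  -- with this `Λ` the lower bound `Λ sqrt (Q 4 ^ s) / 2 ≥ Λ sqrt n / 4` exceeds the rounding error
  -- `60000 sqrt n`
  obtain ⟨Q, δ, hQ, hδ, hS⟩ := exists_large_sineSum (Λ := 4 * 60001) (by norm_num)
  have hQ0 : (0 : ℝ) < Q := by exact_mod_cast (by omega : 0 < Q)
  refine ⟨Q * 4 ^ 6, 2 / Q, min 1 (δ / (2 * Real.sqrt Q)), 1000000, by positivity, by positivity,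
    fun n hn hn1 => ?_⟩
  set s := Nat.log 4 (n / Q) with hs
  have hdiv : 4 ^ 6 ≤ n / Q := by
    rw [Nat.le_div_iff_mul_le (by omega), mul_comm]; exact hn
  have hs6 : 6 ≤ s := Nat.le_log_of_pow_le (by norm_num) hdiv
  have h4 : (4 : ℕ) ^ s = 2 ^ (2 * s) := by rw [pow_mul]; norm_num
  set L : ℕ := 2 ^ (2 * s) with hL
  have hlow : Q * L ≤ n := by
    have := Nat.pow_log_le_self 4 (x := n / Q) (by omega)
    rw [← hs, h4, Nat.le_div_iff_mul_le (by omega)] at this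
    rwa [mul_comm]
  have hupp : n < 4 * (Q * L) := by
    have := Nat.lt_pow_succ_log_self (b := 4) (by norm_num) (n / Q)
    rw [← hs, pow_succ, h4, Nat.div_lt_iff_lt_mul (by omega)] at this
    calc n < L * 4 * Q := this
      _ = _ := by ring
  have hL2500 : 2500 ≤ L := by
    calc 2500 ≤ 2 ^ (2 * 6) := by norm_num
      _ ≤ _ := Nat.pow_le_pow_right (by norm_num) (by omega)
  obtain ⟨x, hx1, hx0, hxbig, hxθ⟩ := hS s hL2500
  rw [← hL] at hxbig
  have hLr : (2 : ℝ) ^ (2 * s) = L := by rw [hL]; push_cast; rfl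
  have h96 : 96 * L ≤ n := (Nat.mul_le_mul_right L hQ).trans hlow
  set m := 2 * 2 ^ (2 * s + 2) with hm
  have hmL : m = 8 * L := by rw [hm, hL, pow_add]; ring
  have hmn : m ≤ n := by omega
  obtain ⟨ε, hε, hεr, hεθ⟩ := exists_rounded_signs (n := n) (by omega) m hx1 hx0
    (r := fun k => rsCoeff (2 * s + 2) ((k / 2 : ℕ) : ℤ)) (fun k => rsCoeff_eq_or _ _)
  have hcos : ∀ θ, |cosPart n m ε θ| = ‖rsSum (2 * s + 2) (2 * θ)‖ := by
    intro θ
    rw [rsSum_eq_ofReal, Complex.norm_real, Real.norm_eq_abs, cosPart]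
    have h0 : ε 0 = 1 := by
      rw [hεr 0 (Nat.zero_le _) (by simp)]
      simpa using rsCoeff_zero (2 * s + 2)
    have h1 := sum_even_eq (N := 2 ^ (2 * s + 2)) (n := n) hmn
      (fun k => ε k * Real.cos (k * θ))
    push_cast at h1
    rw [h0, hm, h1]
    congr 3
    refine Finset.sum_congr rfl fun l hl => ?_
    have := Finset.mem_range.1 hl
    rw [hεr (2 * (l + 1)) (by omega) ⟨l + 1, by ring⟩]
    have e : ((2 * (l + 1) / 2 : ℕ) : ℤ) = (l : ℤ) + 1 := by omega
    rw [e, rsCoeff_succ]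
    ring_nf
  have hn0 : (0 : ℝ) < n := by exact_mod_cast hn1
  have hsn : 0 < Real.sqrt n := Real.sqrt_pos.2 hn0
  have hlow' : (Q : ℝ) * L ≤ n := by exact_mod_cast hlow
  have hupp' : (n : ℝ) ≤ 4 * (Q * L) := by exact_mod_cast hupp.le
  have hsqL : Real.sqrt L = 2 ^ s := by
    rw [← hLr, show (2 : ℝ) ^ (2 * s) = (2 ^ s) ^ 2 by ring, Real.sqrt_sq (by positivity)]
  have hs1 : Real.sqrt (Q * L) ≤ Real.sqrt n := Real.sqrt_le_sqrt hlow'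
  have hs2 : Real.sqrt n ≤ 2 * Real.sqrt (Q * L) := by
    refine (Real.sqrt_le_sqrt hupp').trans (le_of_eq ?_)
    rw [Real.sqrt_mul (by norm_num), show (4 : ℝ) = 2 * 2 by norm_num,
      Real.sqrt_mul_self (by norm_num)]
  refine ⟨m, ε, hε, ?_, hmn, fun θ => ?_⟩
  · rw [hmL, div_mul_eq_mul_div, div_le_iff₀ hQ0]; push_cast
    nlinarith
  obtain ⟨b1, b2, b3⟩ := norm_eval_symmPoly n m ε θ
  obtain ⟨x1, x2⟩ := hxθ θ
  rw [← hL, hLr, ← sineSum_eq_of_le hlow hxbig θ] at x1 x2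
  have hd := hεθ θ
  have t1 := abs_sub_abs_le_abs_sub (sineSum n (sinCoeff m ε) θ) (sineSum n x θ)
  have t2 := abs_sub_abs_le_abs_sub (sineSum n x θ) (sineSum n (sinCoeff m ε) θ)
  rw [abs_sub_comm] at t2
  constructor
  · rcases x2 with h | h
    · rw [← hcos] at h
      have h2 : δ / (2 * Real.sqrt Q) * Real.sqrt n ≤ δ * 2 ^ s := by
        rw [← hsqL, div_mul_eq_mul_div, div_le_iff₀ (by positivity)]
        rw [Real.sqrt_mul hQ0.le] at hs2
        nlinarith
      calc _ ≤ δ / (2 * Real.sqrt Q) * Real.sqrt n := by gcongr; exact min_le_right _ _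
        _ ≤ _ := h2.trans (h.trans b1)
    · calc _ ≤ 1 * Real.sqrt n := by gcongr; exact min_le_left _ _
        _ ≤ _ := by linarith
  · have h1 : |cosPart n m ε θ| ≤ 8 * Real.sqrt n := by
      rw [hcos]
      refine (norm_rsSum_le _ _).trans ?_
      have : (2 : ℝ) ^ (2 * s + 2) ≤ 4 * n := by
        rw [pow_add, hLr]
        have : (96 : ℝ) * L ≤ n := by exact_mod_cast h96
        have : (0 : ℝ) ≤ L := by positivity
        linarith
      have h2 := Real.sqrt_le_sqrt this
      rw [Real.sqrt_mul (by norm_num), show (4 : ℝ) = 2 * 2 by norm_num,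
        Real.sqrt_mul_self (by norm_num)] at h2
      linarith
    linarith

theorem theorem1p2 :
    ∃ η₁ η₂ η : ℝ, 0 < η₁ ∧ η₁ < η₂ ∧ 0 < η ∧
      ∃ (P : ℕ → Polynomial ℂ) (m : ℕ → ℕ), ∀ n : ℕ, 1 ≤ n →
        IsLittlewood (2 * n) (P n) ∧
        (∀ z : ℂ, ‖z‖ = 1 →
          η₁ * Real.sqrt (2 * (n : ℝ)) ≤ ‖(P n).eval z‖ ∧
          ‖(P n).eval z‖ ≤ η₂ * Real.sqrt (2 * (n : ℝ))) ∧
        η * (n : ℝ) ≤ (m n : ℝ) ∧ m n ≤ n ∧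
        (∀ j : ℕ, j < n - m n → (P n).coeff j = -(P n).coeff (2 * n - j)) ∧
        (∀ j : ℕ, n - m n ≤ j → j ≤ n →
          (P n).coeff j = (-1 : ℂ) ^ (n - j) * (P n).coeff (2 * n - j)) := by
  obtain ⟨N, η, c, C, hη, hc, hlarge⟩ := exists_large_degree
  obtain ⟨c', C', hc', hsmall⟩ := exists_uniform_bounds N
  set η₁ := min (c / 2) c' with hη₁
  set η₂ := max (max |C| C') (η₁ + 1) with hη₂
  have hη₁0 : 0 < η₁ := by positivity
  have hη₂' : η₁ < η₂ := lt_of_lt_of_le (by linarith) (le_max_right _ _)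
  have key : ∀ n : ℕ, ∃ (m : ℕ) (ε : ℕ → ℝ), 1 ≤ n → (∀ k, ε k = 1 ∨ ε k = -1) ∧
      (∀ z : ℂ, ‖z‖ = 1 → η₁ * Real.sqrt (2 * (n : ℝ)) ≤ ‖(symmPoly n m ε).eval z‖ ∧
        ‖(symmPoly n m ε).eval z‖ ≤ η₂ * Real.sqrt (2 * (n : ℝ))) ∧
      min η 1 * (n : ℝ) ≤ m ∧ m ≤ n := by
    intro n
    have hn0 : (0 : ℝ) ≤ n := Nat.cast_nonneg n
    rcases Nat.lt_or_ge n N with h | h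
    · refine ⟨n, fun _ => 1, fun hn => ⟨fun _ => Or.inl rfl, fun z hz => ?_, ?_, le_rfl⟩⟩
      · obtain ⟨h1, h2⟩ := hsmall n hn h z hz
        refine ⟨le_trans ?_ h1, h2.trans ?_⟩
        · gcongr; exact min_le_right _ _
        · gcongr; exact (le_max_right _ _).trans (le_max_left _ _)
      · exact mul_le_of_le_one_left hn0 (min_le_right _ _)
    · by_cases hn : 1 ≤ n
      · obtain ⟨m, ε, hε, hm1, hm2, hθ⟩ := hlarge n h hn
        refine ⟨m, ε, fun _ => ⟨hε, fun z hz => ?_, le_trans ?_ hm1, hm2⟩⟩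
        · obtain ⟨θ, rfl⟩ := exists_eq_expChar hz
          obtain ⟨h1, h2⟩ := hθ θ
          have s1 : Real.sqrt n ≤ Real.sqrt (2 * n) := Real.sqrt_le_sqrt (by linarith)
          have s2 : Real.sqrt (2 * n) ≤ 2 * Real.sqrt n := by
            rw [Real.sqrt_le_left (by positivity), mul_pow, Real.sq_sqrt hn0]; linarith
          constructor
          · refine le_trans ?_ h1
            calc η₁ * Real.sqrt (2 * n) ≤ c / 2 * (2 * Real.sqrt n) := by
                  gcongr; exact min_le_left _ _
              _ = _ := by ring
          · refine h2.trans ?_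
            calc C * Real.sqrt n ≤ |C| * Real.sqrt (2 * n) := by
                  gcongr; exact le_abs_self C
              _ ≤ _ := by
                  gcongr; exact (le_max_left _ _).trans (le_max_left _ _)
        · gcongr; exact min_le_left _ _
      · exact ⟨0, fun _ => 1, fun h => absurd h hn⟩
  choose m ε hmε using key
  refine ⟨η₁, η₂, min η 1, hη₁0, hη₂', by positivity, fun n => symmPoly n (m n) (ε n), m,
    fun n hn => ?_⟩
  obtain ⟨h1, h2, h3, h4⟩ := hmε n hn
  exact ⟨isLittlewood_symmPoly h1, h2, h3, h4, fun j hj => coeff_symmPoly_of_lt h4 _ hj,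
    fun j hj hjn => coeff_symmPoly_of_ge _ hj hjn⟩
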